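/- Let $\mathcal V=(\mathcal V_0,\otimes,I)$ be a symmetric monoidal closed category with $\mathcal V_0$ complete and cocomplete; categories, functors, adjunctions, limits and colimits below are $\mathcal V$-enriched (limits and colimits are weighted), and $[\mathcal A,\mathcal V]$ is the $\mathcal V$-category of $\mathcal V$-functors $\mathcal A\to\mathcal V$. A weight is a presheaf $\mathcal A^{\mathrm{op}}\to\mathcal V$ that is a small colimit of representables. Let $\Phi$ be a class of weights that is locally small: for every small $\mathcal A$ the closure of the representables in $[\mathcal A^{\mathrm{op}},\mathcal V]$ under $\Phi$-colimits is (essentially) small. Assume Axiom A: if $\mathcal A$ is a small $\mathcal V$-category with $\Phi$-limits and $F:\mathcal A\to\mathcal V$ is $\Phi$-continuous (preserves $\Phi$-limits), then $F*-:[\mathcal A^{\mathrm{op}},\mathcal V]\to\mathcal V$ (the left Kan extension of $F$ along the Yoneda embedding) is $\Phi$-continuous. Let $\mathcal T$ be a $\Phi$-theory, that is, a small $\mathcal V$-category with $\Phi$-limits, and let $\Phi\text{-}\mathbf{Mod}(\mathcal T)$ be the full subcategory of $[\mathcal T,\mathcal V]$ consisting of the models, that is, of the $\Phi$-continuous $\mathcal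 V$-functors $\mathcal T\to\mathcal V$. Then: 1. $\Phi\text{-}\mathbf{Mod}(\mathcal T)$ is reflective in $[\mathcal T,\mathcal V]$. Explicitly, let $J:\mathcal T\to\mathcal F\mathcal T$ be the free completion of $\mathcal T$ under $\Phi$-limits (the closure of the representables in $[\mathcal T,\mathcal V]^{\mathrm{op}}$ under $\Phi$-limits). Then $J$ has a right adjoint $R$; every $F:\mathcal T\to\mathcal V$ extends to a $\Phi$-continuous $\widehat F:\mathcal F\mathcal T\to\mathcal V$ with $\widehat FJ\cong F$; and for every such $\widehat F$ the pointwise left Kan extension $L=\mathrm{Lan}_R\widehat F:\mathcal T\to\mathcal V$ exists and is the reflection of $F$ into the models. Its unit $F\to L$ is the transformation whose composite with $L\to LRJ$ (induced by the unit $1\to RJ$ of $J\dashv R$) is $F\cong\widehat FJ\to LRJ$. 2. $\Phi\text{-}\mathbf{Mod}(\mathcal T)$ is complete and cocomplete. 3. $\Phi\text{-}\mathbf{Mod}(\mathcal T)$ is closed in $[\mathcal T,\mathcal V]$ under all limits, and under all $\Phi$-flat colimits, that is, the colimits whose weight $G$ is such that $G$-weighted colimits commute in $\mathcal V$ with $\Phi$-limits.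 -/

import Mathlib

open CategoryTheory MonoidalCategory Limits Opposite BraidedCategory
open scoped CategoryTheory.MonoidalClosed
open CategoryTheory.MonoidalClosed (curry uncurry uncurry_curry uncurry_natural_left uncurry_eq
  uncurry_injective curry_injective curry_natural_left compTranspose compTranspose_eq)

universe w w₁ w₂ w₃ v u u₁ u₂ u₃

noncomputable section

namespace EnrichedModels

section Basic

variable (V : Type u) [Category.{v} V] [MonoidalCategory V]

/-- The hom-object `K(X, Y)` of a `V`-category `K`. -/
abbrev eHom {K : Type u₁} [EnrichedCategory V K] (X Y : K) : V :=
  EnrichedCategory.Hom X Y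

variable {V}

/-- For an arrow `f : X ⟶ Y` of the underlying category, the map
`K(f, Z) : K(Y, Z) ⟶ K(X, Z)`. -/
def precomp {K : Type u₁} [EnrichedCategory V K] {X Y : K}
    (f : 𝟙_ V ⟶ eHom V X Y) (Z : K) : eHom V Y Z ⟶ eHom V X Z :=
  (λ_ _).inv ≫ f ▷ _ ≫ eComp V X Y Z

/-- An arrow `f : X ⟶ Y` of the underlying category of a `V`-category is an isomorphism. -/
def IsIsoArrow {K : Type u₁} [EnrichedCategory V K] {X Y : K} (f : 𝟙_ V ⟶ eHom V X Y) : Prop :=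
  IsIso (ForgetEnrichment.homOf V f)

/-- The full sub-`V`-category of `K` on the objects that satisfy `P`. -/
structure FullSub {K : Type u₁} (P : K → Prop) where
  obj : K
  property : P obj

instance {K : Type u₁} [EnrichedCategory V K] (P : K → Prop) :
    EnrichedCategory V (FullSub P) where
  Hom X Y := eHom V X.obj Y.obj
  id X := eId V X.obj
  comp X Y Z := eComp V X.obj Y.obj Z.obj
  id_comp X Y := e_id_comp V X.obj Y.obj
  comp_id X Y := e_comp_id V X.obj Y.obj
  assoc W X Y Z := e_assoc V W.obj X.obj Y.obj Z.obj

/-- The inclusion of a full sub-`V`-category. -/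
def FullSub.ι {K : Type u₁} [EnrichedCategory V K] (P : K → Prop) :
    EnrichedFunctor V (FullSub P) K where
  obj X := X.obj
  map _ _ := 𝟙 _
  map_id _ := Category.comp_id _
  map_comp X Y Z := by
    rw [Category.comp_id, id_tensorHom_id, Category.id_comp]
    rfl

lemma eComp_tensor {K : Type u₁} [EnrichedCategory V K] {W X Y Z : K} {P Q R : V}
    (f : P ⟶ eHom V W X) (g : Q ⟶ eHom V X Y) (h : R ⟶ eHom V Y Z) :
    (((f ⊗ₘ g) ≫ eComp V W X Y) ⊗ₘ h) ≫ eComp V W Y Z =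
      (α_ P Q R).hom ≫ (f ⊗ₘ ((g ⊗ₘ h) ≫ eComp V X Y Z)) ≫ eComp V W X Z := by
  have h1 : (((f ⊗ₘ g) ≫ eComp V W X Y) ⊗ₘ h) =
      ((f ⊗ₘ g) ⊗ₘ h) ≫ (eComp V W X Y ▷ _) := by
    rw [← tensorHom_id, tensorHom_comp_tensorHom, Category.comp_id]
  have h2 : (f ⊗ₘ ((g ⊗ₘ h) ≫ eComp V X Y Z)) =
      (f ⊗ₘ (g ⊗ₘ h)) ≫ (_ ◁ eComp V X Y Z) := by
    rw [← id_tensorHom, tensorHom_comp_tensorHom, Category.comp_id]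
  rw [h1, h2, Category.assoc, Category.assoc, ← associator_naturality_assoc, e_assoc']

lemma eId_tensor {K : Type u₁} [EnrichedCategory V K] {X Y : K} {P : V} (f : P ⟶ eHom V X Y) :
    (eId V X ⊗ₘ f) ≫ eComp V X X Y = (λ_ P).hom ≫ f := by
  have h := e_id_comp V X Y
  rw [Iso.inv_comp_eq, Category.comp_id] at h
  rw [MonoidalCategory.tensorHom_def', Category.assoc, h, leftUnitor_naturality]

lemma tensor_eId {K : Type u₁} [EnrichedCategory V K] {X Y : K} {P : V} (f : P ⟶ eHom V X Y) :
    (f ⊗ₘ eId V Y) ≫ eComp V X Y Y = (ρ_ P).hom ≫ f := by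
  have h := e_comp_id V X Y
  rw [Iso.inv_comp_eq, Category.comp_id] at h
  rw [MonoidalCategory.tensorHom_def, Category.assoc, h, rightUnitor_naturality]

/-- Composition of arrows of the underlying category. -/
def arrowComp {K : Type u₁} [EnrichedCategory V K] {X Y Z : K}
    (f : 𝟙_ V ⟶ eHom V X Y) (g : 𝟙_ V ⟶ eHom V Y Z) : 𝟙_ V ⟶ eHom V X Z :=
  (λ_ (𝟙_ V)).inv ≫ (f ⊗ₘ g) ≫ eComp V X Y Z

end Basic

section Nat

variable {V : Type u} [Category.{v} V] [MonoidalCategory V] [BraidedCategory V]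

/-- The opposite of a `V`-functor. -/
def opFunctor {C : Type u₁} [EnrichedCategory V C] {D : Type u₂} [EnrichedCategory V D]
    (F : EnrichedFunctor V C D) : EnrichedFunctor V Cᵒᵖ Dᵒᵖ where
  obj X := op (F.obj X.unop)
  map X Y := F.map Y.unop X.unop
  map_id X := F.map_id X.unop
  map_comp X Y Z := by
    rw [eComp_op_eq, eComp_op_eq, Category.assoc, F.map_comp]
    exact (braiding_naturality_assoc (F.map Y.unop X.unop) (F.map Z.unop Y.unop) _).symm

/-- A `Z`-indexed `V`-natural family `Z ⟶ D(F a, G a)`. If the hom-object `[C, D](F, G)` exists,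
these are the maps from `Z` into it; for `Z = 𝟙_ V` they are the `V`-natural transformations. -/
def IsNatFamily {C : Type u₁} [EnrichedCategory V C] {D : Type u₂} [EnrichedCategory V D]
    (F G : EnrichedFunctor V C D) (Z : V) (app : ∀ a, Z ⟶ eHom V (F.obj a) (G.obj a)) : Prop :=
  ∀ a b, (β_ Z (eHom V a b)).hom ≫ (F.map a b ⊗ₘ app b) ≫ eComp V _ _ _ =
    (app a ⊗ₘ G.map a b) ≫ eComp V _ _ _

/-- `V`-natural transformations. (Mathlib's `EnrichedNatTrans` only asks for naturality with
respect to the arrows of the underlying ordinary category, which is weaker in general.) -/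
structure VNat {C : Type u₁} [EnrichedCategory V C] {D : Type u₂} [EnrichedCategory V D]
    (F G : EnrichedFunctor V C D) where
  app : ∀ a, 𝟙_ V ⟶ eHom V (F.obj a) (G.obj a)
  natural : IsNatFamily F G (𝟙_ V) app

/-- A `V`-natural transformation all of whose components are invertible. -/
def VNat.IsIso {C : Type u₁} [EnrichedCategory V C] {D : Type u₂} [EnrichedCategory V D]
    {F G : EnrichedFunctor V C D} (α : VNat F G) : Prop :=
  ∀ a, IsIsoArrow (α.app a)

/-- A `V`-adjunction `L ⊣ R`, given by a `V`-natural unit `1 ⟶ R L` such that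
`D(L X, Y) ⟶ C(R L X, R Y) ⟶ C(X, R Y)` is invertible for all `X` and `Y`. -/
structure VAdjunction {C : Type u₁} [EnrichedCategory V C] {D : Type u₂} [EnrichedCategory V D]
    (L : EnrichedFunctor V C D) (R : EnrichedFunctor V D C) where
  unit : VNat (EnrichedFunctor.id V C) (L.comp V R)
  isIso : ∀ X Y, IsIso (R.map (L.obj X) Y ≫ precomp (unit.app X) (R.obj Y))

variable (V) in
/-- The full subcategory of `K` on the objects satisfying `P` is reflective in `K`, that is, its
inclusion has a left adjoint (as a `V`-functor). -/
def IsReflective {K : Type u₁} [EnrichedCategory V K] (P : K → Prop) : Prop :=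
  ∃ L : EnrichedFunctor V K (FullSub P), Nonempty (VAdjunction L (FullSub.ι P))

lemma isNatFamily_id {C : Type u₁} [EnrichedCategory V C] {D : Type u₂} [EnrichedCategory V D]
    (F : EnrichedFunctor V C D) : IsNatFamily F F (𝟙_ V) (fun a => eId V (F.obj a)) := by
  intro a b
  rw [eId_tensor, tensor_eId, braiding_tensorUnit_left]
  simp

lemma isNatFamily_tensor {C : Type u₁} [EnrichedCategory V C] {D : Type u₂} [EnrichedCategory V D]
    {F G H : EnrichedFunctor V C D} {Z Z' : V}
    {s : ∀ a, Z ⟶ eHom V (F.obj a) (G.obj a)} {t : ∀ a, Z' ⟶ eHom V (G.obj a) (H.obj a)}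
    (hs : IsNatFamily F G Z s) (ht : IsNatFamily G H Z' t) :
    IsNatFamily F H (Z ⊗ Z') (fun a => (s a ⊗ₘ t a) ≫ eComp V _ _ _) := by
  intro a b
  have hs := hs a b
  have ht := ht a b
  have e0 : (F.map a b ⊗ₘ ((s b ⊗ₘ t b) ≫ eComp V _ _ _)) ≫ eComp V _ _ _ =
      (α_ _ _ _).inv ≫ (((F.map a b ⊗ₘ s b) ≫ eComp V _ _ _) ⊗ₘ t b) ≫ eComp V _ _ _ := by
    rw [eComp_tensor, Iso.inv_hom_id_assoc]
  have e1 : ∀ {X : V} (f : X ⟶ eHom V a b ⊗ Z),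
      (f ▷ Z') ≫ (((F.map a b ⊗ₘ s b) ≫ eComp V _ _ _) ⊗ₘ t b) =
      ((f ≫ (F.map a b ⊗ₘ s b) ≫ eComp V _ _ _) ⊗ₘ t b) := by
    intro X f
    rw [← tensorHom_id, tensorHom_comp_tensorHom, Category.id_comp]
  have e2 : ∀ {X : V} (f : X ⟶ eHom V a b ⊗ Z'),
      (Z ◁ f) ≫ (s a ⊗ₘ ((G.map a b ⊗ₘ t b) ≫ eComp V _ _ _)) =
      (s a ⊗ₘ (f ≫ (G.map a b ⊗ₘ t b) ≫ eComp V _ _ _)) := by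
    intro X f
    rw [← id_tensorHom, tensorHom_comp_tensorHom, Category.id_comp]
  rw [e0, braiding_tensor_left_hom]
  simp only [Category.assoc, Iso.hom_inv_id_assoc]
  rw [reassoc_of% e1, hs, eComp_tensor, Iso.inv_hom_id_assoc, reassoc_of% e2, ht, eComp_tensor]

end Nat

section FunctorCategory

variable {V : Type u} [Category.{v} V] [MonoidalCategory V] [BraidedCategory V]
  [MonoidalClosed V] [HasLimits V]
variable {A : Type v} [EnrichedCategory V A] {D : Type u₂} [EnrichedCategory V D]

/-- The map `∏ₐ D(F a, G a) ⟶ ∏_{a,b} [A(a, b), D(F a, G b)]` given by the action of `F`. -/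
def homLeft (F G : EnrichedFunctor V A D) :
    (∏ᶜ fun a : A => eHom V (F.obj a) (G.obj a)) ⟶
      ∏ᶜ fun p : A × A => (ihom (eHom V p.1 p.2)).obj (eHom V (F.obj p.1) (G.obj p.2)) :=
  Pi.lift fun p => curry ((F.map p.1 p.2 ⊗ₘ Pi.π _ p.2) ≫ eComp V _ _ _)

/-- The map `∏ₐ D(F a, G a) ⟶ ∏_{a,b} [A(a, b), D(F a, G b)]` given by the action of `G`. -/
def homRight (F G : EnrichedFunctor V A D) :
    (∏ᶜ fun a : A => eHom V (F.obj a) (G.obj a)) ⟶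
      ∏ᶜ fun p : A × A => (ihom (eHom V p.1 p.2)).obj (eHom V (F.obj p.1) (G.obj p.2)) :=
  Pi.lift fun p => curry ((β_ _ (eHom V p.1 p.2)).inv ≫ (Pi.π _ p.1 ⊗ₘ G.map p.1 p.2) ≫ eComp V _ _ _)

/-- The hom-object `[A, D](F, G) = ∫ₐ D(F a, G a)`. -/
def homObj (F G : EnrichedFunctor V A D) : V := equalizer (homLeft F G) (homRight F G)

/-- Evaluation at `a` on hom-objects. -/
def homπ (F G : EnrichedFunctor V A D) (a : A) : homObj F G ⟶ eHom V (F.obj a) (G.obj a) :=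
  equalizer.ι _ _ ≫ Pi.π _ a

lemma homObj_ext {F G : EnrichedFunctor V A D} {Z : V} {f g : Z ⟶ homObj F G}
    (h : ∀ a, f ≫ homπ F G a = g ≫ homπ F G a) : f = g := by
  apply equalizer.hom_ext
  apply Pi.hom_ext
  intro a
  exact (Category.assoc _ _ _).trans ((h a).trans (Category.assoc _ _ _).symm)

lemma isNatFamily_iff (F G : EnrichedFunctor V A D) {Z : V}
    (f : Z ⟶ ∏ᶜ fun a : A => eHom V (F.obj a) (G.obj a)) :
    f ≫ homLeft F G = f ≫ homRight F G ↔ IsNatFamily F G Z (fun a => f ≫ Pi.π _ a) := by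
  have key : ∀ a b,
      (f ≫ homLeft F G ≫ Pi.π _ (a, b) = f ≫ homRight F G ≫ Pi.π _ (a, b)) ↔
      (β_ Z (eHom V a b)).hom ≫ (F.map a b ⊗ₘ (f ≫ Pi.π _ b)) ≫ eComp V _ _ _ =
        ((f ≫ Pi.π _ a) ⊗ₘ G.map a b) ≫ eComp V _ _ _ := by
    intro a b
    rw [homLeft, homRight, Pi.lift_π, Pi.lift_π, ← curry_natural_left, ← curry_natural_left,
      curry_injective.eq_iff, ← cancel_epi (β_ Z (eHom V a b)).hom]
    have e1 : (F.map a b ⊗ₘ (f ≫ Pi.π _ b)) = (eHom V a b ◁ f) ≫ (F.map a b ⊗ₘ Pi.π _ b) := by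
      rw [← id_tensorHom, tensorHom_comp_tensorHom, Category.id_comp]
    have e2 : ((f ≫ Pi.π _ a) ⊗ₘ G.map a b) = (f ▷ eHom V a b) ≫ (Pi.π _ a ⊗ₘ G.map a b) := by
      rw [← tensorHom_id, tensorHom_comp_tensorHom, Category.id_comp]
    have e3 : (β_ Z (eHom V a b)).hom ≫ (eHom V a b ◁ f) ≫
        (β_ (∏ᶜ fun a : A => eHom V (F.obj a) (G.obj a)) (eHom V a b)).inv =
        f ▷ eHom V a b := by
      rw [← braiding_naturality_left_assoc, Iso.hom_inv_id, Category.comp_id]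
    rw [e1, e2, Category.assoc, Category.assoc, ← e3, Category.assoc, Category.assoc]
  constructor
  · intro h a b
    rw [← key, ← Category.assoc, h, Category.assoc]
  · intro h
    apply Pi.hom_ext
    rintro ⟨a, b⟩
    rw [Category.assoc, Category.assoc, key]
    exact h a b

lemma isNatFamily_homπ (F G : EnrichedFunctor V A D) : IsNatFamily F G _ (homπ F G) :=
  (isNatFamily_iff F G _).1 (equalizer.condition _ _)

/-- The map into the hom-object that corresponds to a natural family. -/
def homLift {F G : EnrichedFunctor V A D} {Z : V}
    (app : ∀ a, Z ⟶ eHom V (F.obj a) (G.obj a)) (h : IsNatFamily F G Z app) : Z ⟶ homObj F G :=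
  equalizer.lift (Pi.lift app) ((isNatFamily_iff F G _).2 (by simpa using h))

lemma homLift_π {F G : EnrichedFunctor V A D} {Z : V}
    (app : ∀ a, Z ⟶ eHom V (F.obj a) (G.obj a)) (h : IsNatFamily F G Z app) (a : A) :
    homLift app h ≫ homπ F G a = app a := by
  have h1 : (homLift app h ≫ equalizer.ι _ _ : Z ⟶ _) = Pi.lift app := equalizer.lift_ι _ _
  refine (Category.assoc _ _ _).symm.trans ?_
  exact (congrArg (· ≫ Pi.π _ a) h1).trans (Pi.lift_π _ _)

/-- Composition of `V`-natural transformations, as a map of hom-objects. -/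
def homComp (F G H : EnrichedFunctor V A D) : homObj F G ⊗ homObj G H ⟶ homObj F H :=
  homLift _ (isNatFamily_tensor (isNatFamily_homπ F G) (isNatFamily_homπ G H))

lemma homComp_π (F G H : EnrichedFunctor V A D) (a : A) :
    homComp F G H ≫ homπ F H a = (homπ F G a ⊗ₘ homπ G H a) ≫ eComp V _ _ _ :=
  homLift_π _ _ a

/-- The `V`-category `[A, D]` of `V`-functors from a small `V`-category `A` to `D`. -/
instance functorCategory : EnrichedCategory V (EnrichedFunctor V A D) where
  Hom F G := homObj F G
  id F := homLift _ (isNatFamily_id F)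
  comp F G H := homComp F G H
  id_comp F G := by
    apply homObj_ext
    intro a
    rw [Category.assoc, Category.assoc, homComp_π, ← tensorHom_id, tensorHom_comp_tensorHom_assoc,
      homLift_π, Category.id_comp, eId_tensor, Iso.inv_hom_id_assoc]
  comp_id F G := by
    apply homObj_ext
    intro a
    rw [Category.assoc, Category.assoc, homComp_π, ← id_tensorHom, tensorHom_comp_tensorHom_assoc,
      homLift_π, Category.id_comp, tensor_eId, Iso.inv_hom_id_assoc]
  assoc F G H K := by
    apply homObj_ext
    intro a
    rw [Category.assoc, Category.assoc, Category.assoc, homComp_π, homComp_π, ← tensorHom_id,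
      ← id_tensorHom, tensorHom_comp_tensorHom_assoc, tensorHom_comp_tensorHom_assoc, homComp_π,
      homComp_π, Category.id_comp, Category.id_comp, eComp_tensor, Iso.inv_hom_id_assoc]

end FunctorCategory

section Hom

variable {V : Type u} [Category.{v} V] [MonoidalCategory V] [MonoidalClosed V]

lemma uncurry_eComp {X Y Z P Q : V} (f : P ⟶ eHom V X Y) (g : Q ⟶ eHom V Y Z) :
    uncurry ((f ⊗ₘ g) ≫ eComp V X Y Z) = (α_ X P Q).inv ≫ (uncurry f ▷ Q) ≫ uncurry g := by
  have h : uncurry (eComp V X Y Z) = compTranspose X Y Z := uncurry_curry _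
  have h1 : X ◁ (f ⊗ₘ g) ≫ (α_ _ _ _).inv = (α_ X P Q).inv ≫ (X ◁ f) ▷ Q ≫ _ ◁ g := by
    rw [← id_tensorHom, associator_inv_naturality, id_tensorHom,
      MonoidalCategory.tensorHom_def]
  have h2 : ((X ◁ f) ▷ Q ≫ _ ◁ g) ≫ (ihom.ev X).app Y ▷ _ = (uncurry f ▷ Q) ≫ Y ◁ g := by
    rw [Category.assoc, whisker_exchange, ← comp_whiskerRight_assoc, uncurry_eq f]
    rfl
  rw [uncurry_natural_left, h, compTranspose_eq, ← Category.assoc]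
  refine (congrArg (· ≫ _) h1).trans ?_
  rw [Category.assoc]
  congr 1
  refine (Category.assoc _ _ _).symm.trans ((congrArg (· ≫ _) h2).trans ?_)
  rw [Category.assoc, uncurry_eq g]

lemma uncurry_eId (X : V) : uncurry (eId V X) = (ρ_ X).hom := uncurry_curry _

/-- The representable `V`-functor `K(X, -) : K → V`. -/
def homFunctor {K : Type u₁} [EnrichedCategory V K] (X : K) : EnrichedFunctor V K V where
  obj Y := eHom V X Y
  map Y Z := curry (eComp V X Y Z)
  map_id Y := by
    apply uncurry_injective
    rw [uncurry_natural_left, uncurry_curry, uncurry_eId]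
    have h := e_comp_id V X Y
    rwa [Iso.inv_comp_eq, Category.comp_id] at h
  map_comp Y Z W := by
    apply uncurry_injective
    rw [uncurry_natural_left, uncurry_curry, uncurry_eComp, uncurry_curry, uncurry_curry, e_assoc]

end Hom

section Yoneda

variable {V : Type u} [Category.{v} V] [MonoidalCategory V] [SymmetricCategory V]

lemma braid_eComp {T : Type u₁} [EnrichedCategory V T] (s t a b : T) :
    eHom V t a ◁ (β_ (eHom V s t) (eHom V a b)).hom ≫ (α_ _ _ _).inv ≫
      (eComp V t a b ▷ eHom V s t) ≫ (β_ (eHom V t b) (eHom V s t)).hom ≫ eComp V s t b =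
    (α_ _ _ _).inv ≫ (((β_ (eHom V t a) (eHom V s t)).hom ≫ eComp V s t a) ▷ eHom V a b) ≫
      eComp V s a b := by
  rw [braiding_naturality_left_assoc, braiding_tensor_left_hom]
  simp only [Category.assoc, Iso.inv_hom_id_assoc]
  rw [← MonoidalCategory.whiskerLeft_comp_assoc, SymmetricCategory.symmetry,
    MonoidalCategory.whiskerLeft_id, Category.id_comp, ← e_assoc, Iso.hom_inv_id_assoc,
    comp_whiskerRight_assoc]

lemma braid_eComp' {T : Type u₁} [EnrichedCategory V T] (r s t x : T) :
    eHom V t x ◁ eComp V r s t ≫ (β_ (eHom V t x) (eHom V r t)).hom ≫ eComp V r t x =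
      eHom V t x ◁ (β_ (eHom V r s) (eHom V s t)).hom ≫ (α_ _ _ _).inv ≫
        (((β_ (eHom V t x) (eHom V s t)).hom ≫ eComp V s t x) ▷ eHom V r s) ≫
          (β_ (eHom V s x) (eHom V r s)).hom ≫ eComp V r s x := by
  rw [braiding_naturality_right_assoc, braiding_naturality_left_assoc, braiding_tensor_right_hom,
    braiding_tensor_left_hom]
  simp only [Category.assoc, Iso.inv_hom_id_assoc]
  rw [← MonoidalCategory.whiskerLeft_comp_assoc, SymmetricCategory.symmetry,
    MonoidalCategory.whiskerLeft_id, Category.id_comp, MonoidalCategory.whiskerLeft_comp_assoc,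
    ← e_assoc]

variable [MonoidalClosed V]

lemma yoneda_comp {T : Type u₁} [EnrichedCategory V T] (r s t x : T) :
    eComp V r s t ≫ curry ((β_ (eHom V t x) (eHom V r t)).hom ≫ eComp V r t x) =
      (β_ _ _).hom ≫ (curry ((β_ (eHom V t x) (eHom V s t)).hom ≫ eComp V s t x) ⊗ₘ
        curry ((β_ (eHom V s x) (eHom V r s)).hom ≫ eComp V r s x)) ≫
          eComp V (eHom V t x) (eHom V s x) (eHom V r x) := by
  apply uncurry_injective
  have h := uncurry_eComp (curry ((β_ (eHom V t x) (eHom V s t)).hom ≫ eComp V s t x))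
    (curry ((β_ (eHom V s x) (eHom V r s)).hom ≫ eComp V r s x))
  rw [uncurry_curry, uncurry_curry] at h
  rw [uncurry_natural_left, uncurry_natural_left, uncurry_curry, braid_eComp']
  exact congrArg (_ ≫ ·) h.symm

lemma isNatFamily_yoneda {T : Type u₁} [EnrichedCategory V T] (s t : T) :
    IsNatFamily (homFunctor (V := V) t) (homFunctor s) (eHom V s t)
      (fun r => curry ((β_ (eHom V t r) (eHom V s t)).hom ≫ eComp V s t r)) := by
  intro a b
  apply uncurry_injective
  have h1 := uncurry_eComp (curry (eComp V t a b))
    (curry ((β_ (eHom V t b) (eHom V s t)).hom ≫ eComp V s t b))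
  have h2 := uncurry_eComp (curry ((β_ (eHom V t a) (eHom V s t)).hom ≫ eComp V s t a))
    (curry (eComp V s a b))
  rw [uncurry_curry, uncurry_curry] at h1 h2
  rw [uncurry_natural_left]
  refine (congrArg (_ ≫ ·) h1).trans (Eq.trans ?_ h2.symm)
  exact braid_eComp s t a b

/-- The contravariant Yoneda embedding `t ↦ T(t, -)`, as a `V`-functor `T → [T, V]ᵒᵖ`. -/
def yonedaOp [HasLimits V] (T : Type v) [EnrichedCategory V T] :
    EnrichedFunctor V T (EnrichedFunctor V T V)ᵒᵖ where
  obj t := op (homFunctor t)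
  map s t := homLift _ (isNatFamily_yoneda s t)
  map_id t := by
    apply homObj_ext
    intro r
    have h : eId V t ≫ curry ((β_ (eHom V t r) (eHom V t t)).hom ≫ eComp V t t r) =
        eId V (eHom V t r) := by
      apply uncurry_injective
      rw [uncurry_natural_left, uncurry_curry, uncurry_eId, braiding_naturality_right_assoc]
      have h := e_id_comp V t r
      rw [Iso.inv_comp_eq, Category.comp_id] at h
      rw [h, braiding_tensorUnit_right, Category.assoc, Iso.inv_hom_id, Category.comp_id]
    refine (Category.assoc _ _ _).trans ((congrArg (_ ≫ ·) (homLift_π _ _ r)).trans ?_)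
    exact h.trans (homLift_π _ (isNatFamily_id (homFunctor t)) r).symm
  map_comp r s t := by
    apply homObj_ext
    intro x
    refine (Category.assoc _ _ _).trans ((congrArg (_ ≫ ·) (homLift_π _ _ x)).trans ?_)
    refine (yoneda_comp r s t x).trans (Eq.symm ?_)
    have h1 : ∀ {P Q : V} (f : P ⟶ homObj (homFunctor (V := V) t) (homFunctor s))
        (g : Q ⟶ homObj (homFunctor (V := V) s) (homFunctor r)),
        (f ⊗ₘ g) ≫ homComp _ _ _ ≫ homπ (homFunctor (V := V) t) (homFunctor r) x =
          ((f ≫ homπ _ _ x) ⊗ₘ (g ≫ homπ _ _ x)) ≫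
            eComp V (eHom V t x) (eHom V s x) (eHom V r x) := by
      intro P Q f g
      rw [homComp_π]
      exact tensorHom_comp_tensorHom_assoc _ _ _ _ _
    have h2 := h1 (homLift _ (isNatFamily_yoneda s t)) (homLift _ (isNatFamily_yoneda r s))
    rw [homLift_π, homLift_π] at h2
    refine Eq.trans ?_ (congrArg ((β_ _ _).hom ≫ ·) h2)
    have h3 := braiding_naturality_assoc (homLift _ (isNatFamily_yoneda r s))
      (homLift _ (isNatFamily_yoneda s t))
      (homComp (homFunctor (V := V) t) (homFunctor s) (homFunctor r) ≫ homπ _ _ x)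
    exact (Category.assoc _ _ _).trans ((congrArg (_ ≫ ·) (Category.assoc _ _ _)).trans h3)

end Yoneda

section Weighted

variable {V : Type u} [Category.{v} V] [MonoidalCategory V] [MonoidalClosed V]

/-- The action `W a ⊗ B(a, b) ⟶ W b` of a `V`-functor `W : B → V`. -/
def act {B : Type w} [EnrichedCategory V B] (W : EnrichedFunctor V B V) (a b : B) :
    W.obj a ⊗ eHom V a b ⟶ W.obj b :=
  uncurry (W.map a b)

/-- The family `c b : W b ⟶ K(X, S b)` is `V`-natural in `b`, that is, a `W`-weighted cone over
`S` with vertex `X`. -/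
def IsWeightedCone {B : Type w} [EnrichedCategory V B] {K : Type u₁} [EnrichedCategory V K]
    (W : EnrichedFunctor V B V) (S : EnrichedFunctor V B K) (X : K)
    (c : ∀ b, W.obj b ⟶ eHom V X (S.obj b)) : Prop :=
  ∀ a b, act W a b ≫ c b = (c a ⊗ₘ S.map a b) ≫ eComp V X (S.obj a) (S.obj b)

/-- The family `c b : Z ⊗ W b ⟶ K(X, S b)` is `V`-natural in `b`. Such families are the maps from
`Z` to the hom-object `[B, V](W, K(X, S -))`. -/
def IsIndexedCone {B : Type w} [EnrichedCategory V B] {K : Type u₁} [EnrichedCategory V K]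
    (W : EnrichedFunctor V B V) (S : EnrichedFunctor V B K) (X : K) (Z : V)
    (c : ∀ b, Z ⊗ W.obj b ⟶ eHom V X (S.obj b)) : Prop :=
  ∀ a b, Z ◁ act W a b ≫ c b =
    (α_ _ _ _).inv ≫ (c a ⊗ₘ S.map a b) ≫ eComp V X (S.obj a) (S.obj b)

/-- `L`, with the cone `c`, is the limit `{W, S}` of `S` weighted by `W`: composition with `c`
gives an isomorphism `K(X, L) ≅ [B, V](W, K(X, S -))` in `V` for every `X`, that is, a bijection
between the maps from `Z` to the two sides for every `Z` in `V`. -/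
def IsWeightedLimit {B : Type w} [EnrichedCategory V B] {K : Type u₁} [EnrichedCategory V K]
    (W : EnrichedFunctor V B V) (S : EnrichedFunctor V B K) (L : K)
    (c : ∀ b, W.obj b ⟶ eHom V L (S.obj b)) : Prop :=
  IsWeightedCone W S L c ∧
    ∀ (X : K) (Z : V) (d : ∀ b, Z ⊗ W.obj b ⟶ eHom V X (S.obj b)), IsIndexedCone W S X Z d →
      ∃! f : Z ⟶ eHom V X L, ∀ b, (f ⊗ₘ c b) ≫ eComp V X L (S.obj b) = d b

/-- `C`, with the cocone `c`, is the colimit `W * S` of `S : A → K` weighted by `W : Aᵒᵖ → V`: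
it is the limit of `Sᵒᵖ : Aᵒᵖ → Kᵒᵖ` weighted by `W`. -/
def IsWeightedColimit [BraidedCategory V] {A : Type w} [EnrichedCategory V A] {K : Type u₁}
    [EnrichedCategory V K] (W : EnrichedFunctor V Aᵒᵖ V) (S : EnrichedFunctor V A K) (C : K)
    (c : ∀ a : Aᵒᵖ, W.obj a ⟶ eHom V (S.obj a.unop) C) : Prop :=
  IsWeightedLimit W (opFunctor S) (op C) c

variable [BraidedCategory V]

/-- Presheaves `F : Aᵒᵖ → V` that are small colimits of representables: there are a `V`-functor
`J : B → A` with `B` small and `G : Bᵒᵖ → V` such that `F` is the colimit of the representables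
`A(-, J b)` weighted by `G`, that is, `[Aᵒᵖ, V](F, H) ≅ [Bᵒᵖ, V](G, H Jᵒᵖ)` for all `H`.
If `A` is small, every presheaf on `A` is of this kind. -/
def IsWeight {A : Type w} [EnrichedCategory V A] (F : EnrichedFunctor V Aᵒᵖ V) : Prop :=
  ∃ (B : Type v) (_ : EnrichedCategory V B) (J : EnrichedFunctor V B A)
    (G : EnrichedFunctor V Bᵒᵖ V) (η : VNat G ((opFunctor J).comp V F)),
    ∀ (H : EnrichedFunctor V Aᵒᵖ V) (Z : V) (g : ∀ b, Z ⟶ eHom V (G.obj b)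
        (H.obj ((opFunctor J).obj b))), IsNatFamily G ((opFunctor J).comp V H) Z g →
      ∃! f : ∀ a, Z ⟶ eHom V (F.obj a) (H.obj a), IsNatFamily F H Z f ∧
        ∀ b, f ((opFunctor J).obj b) ≫ precomp (η.app b) (H.obj ((opFunctor J).obj b)) = g b

variable (V) in
/-- A class of weights. The domains of the weights may be large. -/
structure WeightClass where
  mem : ∀ {A : Type w} [EnrichedCategory V A], EnrichedFunctor V Aᵒᵖ V → Prop
  isWeight : ∀ {A : Type w} [EnrichedCategory V A] (F : EnrichedFunctor V Aᵒᵖ V),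
    mem F → IsWeight F

/-- `K` has `Φ`-limits. -/
def HasPhiLimits (Φ : WeightClass.{w} V) (K : Type u₁) [EnrichedCategory V K] : Prop :=
  ∀ (A : Type w) [EnrichedCategory V A] (W : EnrichedFunctor V Aᵒᵖ V), Φ.mem W →
    ∀ S : EnrichedFunctor V Aᵒᵖ K, ∃ L c, IsWeightedLimit W S L c

/-- The `V`-functor `H` preserves all existing `Φ`-limits. -/
def PhiContinuous (Φ : WeightClass.{w} V) {K : Type u₁} [EnrichedCategory V K] {K' : Type u₂}
    [EnrichedCategory V K'] (H : EnrichedFunctor V K K') : Prop :=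
  ∀ (A : Type w) [EnrichedCategory V A] (W : EnrichedFunctor V Aᵒᵖ V), Φ.mem W →
    ∀ (S : EnrichedFunctor V Aᵒᵖ K) (L : K) (c : ∀ a, W.obj a ⟶ eHom V L (S.obj a)),
      IsWeightedLimit W S L c →
        IsWeightedLimit W (S.comp V H) (H.obj L) (fun a => c a ≫ H.map L (S.obj a))

/-- `K` is complete: it has all limits with weights indexed in `Type w`. -/
def IsVComplete (V : Type u) [Category.{v} V] [MonoidalCategory V] [MonoidalClosed V]
    [BraidedCategory V] (K : Type u₁) [EnrichedCategory V K] : Prop :=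
  ∀ (A : Type w) [EnrichedCategory V A] (W : EnrichedFunctor V Aᵒᵖ V), IsWeight W →
    ∀ S : EnrichedFunctor V Aᵒᵖ K, ∃ L c, IsWeightedLimit W S L c

/-- `K` is cocomplete: it has all colimits with weights indexed in `Type w`. -/
def IsVCocomplete (V : Type u) [Category.{v} V] [MonoidalCategory V] [MonoidalClosed V]
    [BraidedCategory V] (K : Type u₁) [EnrichedCategory V K] : Prop :=
  ∀ (A : Type w) [EnrichedCategory V A] (W : EnrichedFunctor V Aᵒᵖ V), IsWeight W →
    ∀ S : EnrichedFunctor V A K, ∃ C c, IsWeightedColimit W S C c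

variable (V) in
/-- The full subcategory of `K` on the objects satisfying `P` is closed in `K` under limits. -/
def ClosedUnderLimits {K : Type u₁} [EnrichedCategory V K] (P : K → Prop) : Prop :=
  ∀ (A : Type w) [EnrichedCategory V A] (W : EnrichedFunctor V Aᵒᵖ V), IsWeight W →
    ∀ (S : EnrichedFunctor V Aᵒᵖ K), (∀ a, P (S.obj a)) →
      ∀ L c, IsWeightedLimit W S L c → P L

variable (V) in
/-- The full subcategory of `K` on the objects satisfying `P` is closed in `K` under the colimits
whose weight `W` satisfies `Q`. -/
def ClosedUnderColimits {K : Type u₁} [EnrichedCategory V K] (P : K → Prop)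
    (Q : ∀ {A : Type w} [EnrichedCategory V A], EnrichedFunctor V Aᵒᵖ V → Prop) : Prop :=
  ∀ (A : Type w) [EnrichedCategory V A] (W : EnrichedFunctor V Aᵒᵖ V), IsWeight W → Q W →
    ∀ (S : EnrichedFunctor V A K), (∀ a, P (S.obj a)) →
      ∀ C c, IsWeightedColimit W S C c → P C

/-- `L`, with `η : F ⟶ L K`, is the (pointwise) left Kan extension of `F : A → E` along
`K : A → B`, that is, `L b` is the colimit of `F` weighted by `B(K -, b)` for each `b`. -/
def IsLeftKan {A : Type u₁} [EnrichedCategory V A] {B : Type u₂} [EnrichedCategory V B]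
    {E : Type u₃} [EnrichedCategory V E] (K : EnrichedFunctor V A B) (F : EnrichedFunctor V A E)
    (L : EnrichedFunctor V B E) (η : VNat F (K.comp V L)) : Prop :=
  ∀ b, IsWeightedColimit ((opFunctor K).comp V (homFunctor (op b))) F (L.obj b)
    (fun a => L.map (K.obj a.unop) b ≫ precomp (η.app a.unop) (L.obj b))

end Weighted

section Commutation

variable (V : Type u) [Category.{v} V] [MonoidalCategory V] [BraidedCategory V]

/-- A `V`-functor `A ⊗ B → E`, given by its partial `V`-functors. -/
structure Bifunctor (A : Type u₁) [EnrichedCategory V A] (B : Type u₂) [EnrichedCategory V B]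
    (E : Type u₃) [EnrichedCategory V E] where
  obj : A → B → E
  mapL : ∀ a a' b, eHom V a a' ⟶ eHom V (obj a b) (obj a' b)
  mapR : ∀ a b b', eHom V b b' ⟶ eHom V (obj a b) (obj a b')
  mapL_id : ∀ a b, eId V a ≫ mapL a a b = eId V (obj a b)
  mapR_id : ∀ a b, eId V b ≫ mapR a b b = eId V (obj a b)
  mapL_comp : ∀ a a' a'' b, eComp V a a' a'' ≫ mapL a a'' b =
    (mapL a a' b ⊗ₘ mapL a' a'' b) ≫ eComp V _ _ _
  mapR_comp : ∀ a b b' b'', eComp V b b' b'' ≫ mapR a b b'' =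
    (mapR a b b' ⊗ₘ mapR a b' b'') ≫ eComp V _ _ _
  interchange : ∀ a a' b b', (mapL a a' b ⊗ₘ mapR a' b b') ≫ eComp V _ _ _ =
    (β_ _ _).hom ≫ (mapR a b b' ⊗ₘ mapL a a' b') ≫ eComp V _ _ _

variable {V}

/-- The partial `V`-functor `S(-, b)`. -/
def Bifunctor.left {A : Type u₁} [EnrichedCategory V A] {B : Type u₂} [EnrichedCategory V B]
    {E : Type u₃} [EnrichedCategory V E] (S : Bifunctor V A B E) (b : B) :
    EnrichedFunctor V A E where
  obj a := S.obj a b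
  map a a' := S.mapL a a' b
  map_id a := S.mapL_id a b
  map_comp a a' a'' := S.mapL_comp a a' a'' b

/-- The partial `V`-functor `S(a, -)`. -/
def Bifunctor.right {A : Type u₁} [EnrichedCategory V A] {B : Type u₂} [EnrichedCategory V B]
    {E : Type u₃} [EnrichedCategory V E] (S : Bifunctor V A B E) (a : A) :
    EnrichedFunctor V B E where
  obj b := S.obj a b
  map b b' := S.mapR a b b'
  map_id b := S.mapR_id a b
  map_comp b b' b'' := S.mapR_comp a b b' b''

variable [MonoidalClosed V]

/-- Limits weighted by `F` commute in `V` with colimits weighted by `G`: for every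
`S : Aᵒᵖ ⊗ B → V`, with `L = {F, S} : B → V`, `C = G * S : Aᵒᵖ → V`, `X = G * L` and `Y = {F, C}`,
the canonical comparison map `k : G * {F, S} ⟶ {F, G * S}` is invertible. -/
def CommutesInBase {A : Type w} [EnrichedCategory V A] {B : Type w₁} [EnrichedCategory V B]
    (F : EnrichedFunctor V Aᵒᵖ V) (G : EnrichedFunctor V Bᵒᵖ V) : Prop :=
  ∀ (S : Bifunctor V Aᵒᵖ B V)
    -- the `V`-functor `L = {F, S}`
    (L : EnrichedFunctor V B V) (l : ∀ b a, F.obj a ⟶ eHom V (L.obj b) (S.obj a b)),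
    (∀ b, IsWeightedLimit F (S.left b) (L.obj b) (l b)) →
    (∀ a b b', (l b a ⊗ₘ S.mapR a b b') ≫ eComp V _ _ _ =
      (β_ _ _).hom ≫ (L.map b b' ⊗ₘ l b' a) ≫ eComp V _ _ _) →
    -- the `V`-functor `C = G * S`
    ∀ (C : EnrichedFunctor V Aᵒᵖ V)
      (c : ∀ a (b : Bᵒᵖ), G.obj b ⟶ eHom V (S.obj a b.unop) (C.obj a)),
    (∀ a, IsWeightedColimit G (S.right a) (C.obj a) (c a)) →
    (∀ a a' (b : Bᵒᵖ), (c a b ⊗ₘ C.map a a') ≫ eComp V _ _ _ =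
      (β_ _ _).hom ≫ (S.mapL a a' b.unop ⊗ₘ c a' b) ≫ eComp V _ _ _) →
    -- the objects `X = G * L` and `Y = {F, C}`
    ∀ (X : V) (x : ∀ b : Bᵒᵖ, G.obj b ⟶ eHom V (L.obj b.unop) X),
    IsWeightedColimit G L X x →
    ∀ (Y : V) (y : ∀ a, F.obj a ⟶ eHom V Y (C.obj a)),
    IsWeightedLimit F C Y y →
    -- the comparison map
    ∀ k : 𝟙_ V ⟶ eHom V X Y,
    (∀ a (b : Bᵒᵖ), (l b.unop a ⊗ₘ c a b) ≫ eComp V _ _ _ =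
      (β_ _ _).hom ≫ (x b ⊗ₘ (y a ≫ precomp k (C.obj a))) ≫ eComp V _ _ _) →
    IsIsoArrow k

/-- `G` is `Φ`-flat: colimits weighted by `G` commute in `V` with `Φ`-limits. -/
def IsFlat (Φ : WeightClass.{w} V) {B : Type w₁} [EnrichedCategory V B]
    (G : EnrichedFunctor V Bᵒᵖ V) : Prop :=
  ∀ (A : Type w) [EnrichedCategory V A] (F : EnrichedFunctor V Aᵒᵖ V), Φ.mem F →
    CommutesInBase F G

end Commutation

section Theories

variable {V : Type u} [Category.{v} V] [MonoidalCategory V] [SymmetricCategory V]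
  [MonoidalClosed V]

/-- The closure of a class of objects of `M` under `Φ`-limits. -/
inductive LimitClosure (Φ : WeightClass.{w} V) {M : Type u₁} [EnrichedCategory V M]
    (P : M → Prop) : M → Prop
  | base (X : M) (hX : P X) : LimitClosure Φ P X
  | limit (A : Type w) [EnrichedCategory V A] (W : EnrichedFunctor V Aᵒᵖ V) (hW : Φ.mem W)
      (S : EnrichedFunctor V Aᵒᵖ M) (hS : ∀ a, LimitClosure Φ P (S.obj a))
      (L : M) (c : ∀ a, W.obj a ⟶ eHom V L (S.obj a)) (h : IsWeightedLimit W S L c) :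
      LimitClosure Φ P L

variable [HasLimits V]

/-- The objects of `[T, V]ᵒᵖ` in the closure of the representables under `Φ`-limits. -/
def InFreeCompletion (Φ : WeightClass.{w} V) (T : Type v) [EnrichedCategory V T] :
    (EnrichedFunctor V T V)ᵒᵖ → Prop :=
  LimitClosure Φ (fun X => ∃ t : T, X = op (homFunctor t))

/-- The free completion `FT` of a small `V`-category `T` under `Φ`-limits: the closure of the
representables in `[T, V]ᵒᵖ` under `Φ`-limits. -/
abbrev FreeCompletion (Φ : WeightClass.{w} V) (T : Type v) [EnrichedCategory V T] :=
  FullSub (InFreeCompletion Φ T)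

/-- The canonical inclusion `T → FT`. -/
def toFreeCompletion (Φ : WeightClass.{w} V) (T : Type v) [EnrichedCategory V T] :
    EnrichedFunctor V T (FreeCompletion Φ T) where
  obj t := ⟨op (homFunctor t), .base _ ⟨t, rfl⟩⟩
  map s t := (yonedaOp T).map s t
  map_id t := (yonedaOp T).map_id t
  map_comp r s t := (yonedaOp T).map_comp r s t

/-- `Φ` is locally small: for small `A`, the closure of the representables in `[A, V]` under
`Φ`-colimits is essentially small. (As `A` ranges over all small `V`-categories, so does `Aᵒᵖ`.) -/
def IsLocallySmallClass (Φ : WeightClass.{w} V) : Prop :=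
  ∀ (A : Type v) [EnrichedCategory V A],
    ∃ (ι : Type v) (X : ι → (EnrichedFunctor V A V)ᵒᵖ), ∀ Y, InFreeCompletion Φ A Y →
      ∃ (i : ι) (e : 𝟙_ V ⟶ eHom V Y (X i)), IsIsoArrow e

/-- The `V`-functor `(-) * F : [Aᵒᵖ, V] → V` sending `G` to the colimit `G * F` of `F : A → V`
weighted by `G`. It is the left Kan extension of `F` along the Yoneda embedding, and `G * F` is
also the colimit `F * G` of `G : Aᵒᵖ → V` weighted by `F`. It exists since `V` is cocomplete, and
is unique up to isomorphism. -/
structure ColimitFunctor {A : Type v} [EnrichedCategory V A] (F : EnrichedFunctor V A V) where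
  functor : EnrichedFunctor V (EnrichedFunctor V Aᵒᵖ V) V
  cocone : ∀ (G : EnrichedFunctor V Aᵒᵖ V) (a : Aᵒᵖ),
    G.obj a ⟶ eHom V (F.obj a.unop) (functor.obj G)
  isColimit : ∀ G, IsWeightedColimit G F (functor.obj G) (cocone G)
  natural : ∀ (G G' : EnrichedFunctor V Aᵒᵖ V) (a : Aᵒᵖ),
    uncurry (homπ G G' a) ≫ cocone G' a =
      (cocone G a ⊗ₘ functor.map G G') ≫ eComp V _ _ _

/-- Axiom A: if `A` is a small `V`-category with `Φ`-limits and `F : A → V` is `Φ`-continuous,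
then so is `F * (-) : [Aᵒᵖ, V] → V`. -/
def AxiomA (Φ : WeightClass.{w} V) : Prop :=
  ∀ (A : Type v) [EnrichedCategory V A], HasPhiLimits Φ A →
    ∀ F : EnrichedFunctor V A V, PhiContinuous Φ F →
      ∀ H : ColimitFunctor F, PhiContinuous Φ H.functor

/-- The models of `T` (in `V`), as a class of objects of `[T, V]`. -/
def IsModel (Φ : WeightClass.{w} V) {T : Type v} [EnrichedCategory V T]
    (F : EnrichedFunctor V T V) : Prop :=
  PhiContinuous Φ F

/-- The `V`-category of models of `T` in `V`. -/
abbrev PhiMod (Φ : WeightClass.{w} V) (T : Type v) [EnrichedCategory V T] :=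
  FullSub (IsModel Φ (T := T))

/-- The `V`-natural transformation `ρ : F ⟶ L` is a reflection of `F` into the models: `L` is a
model and `[T, V](L, M) ⟶ [T, V](F, M)` is invertible for every model `M`. -/
def IsReflectionIntoModels (Φ : WeightClass.{w} V) {T : Type v} [EnrichedCategory V T]
    {F L : EnrichedFunctor V T V} (ρ : VNat F L) : Prop :=
  IsModel Φ L ∧ ∀ M : EnrichedFunctor V T V, IsModel Φ M →
    IsIso (precomp (X := F) (Y := L) (homLift ρ.app ρ.natural) M)

end Theories

end EnrichedModels

end

open EnrichedModels

/-!
Write `FT` for the free completion of `T` under `Φ`-limits, a full subcategory of `[T, V]ᵒᵖ`, and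
`J : T → FT` for the inclusion.

*Method.* A hom-object `K(X, Y)` is handled through its generalized elements `Z ⟶ K(X, Y)`, with
composition `f ⊙ g` (`elemComp`). Universal properties become unique existence of generalized
elements, and a map between hom-objects is invertible as soon as it is bijective on generalized
elements (`isIso_of_bijective`). A `Z`-indexed family of transformations `F ⟶ G` is a generalized
element of `[T, V](F, G)`, so bijections between such families give isomorphisms of hom-objects.

*The functor category.* `V` has limits with small weights (`[B, V](W, S)` is the limit of `S`
weighted by `W`) and colimits with small weights (a coequalizer of coproducts); since a weight is a
small colimit of representables, `V` has all weighted limits and colimits, and `[T, V]` has them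
pointwise (`IsWeight.exists_limit`, `IsWeight.exists_colimit`).

*Limits of models.* A `V`-functor `F` preserves a limit cone of `T` exactly when `[T, V](k, F)` is
invertible, where `k` is the comparison map from the weighted colimit of the representables of the
diagram to the representable of the limit (`IsWeight.exists_preserves_iff`). Such an orthogonality
condition is inherited by limits, so the models are closed under limits and complete.

*The adjunction `J ⊣ R`.* The objects of `[T, V]ᵒᵖ` at which a right adjoint of the Yoneda embedding
of `T` has a value contain the representables, and are closed under `Φ`-limits because `T` has them.
So they contain `FT` (`exists_rightAdjoint_toFreeCompletion`).

*The extension.* `F : T → V` extends to `X ↦ [T, V](X, F)` on `FT` (`freeExtension`), which is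
`Φ`-continuous since representables preserve limits. Every `Φ`-continuous functor on `FT` is the
right Kan extension of its restriction to `T` (`isRightKanAt_of_phiContinuous`): this holds at the
objects of `T`, and passes to `Φ`-limits because `FT(-, J t)` turns them into colimits.

*The left Kan extension.* As `Φ` is locally small, `FT` is equivalent to a small `A`. For
`Φ`-continuous `E : FT → V` the Kan extension `Lan_R E` is `t ↦ T(R -, t) * E`, the composite of
`T → [Aᵒᵖ, V]`, `t ↦ T(R -, t)`, with `(-) * E : [Aᵒᵖ, V] → V`. The first functor is
`Φ`-continuous because limits in `[Aᵒᵖ, V]` are pointwise, the second by Axiom A; hence `Lan_R E` is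
a model (`exists_isLeftKan_isModel`).

*The reflection.* Let `E` be a `Φ`-continuous extension of `F`, `L = Lan_R E`, and `M` a model. The
right adjoint `R` preserves limits, so `M R` is `Φ`-continuous, and the unit `1 ⟶ R J` is invertible
because `J` is fully faithful. Families of transformations thus correspond as follows
(`isReflection_of_isLeftKan`):
`L ⟶ M`, by the left Kan extension, to `E ⟶ M R`; by the right Kan extension `M R`, to
`E J ⟶ M R J`; by `F ≅ E J` and `M ≅ M R J`, to `F ⟶ M`.

*Colimits of models.* Colimits in a reflective subcategory are reflections of colimits. For a
`Φ`-flat weight the pointwise colimit of models is itself a model, as such colimits commute with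
`Φ`-limits in `V` (`closedUnderColimits_isModel`).
-/

noncomputable section

namespace EnrichedModels

/-! ### The calculus of generalized elements of hom-objects -/

/-- A morphism that is bijective on generalized elements is invertible; it suffices to lift `𝟙 B`
and to use uniqueness at `𝟙 A`. -/
lemma isIso_of_bijective {V : Type u} [Category.{v} V] {A B : V} (φ : A ⟶ B)
    (h : ∀ (Z : V) (g : Z ⟶ B), ∃! f : Z ⟶ A, f ≫ φ = g) : IsIso φ := by
  obtain ⟨ψ, hψ, -⟩ := h B (𝟙 B)
  refine ⟨ψ, ?_, hψ⟩
  exact (h A φ).unique (by simp [hψ]) (by simp)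

lemma existsUnique_comp_eq {V : Type u} [Category.{v} V] {A B Z : V} (φ : A ⟶ B) [IsIso φ]
    (g : Z ⟶ B) : ∃! f : Z ⟶ A, f ≫ φ = g :=
  ⟨g ≫ inv φ, by simp, fun f hf => by simp [← hf]⟩

section Elements

variable {V : Type u} [Category.{v} V] [MonoidalCategory V]
variable {K : Type u₁} [EnrichedCategory V K] {D : Type u₂} [EnrichedCategory V D]

/-- Composition of generalized elements `P ⟶ K(X, Y)` and `Q ⟶ K(Y, Z)` of hom-objects. -/
def elemComp {X Y Z : K} {P Q : V} (f : P ⟶ eHom V X Y) (g : Q ⟶ eHom V Y Z) :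
    P ⊗ Q ⟶ eHom V X Z :=
  (f ⊗ₘ g) ≫ eComp V X Y Z

/-- Infix notation for `elemComp`, in diagrammatic order. -/
infixl:75 " ⊙ " => elemComp

/-- For an arrow `g : X ⟶ Y` of the underlying category, the map
`K(Z, g) : K(Z, X) ⟶ K(Z, Y)`. -/
def postcomp {X Y : K} (g : 𝟙_ V ⟶ eHom V X Y) (Z : K) : eHom V Z X ⟶ eHom V Z Y :=
  (ρ_ _).inv ≫ _ ◁ g ≫ eComp V Z X Y

variable {W X Y Z : K} {P Q R P' Q' : V}

lemma comp_elemComp (u : P' ⟶ P) (f : P ⟶ eHom V X Y) (g : Q ⟶ eHom V Y Z) :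
    (u ≫ f) ⊙ g = u ▷ Q ≫ (f ⊙ g) := by
  simp [elemComp, MonoidalCategory.tensorHom_def]

lemma elemComp_comp (u : Q' ⟶ Q) (f : P ⟶ eHom V X Y) (g : Q ⟶ eHom V Y Z) :
    f ⊙ (u ≫ g) = P ◁ u ≫ (f ⊙ g) := by
  simp [elemComp, MonoidalCategory.tensorHom_def']

lemma elemComp_assoc (f : P ⟶ eHom V W X) (g : Q ⟶ eHom V X Y) (h : R ⟶ eHom V Y Z) :
    (f ⊙ g) ⊙ h = (α_ P Q R).hom ≫ (f ⊙ (g ⊙ h)) :=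
  eComp_tensor f g h

lemma elemComp_assoc' (f : P ⟶ eHom V W X) (g : Q ⟶ eHom V X Y) (h : R ⟶ eHom V Y Z) :
    f ⊙ (g ⊙ h) = (α_ P Q R).inv ≫ ((f ⊙ g) ⊙ h) := by
  rw [elemComp_assoc, Iso.inv_hom_id_assoc]

lemma eId_elemComp (f : P ⟶ eHom V X Y) : eId V X ⊙ f = (λ_ P).hom ≫ f :=
  eId_tensor f

lemma elemComp_eId (f : P ⟶ eHom V X Y) : f ⊙ eId V Y = (ρ_ P).hom ≫ f :=
  tensor_eId f

lemma elemComp_map (F : EnrichedFunctor V K D) (f : P ⟶ eHom V X Y) (g : Q ⟶ eHom V Y Z) :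
    (f ⊙ g) ≫ F.map X Z = (f ≫ F.map X Y) ⊙ (g ≫ F.map Y Z) := by
  rw [elemComp, Category.assoc, F.map_comp, tensorHom_comp_tensorHom_assoc, elemComp]

lemma eComp_eq_elemComp (X Y Z : K) : eComp V X Y Z = 𝟙 (eHom V X Y) ⊙ 𝟙 (eHom V Y Z) := by
  simp [elemComp]

lemma comp_precomp (r : 𝟙_ V ⟶ eHom V X Y) (f : P ⟶ eHom V Y Z) :
    f ≫ precomp r Z = (λ_ P).inv ≫ (r ⊙ f) := by
  rw [precomp, elemComp, MonoidalCategory.tensorHom_def', leftUnitor_inv_naturality_assoc,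
    Category.assoc]

lemma comp_postcomp (r : 𝟙_ V ⟶ eHom V Y Z) (f : P ⟶ eHom V X Y) :
    f ≫ postcomp r X = (ρ_ P).inv ≫ (f ⊙ r) := by
  rw [postcomp, elemComp, MonoidalCategory.tensorHom_def, rightUnitor_inv_naturality_assoc,
    Category.assoc]

lemma comp_precomp_elemComp (r : 𝟙_ V ⟶ eHom V W X) (f : P ⟶ eHom V X Y) (g : Q ⟶ eHom V Y Z) :
    (f ≫ precomp r Y) ⊙ g = (f ⊙ g) ≫ precomp r Z := by
  rw [comp_precomp, comp_precomp, comp_elemComp, elemComp_assoc]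
  simp

lemma elemComp_comp_postcomp (f : P ⟶ eHom V W X) (g : Q ⟶ eHom V X Y)
    (r : 𝟙_ V ⟶ eHom V Y Z) : f ⊙ (g ≫ postcomp r X) = (f ⊙ g) ≫ postcomp r W := by
  rw [comp_postcomp, comp_postcomp, elemComp_comp, elemComp_assoc]
  simp

lemma comp_postcomp_elemComp (f : P ⟶ eHom V W X) (r : 𝟙_ V ⟶ eHom V X Y)
    (g : Q ⟶ eHom V Y Z) : (f ≫ postcomp r W) ⊙ g = f ⊙ (g ≫ precomp r Z) := by
  rw [comp_postcomp, comp_precomp, elemComp_comp, comp_elemComp, elemComp_assoc]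
  simp

lemma precomp_map (F : EnrichedFunctor V K D) (r : 𝟙_ V ⟶ eHom V X Y) (Z : K) :
    precomp r Z ≫ F.map X Z = F.map Y Z ≫ precomp (r ≫ F.map X Y) (F.obj Z) := by
  have h := comp_precomp r (𝟙 (eHom V Y Z))
  rw [Category.id_comp] at h
  rw [h, Category.assoc, elemComp_map, Category.id_comp, comp_precomp]

lemma postcomp_map (F : EnrichedFunctor V K D) (r : 𝟙_ V ⟶ eHom V X Y) (Z : K) :
    postcomp r Z ≫ F.map Z Y = F.map Z X ≫ postcomp (r ≫ F.map X Y) (F.obj Z) := by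
  have h := comp_postcomp r (𝟙 (eHom V Z X))
  rw [Category.id_comp] at h
  rw [h, Category.assoc, elemComp_map, Category.id_comp, comp_postcomp]

lemma precomp_postcomp (r : 𝟙_ V ⟶ eHom V W X) (s : 𝟙_ V ⟶ eHom V Y Z) :
    precomp r Y ≫ postcomp s W = postcomp s X ≫ precomp r Z := by
  have h := comp_precomp r (𝟙 (eHom V X Y))
  rw [Category.id_comp] at h
  have h' := comp_postcomp s (𝟙 (eHom V X Y))
  rw [Category.id_comp] at h'
  rw [h, h', Category.assoc, comp_postcomp, Category.assoc, ← comp_precomp_elemComp, comp_precomp,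
    comp_elemComp]
  simp

lemma eId_precomp (r : 𝟙_ V ⟶ eHom V X Y) : eId V Y ≫ precomp r Y = r := by
  rw [comp_precomp, elemComp_eId, ← unitors_equal, Iso.inv_hom_id_assoc]

lemma eId_postcomp (r : 𝟙_ V ⟶ eHom V X Y) : eId V X ≫ postcomp r X = r := by
  rw [comp_postcomp, eId_elemComp, unitors_equal, Iso.inv_hom_id_assoc]

lemma arrowComp_eq_precomp (r : 𝟙_ V ⟶ eHom V X Y) (s : 𝟙_ V ⟶ eHom V Y Z) :
    arrowComp r s = s ≫ precomp r Z := by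
  rw [comp_precomp]; rfl

lemma arrowComp_eq_postcomp (r : 𝟙_ V ⟶ eHom V X Y) (s : 𝟙_ V ⟶ eHom V Y Z) :
    arrowComp r s = r ≫ postcomp s X := by
  rw [comp_postcomp, ← unitors_inv_equal]; rfl

lemma comp_precomp_eq_comp_postcomp (r : 𝟙_ V ⟶ eHom V X Y) (s : 𝟙_ V ⟶ eHom V Y Z) :
    s ≫ precomp r Z = r ≫ postcomp s X := by
  rw [← arrowComp_eq_precomp, arrowComp_eq_postcomp]

lemma precomp_comp_precomp (r : 𝟙_ V ⟶ eHom V W X) (s : 𝟙_ V ⟶ eHom V X Y) (Z : K) :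
    precomp s Z ≫ precomp r Z = precomp (s ≫ precomp r Y) Z := by
  have h := comp_precomp s (𝟙 (eHom V Y Z))
  have h' := comp_precomp (s ≫ precomp r Y) (𝟙 (eHom V Y Z))
  rw [Category.id_comp] at h h'
  rw [h, h', comp_precomp_elemComp, Category.assoc]

lemma postcomp_comp_postcomp (r : 𝟙_ V ⟶ eHom V X Y) (s : 𝟙_ V ⟶ eHom V Y Z) (W : K) :
    postcomp r W ≫ postcomp s W = postcomp (r ≫ postcomp s X) W := by
  have h := comp_postcomp r (𝟙 (eHom V W X))
  have h' := comp_postcomp (r ≫ postcomp s X) (𝟙 (eHom V W X))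
  rw [Category.id_comp] at h h'
  rw [h, h', elemComp_comp_postcomp, Category.assoc]

lemma precomp_eId (X Z : K) : precomp (eId V X) Z = 𝟙 (eHom V X Z) := by
  have h := comp_precomp (eId V X) (𝟙 (eHom V X Z))
  rw [Category.id_comp] at h
  rw [h, eId_elemComp, Iso.inv_hom_id_assoc]

lemma postcomp_eId (X Z : K) : postcomp (eId V X) Z = 𝟙 (eHom V Z X) := by
  have h := comp_postcomp (eId V X) (𝟙 (eHom V Z X))
  rw [Category.id_comp] at h
  rw [h, elemComp_eId, Iso.inv_hom_id_assoc]

lemma isIsoArrow_iff (f : 𝟙_ V ⟶ eHom V X Y) :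
    IsIsoArrow f ↔ ∃ g : 𝟙_ V ⟶ eHom V Y X, f ≫ postcomp g X = eId V X ∧
      g ≫ postcomp f Y = eId V Y := by
  have key : ∀ {A B C : K} (a : 𝟙_ V ⟶ eHom V A B) (b : 𝟙_ V ⟶ eHom V B C),
      ForgetEnrichment.homOf V a ≫ ForgetEnrichment.homOf V b =
        ForgetEnrichment.homOf V (a ≫ postcomp b A) := by
    intro A B C a b
    rw [← arrowComp_eq_postcomp]
    exact (ForgetEnrichment.homOf_comp V a b).symm
  constructor
  · intro h
    have : IsIso (ForgetEnrichment.homOf V f) := h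
    refine ⟨ForgetEnrichment.homTo V (inv (ForgetEnrichment.homOf V f)), ?_, ?_⟩
    · have h1 := (key f (ForgetEnrichment.homTo V (inv (ForgetEnrichment.homOf V f)))).symm.trans
        (IsIso.hom_inv_id (ForgetEnrichment.homOf V f))
      exact (congrArg (ForgetEnrichment.homTo V) h1).trans (ForgetEnrichment.homTo_id V _)
    · have h1 := (key (ForgetEnrichment.homTo V (inv (ForgetEnrichment.homOf V f))) f).symm.trans
        (IsIso.inv_hom_id (ForgetEnrichment.homOf V f))
      exact (congrArg (ForgetEnrichment.homTo V) h1).trans (ForgetEnrichment.homTo_id V _)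
  · rintro ⟨g, h1, h2⟩
    exact ⟨ForgetEnrichment.homOf V g,
      (key f g).trans ((congrArg _ h1).trans (ForgetEnrichment.homOf_eId V X)),
      (key g f).trans ((congrArg _ h2).trans (ForgetEnrichment.homOf_eId V Y))⟩

lemma IsIsoArrow.isIso_precomp {f : 𝟙_ V ⟶ eHom V X Y} (h : IsIsoArrow f) (Z : K) :
    IsIso (precomp f Z) := by
  obtain ⟨g, h1, h2⟩ := (isIsoArrow_iff f).1 h
  refine ⟨precomp g Z, ?_, ?_⟩
  · rw [precomp_comp_precomp, comp_precomp_eq_comp_postcomp, h2, precomp_eId]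
  · rw [precomp_comp_precomp, comp_precomp_eq_comp_postcomp, h1, precomp_eId]

lemma IsIsoArrow.isIso_postcomp {f : 𝟙_ V ⟶ eHom V X Y} (h : IsIsoArrow f) (Z : K) :
    IsIso (postcomp f Z) := by
  obtain ⟨g, h1, h2⟩ := (isIsoArrow_iff f).1 h
  refine ⟨postcomp g Z, ?_, ?_⟩
  · rw [postcomp_comp_postcomp, h1, postcomp_eId]
  · rw [postcomp_comp_postcomp, h2, postcomp_eId]

lemma IsIsoArrow.map {f : 𝟙_ V ⟶ eHom V X Y} (h : IsIsoArrow f) (F : EnrichedFunctor V K D) :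
    IsIsoArrow (f ≫ F.map X Y) := by
  obtain ⟨g, h1, h2⟩ := (isIsoArrow_iff f).1 h
  refine (isIsoArrow_iff _).2 ⟨g ≫ F.map Y X, ?_, ?_⟩
  · rw [Category.assoc, ← postcomp_map, reassoc_of% h1, F.map_id]
  · rw [Category.assoc, ← postcomp_map, reassoc_of% h2, F.map_id]

end Elements

end EnrichedModels

end

noncomputable section

namespace EnrichedModels

/-! ### Natural families -/

section NatFamilies

variable {V : Type u} [Category.{v} V] [MonoidalCategory V] [BraidedCategory V]
variable {B : Type u₁} [EnrichedCategory V B] {C : Type u₂} [EnrichedCategory V C]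
  {D : Type u₃} [EnrichedCategory V D]

lemma IsNatFamily.eq {F G : EnrichedFunctor V C D} {Z : V}
    {s : ∀ a, Z ⟶ eHom V (F.obj a) (G.obj a)} (h : IsNatFamily F G Z s) (a b : C) :
    (β_ Z (eHom V a b)).hom ≫ (F.map a b ⊙ s b) = s a ⊙ G.map a b :=
  h a b

lemma IsNatFamily.comp_left {F G : EnrichedFunctor V C D} {Z Z' : V}
    {s : ∀ a, Z ⟶ eHom V (F.obj a) (G.obj a)} (h : IsNatFamily F G Z s) (u : Z' ⟶ Z) :
    IsNatFamily F G Z' (fun a => u ≫ s a) := by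
  intro a b
  change (β_ _ _).hom ≫ (F.map a b ⊙ (u ≫ s b)) = (u ≫ s a) ⊙ G.map a b
  rw [elemComp_comp, comp_elemComp, ← h.eq a b, braiding_naturality_left_assoc]

/-- Families indexed by the unit object are `V`-natural transformations in the usual sense. -/
lemma isNatFamily_unit_iff {F G : EnrichedFunctor V C D}
    (s : ∀ a, 𝟙_ V ⟶ eHom V (F.obj a) (G.obj a)) :
    IsNatFamily F G (𝟙_ V) s ↔
      ∀ a b, F.map a b ≫ postcomp (s b) (F.obj a) = G.map a b ≫ precomp (s a) (G.obj b) := by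
  refine forall₂_congr fun a b => ?_
  change (β_ _ _).hom ≫ (F.map a b ⊙ s b) = s a ⊙ G.map a b ↔ _
  rw [comp_precomp, comp_postcomp, braiding_tensorUnit_left, Category.assoc, Iso.eq_inv_comp]

lemma VNat.naturality {F G : EnrichedFunctor V C D} (α : VNat F G) (a b : C) :
    F.map a b ≫ postcomp (α.app b) (F.obj a) = G.map a b ≫ precomp (α.app a) (G.obj b) :=
  (isNatFamily_unit_iff _).1 α.natural a b

lemma IsNatFamily.postcomp {F G H : EnrichedFunctor V C D} {Z : V}
    {s : ∀ a, Z ⟶ eHom V (F.obj a) (G.obj a)} (h : IsNatFamily F G Z s) (α : VNat G H) :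
    IsNatFamily F H Z (fun a => s a ≫ EnrichedModels.postcomp (α.app a) (F.obj a)) := by
  intro a b
  change (β_ _ _).hom ≫ (F.map a b ⊙ (s b ≫ EnrichedModels.postcomp _ _)) =
    (s a ≫ EnrichedModels.postcomp _ _) ⊙ H.map a b
  rw [elemComp_comp_postcomp, comp_postcomp_elemComp, ← α.naturality, elemComp_comp_postcomp,
    ← h.eq, Category.assoc]

lemma IsNatFamily.precomp {F G H : EnrichedFunctor V C D} {Z : V}
    {s : ∀ a, Z ⟶ eHom V (G.obj a) (H.obj a)} (h : IsNatFamily G H Z s) (α : VNat F G) :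
    IsNatFamily F H Z (fun a => s a ≫ EnrichedModels.precomp (α.app a) (H.obj a)) := by
  intro a b
  change (β_ _ _).hom ≫ (F.map a b ⊙ (s b ≫ EnrichedModels.precomp _ _)) =
    (s a ≫ EnrichedModels.precomp _ _) ⊙ H.map a b
  rw [comp_precomp_elemComp, ← comp_postcomp_elemComp, α.naturality, comp_precomp_elemComp,
    ← h.eq, Category.assoc]

lemma IsNatFamily.whiskerLeft {F G : EnrichedFunctor V C D} {Z : V}
    {s : ∀ a, Z ⟶ eHom V (F.obj a) (G.obj a)} (h : IsNatFamily F G Z s)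
    (J : EnrichedFunctor V B C) :
    IsNatFamily (J.comp V F) (J.comp V G) Z (fun b => s (J.obj b)) := by
  intro a b
  change (β_ _ _).hom ≫ ((J.map a b ≫ F.map _ _) ⊙ s _) = s _ ⊙ (J.map a b ≫ G.map _ _)
  rw [comp_elemComp, elemComp_comp, ← h.eq, braiding_naturality_right_assoc]

lemma IsNatFamily.whiskerRight {F G : EnrichedFunctor V B C} {Z : V}
    {s : ∀ a, Z ⟶ eHom V (F.obj a) (G.obj a)} (h : IsNatFamily F G Z s)
    (H : EnrichedFunctor V C D) :
    IsNatFamily (F.comp V H) (G.comp V H) Z (fun b => s b ≫ H.map _ _) := by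
  intro a b
  change (β_ _ _).hom ≫ ((F.map a b ≫ H.map _ _) ⊙ (s b ≫ H.map _ _)) =
    (s a ≫ H.map _ _) ⊙ (G.map a b ≫ H.map _ _)
  rw [← elemComp_map, ← elemComp_map, ← h.eq, Category.assoc]

/-- Whiskering a `V`-natural transformation with a `V`-functor on its target. -/
def VNat.whiskerRight {F G : EnrichedFunctor V B C} (α : VNat F G) (H : EnrichedFunctor V C D) :
    VNat (F.comp V H) (G.comp V H) where
  app b := α.app b ≫ H.map _ _
  natural := α.natural.whiskerRight H

/-- Whiskering a `V`-natural transformation with a `V`-functor on its source. -/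
def VNat.whiskerLeft {F G : EnrichedFunctor V C D} (α : VNat F G) (J : EnrichedFunctor V B C) :
    VNat (J.comp V F) (J.comp V G) where
  app b := α.app (J.obj b)
  natural := α.natural.whiskerLeft J

/-- Vertical composition of `V`-natural transformations. -/
def VNat.vcomp {F G H : EnrichedFunctor V C D} (α : VNat F G) (γ : VNat G H) : VNat F H where
  app a := α.app a ≫ EnrichedModels.postcomp (γ.app a) (F.obj a)
  natural := α.natural.postcomp γ

lemma VNat.IsIso.exists_inv {F G : EnrichedFunctor V C D} {α : VNat F G} (h : α.IsIso) :
    ∃ γ : VNat G F, (∀ a, α.app a ≫ EnrichedModels.postcomp (γ.app a) _ = eId V _) ∧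
      ∀ a, γ.app a ≫ EnrichedModels.postcomp (α.app a) _ = eId V _ := by
  choose γ hγ hγ' using fun a => (isIsoArrow_iff _).1 (h a)
  refine ⟨⟨γ, (isNatFamily_unit_iff _).2 fun a b => ?_⟩, hγ, hγ'⟩
  have := (h a).isIso_precomp (F.obj b)
  have := (h b).isIso_postcomp (G.obj a)
  rw [← cancel_mono (EnrichedModels.precomp (α.app a) (F.obj b)), Category.assoc, Category.assoc,
    precomp_comp_precomp, comp_precomp_eq_comp_postcomp, hγ, precomp_eId, Category.comp_id,
    ← precomp_postcomp, ← reassoc_of% α.naturality, postcomp_comp_postcomp, hγ, postcomp_eId,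
    Category.comp_id]

end NatFamilies

/-! ### Weighted limits -/

section Limits

variable {V : Type u} [Category.{v} V] [MonoidalCategory V] [MonoidalClosed V]
variable {B : Type w} [EnrichedCategory V B] {K : Type u₁} [EnrichedCategory V K]
  {K' : Type u₂} [EnrichedCategory V K']
variable {W : EnrichedFunctor V B V} {S S' : EnrichedFunctor V B K} {L L' X Y : K} {Z Z' : V}
  {c : ∀ b, W.obj b ⟶ eHom V L (S.obj b)} {c' : ∀ b, W.obj b ⟶ eHom V L' (S.obj b)}

/-- The cone `c` with vertex `L` has the universal property of the weighted limit `{W, S}` with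
respect to the object `X`: it induces `K(X, L) ≅ [B, V](W, K(X, S -))`. -/
def IsLimitAt (W : EnrichedFunctor V B V) (S : EnrichedFunctor V B K) (L : K)
    (c : ∀ b, W.obj b ⟶ eHom V L (S.obj b)) (X : K) : Prop :=
  ∀ (Z : V) (d : ∀ b, Z ⊗ W.obj b ⟶ eHom V X (S.obj b)), IsIndexedCone W S X Z d →
    ∃! f : Z ⟶ eHom V X L, ∀ b, f ⊙ c b = d b

lemma IsWeightedLimit.isLimitAt (h : IsWeightedLimit W S L c) (X : K) : IsLimitAt W S L c X :=
  h.2 X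

lemma IsWeightedCone.eq (h : IsWeightedCone W S L c) (a b : B) :
    act W a b ≫ c b = c a ⊙ S.map a b :=
  h a b

lemma IsIndexedCone.eq {d : ∀ b, Z ⊗ W.obj b ⟶ eHom V X (S.obj b)}
    (h : IsIndexedCone W S X Z d) (a b : B) :
    Z ◁ act W a b ≫ d b = (α_ _ _ _).inv ≫ (d a ⊙ S.map a b) :=
  h a b

lemma IsWeightedCone.isIndexedCone (h : IsWeightedCone W S L c) (f : Z ⟶ eHom V X L) :
    IsIndexedCone W S X Z (fun b => f ⊙ c b) := by
  intro a b
  change Z ◁ act W a b ≫ (f ⊙ c b) = (α_ _ _ _).inv ≫ ((f ⊙ c a) ⊙ S.map a b)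
  rw [elemComp_assoc, Iso.inv_hom_id_assoc, ← h.eq, elemComp_comp]

lemma IsWeightedCone.isIndexedCone_unit (h : IsWeightedCone W S L c) :
    IsIndexedCone W S L (𝟙_ V) (fun b => (λ_ _).hom ≫ c b) := by
  simpa only [eId_elemComp] using h.isIndexedCone (eId V L)

lemma IsIndexedCone.postcomp [BraidedCategory V] {d : ∀ b, Z ⊗ W.obj b ⟶ eHom V X (S.obj b)}
    (h : IsIndexedCone W S X Z d) (σ : VNat S S') :
    IsIndexedCone W S' X Z (fun b => d b ≫ EnrichedModels.postcomp (σ.app b) X) := by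
  intro a b
  change Z ◁ act W a b ≫ d b ≫ _ = (α_ _ _ _).inv ≫ ((d a ≫ _) ⊙ S'.map a b)
  rw [reassoc_of% h.eq, comp_postcomp_elemComp, ← σ.naturality, elemComp_comp_postcomp]

lemma IsIndexedCone.map {d : ∀ b, Z ⊗ W.obj b ⟶ eHom V X (S.obj b)}
    (h : IsIndexedCone W S X Z d) (H : EnrichedFunctor V K K') :
    IsIndexedCone W (S.comp V H) (H.obj X) Z (fun b => d b ≫ H.map X (S.obj b)) := by
  intro a b
  change Z ◁ act W a b ≫ d b ≫ _ = (α_ _ _ _).inv ≫ ((d a ≫ _) ⊙ (S.map a b ≫ H.map _ _))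
  rw [reassoc_of% h.eq, elemComp_map]

lemma IsWeightedCone.map (h : IsWeightedCone W S L c) (H : EnrichedFunctor V K K') :
    IsWeightedCone W (S.comp V H) (H.obj L) (fun b => c b ≫ H.map L (S.obj b)) := by
  intro a b
  change act W a b ≫ c b ≫ _ = (c a ≫ _) ⊙ (S.map a b ≫ H.map _ _)
  rw [reassoc_of% h.eq, elemComp_map]

lemma IsWeightedCone.precomp (h : IsWeightedCone W S L c) (k : 𝟙_ V ⟶ eHom V X L) :
    IsWeightedCone W S X (fun b => c b ≫ EnrichedModels.precomp k (S.obj b)) := by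
  intro a b
  change act W a b ≫ c b ≫ _ = (c a ≫ _) ⊙ S.map a b
  rw [reassoc_of% h.eq, comp_precomp_elemComp]

lemma IsWeightedCone.postcomp [BraidedCategory V] (h : IsWeightedCone W S L c) (σ : VNat S S') :
    IsWeightedCone W S' L (fun b => c b ≫ EnrichedModels.postcomp (σ.app b) L) := by
  intro a b
  change act W a b ≫ c b ≫ _ = (c a ≫ _) ⊙ S'.map a b
  rw [reassoc_of% h.eq, comp_postcomp_elemComp, ← σ.naturality, elemComp_comp_postcomp]

lemma IsLimitAt.ext (h : IsLimitAt W S L c X) (hc : IsWeightedCone W S L c)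
    {f g : Z ⟶ eHom V X L} (hfg : ∀ b, f ⊙ c b = g ⊙ c b) : f = g :=
  (h Z (fun b => g ⊙ c b) (hc.isIndexedCone g)).unique hfg (fun _ => rfl)

lemma IsWeightedLimit.ext (h : IsWeightedLimit W S L c)
    {f g : Z ⟶ eHom V X L} (hfg : ∀ b, f ⊙ c b = g ⊙ c b) : f = g :=
  (h.isLimitAt X).ext h.1 hfg

lemma IsWeightedLimit.exists_lift (h : IsWeightedLimit W S L c)
    {d : ∀ b, W.obj b ⟶ eHom V X (S.obj b)} (hd : IsWeightedCone W S X d) :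
    ∃ k : 𝟙_ V ⟶ eHom V X L, ∀ b, c b ≫ EnrichedModels.precomp k (S.obj b) = d b := by
  obtain ⟨k, hk, -⟩ := h.2 X _ _ hd.isIndexedCone_unit
  refine ⟨k, fun b => ?_⟩
  rw [comp_precomp]
  exact (congrArg ((λ_ _).inv ≫ ·) (hk b)).trans (Iso.inv_hom_id_assoc _ _)

lemma IsWeightedLimit.arrow_ext (h : IsWeightedLimit W S L c) {k k' : 𝟙_ V ⟶ eHom V X L}
    (hk : ∀ b, c b ≫ EnrichedModels.precomp k (S.obj b) =
      c b ≫ EnrichedModels.precomp k' (S.obj b)) : k = k' := by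
  refine h.ext fun b => ?_
  have := hk b
  rwa [comp_precomp, comp_precomp, cancel_epi] at this

lemma IsWeightedLimit.exists_iso (h : IsWeightedLimit W S L c) (h' : IsWeightedLimit W S L' c') :
    ∃ k : 𝟙_ V ⟶ eHom V L L', IsIsoArrow k ∧
      ∀ b, c' b ≫ EnrichedModels.precomp k (S.obj b) = c b := by
  obtain ⟨k, hk⟩ := h'.exists_lift h.1
  obtain ⟨l, hl⟩ := h.exists_lift h'.1
  refine ⟨k, (isIsoArrow_iff _).2 ⟨l, h.arrow_ext fun b => ?_, h'.arrow_ext fun b => ?_⟩, hk⟩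
  · rw [← comp_precomp_eq_comp_postcomp, ← precomp_comp_precomp, reassoc_of% hl, hk, precomp_eId,
      Category.comp_id]
  · rw [← comp_precomp_eq_comp_postcomp, ← precomp_comp_precomp, reassoc_of% hk, hl, precomp_eId,
      Category.comp_id]

/-- A comparison map `k` into a limit detects at which objects a cone has the universal property
of the limit. -/
lemma IsWeightedLimit.isLimitAt_iff_isIso (h : IsWeightedLimit W S L c) {k : 𝟙_ V ⟶ eHom V L' L}
    (hk : ∀ b, c b ≫ EnrichedModels.precomp k (S.obj b) = c' b) (X : K) :
    IsLimitAt W S L' c' X ↔ IsIso (EnrichedModels.postcomp k X) := by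
  have key : ∀ {Z : V} (f : Z ⟶ eHom V X L') b, f ⊙ c' b =
      (f ≫ EnrichedModels.postcomp k X) ⊙ c b := by
    intro Z f b
    rw [comp_postcomp_elemComp, hk]
  constructor
  · intro hX
    refine isIso_of_bijective _ fun Z g => ?_
    obtain ⟨f, hf, hu⟩ := hX Z (fun b => g ⊙ c b) (h.1.isIndexedCone g)
    refine ⟨f, h.ext fun b => by rw [← key, hf], fun f' hf' => hu f' fun b => ?_⟩
    rw [key, hf']
  · intro hk Z d hd
    obtain ⟨g, hg, hgu⟩ := h.2 X Z d hd
    obtain ⟨f, hf, hu⟩ := existsUnique_comp_eq (EnrichedModels.postcomp k X) g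
    refine ⟨f, fun b => by rw [key, hf]; exact hg b, fun f' hf' => hu f' (hgu _ fun b => ?_)⟩
    exact (key f' b).symm.trans (hf' b)

lemma IsWeightedLimit.of_isIsoArrow (h : IsWeightedLimit W S L c) {k : 𝟙_ V ⟶ eHom V L' L}
    (hk : IsIsoArrow k) :
    IsWeightedLimit W S L' (fun b => c b ≫ EnrichedModels.precomp k (S.obj b)) :=
  ⟨h.1.precomp k, fun X => (h.isLimitAt_iff_isIso (fun _ => rfl) X).2
    (hk.isIso_postcomp X)⟩

lemma IsWeightedLimit.of_isIsoArrow' (h : IsWeightedLimit W S L c) {k : 𝟙_ V ⟶ eHom V L' L}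
    (hk : IsIsoArrow k) (hc : ∀ b, c b ≫ EnrichedModels.precomp k (S.obj b) = c' b) :
    IsWeightedLimit W S L' c' := by
  obtain rfl : (fun b => c b ≫ EnrichedModels.precomp k (S.obj b)) = c' := funext hc
  exact h.of_isIsoArrow hk

lemma IsWeightedLimit.of_eq {c c' : ∀ b, W.obj b ⟶ eHom V L (S.obj b)}
    (h : IsWeightedLimit W S L c) (hc : ∀ b, c b = c' b) : IsWeightedLimit W S L c' := by
  obtain rfl : c = c' := funext hc
  exact h

/-- Transport of a limit along an equality of diagrams that agree on objects definitionally and on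
hom-objects propositionally, as for two bracketings of a composite of `V`-functors. -/
lemma IsWeightedLimit.of_map_eq {o : B → K}
    {m m' : ∀ a b, eHom V a b ⟶ eHom V (o a) (o b)} {i q i' q'}
    {c c' : ∀ b, W.obj b ⟶ eHom V L (o b)}
    (h : IsWeightedLimit W ⟨o, m, i, q⟩ L c) (hm : ∀ a b, m a b = m' a b)
    (hc : ∀ b, c b = c' b) : IsWeightedLimit W ⟨o, m', i', q'⟩ L c' := by
  obtain rfl : m = m' := funext fun a => funext fun b => hm a b
  exact h.of_eq hc

/-- If `H` preserves one limit of `S`, it preserves every limit of `S` with the same weight. -/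
lemma IsWeightedLimit.map_of_map (h : IsWeightedLimit W S L c) (h' : IsWeightedLimit W S L' c')
    (H : EnrichedFunctor V K K')
    (hH : IsWeightedLimit W (S.comp V H) (H.obj L) (fun b => c b ≫ H.map L (S.obj b))) :
    IsWeightedLimit W (S.comp V H) (H.obj L') (fun b => c' b ≫ H.map L' (S.obj b)) := by
  obtain ⟨k, hk, hc⟩ := h'.exists_iso h
  refine hH.of_isIsoArrow' (hk.map H) fun b => ?_
  change (c b ≫ H.map L (S.obj b)) ≫ EnrichedModels.precomp _ (H.obj (S.obj b)) =
    c' b ≫ H.map L' (S.obj b)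
  rw [Category.assoc, ← hc b, Category.assoc, precomp_map]

/-- Limits are invariant under isomorphisms of diagrams; the statement is for one test object. -/
lemma isLimitAt_postcomp_iff [BraidedCategory V] (σ : VNat S S') (hσ : σ.IsIso) (X : K) :
    IsLimitAt W S' L (fun b => c b ≫ EnrichedModels.postcomp (σ.app b) L) X ↔
      IsLimitAt W S L c X := by
  obtain ⟨τ, hτ, hτ'⟩ := hσ.exists_inv
  have e : ∀ (b : B) (Y : K), EnrichedModels.postcomp (σ.app b) Y ≫
      EnrichedModels.postcomp (τ.app b) Y = 𝟙 _ := fun b Y => by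
    rw [postcomp_comp_postcomp, hτ, postcomp_eId]
  have e' : ∀ (b : B) (Y : K), EnrichedModels.postcomp (τ.app b) Y ≫
      EnrichedModels.postcomp (σ.app b) Y = 𝟙 _ := fun b Y => by
    rw [postcomp_comp_postcomp, hτ', postcomp_eId]
  constructor
  · intro h Z d hd
    obtain ⟨f, hf, hu⟩ := h Z _ (hd.postcomp σ)
    refine ⟨f, fun b => ?_, fun f' hf' => hu f' fun b => ?_⟩
    · have h1 := congrArg (· ≫ EnrichedModels.postcomp (τ.app b) X) (hf b)
      simpa only [elemComp_comp_postcomp, Category.assoc, e, Category.comp_id] using h1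
    · rw [elemComp_comp_postcomp, hf']
  · intro h Z d hd
    obtain ⟨f, hf, hu⟩ := h Z _ (hd.postcomp τ)
    refine ⟨f, fun b => ?_, fun f' hf' => hu f' fun b => ?_⟩
    · rw [elemComp_comp_postcomp, hf]
      simp only [Category.assoc, e', Category.comp_id]
    · have h1 := congrArg (· ≫ EnrichedModels.postcomp (τ.app b) X) (hf' b)
      simpa only [elemComp_comp_postcomp, Category.assoc, e, Category.comp_id] using h1

lemma IsWeightedLimit.postcomp [BraidedCategory V] (h : IsWeightedLimit W S L c) (σ : VNat S S')
    (hσ : σ.IsIso) :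
    IsWeightedLimit W S' L (fun b => c b ≫ EnrichedModels.postcomp (σ.app b) L) :=
  ⟨h.1.postcomp σ, fun X => (isLimitAt_postcomp_iff σ hσ X).2 (h.2 X)⟩

/-- Isomorphic `V`-functors preserve the same limits. -/
lemma IsWeightedLimit.map_of_iso [BraidedCategory V] {H H' : EnrichedFunctor V K K'}
    (θ : VNat H H') (hθ : θ.IsIso) (c : ∀ b, W.obj b ⟶ eHom V L (S.obj b))
    (h : IsWeightedLimit W (S.comp V H') (H'.obj L) (fun b => c b ≫ H'.map L (S.obj b))) :
    IsWeightedLimit W (S.comp V H) (H.obj L) (fun b => c b ≫ H.map L (S.obj b)) := by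
  obtain ⟨τ, hτ, hτ'⟩ := hθ.exists_inv
  have hτi : τ.IsIso := fun a => (isIsoArrow_iff _).2 ⟨_, hτ' a, hτ a⟩
  refine (h.postcomp (τ.whiskerLeft S) (fun b => hτi (S.obj b))).of_isIsoArrow'
    (hθ L) fun b => ?_
  have e1 := θ.naturality L (S.obj b)
  have e2 : EnrichedModels.postcomp (θ.app (S.obj b)) (H.obj L) ≫
      EnrichedModels.postcomp (τ.app (S.obj b)) (H.obj L) = 𝟙 _ := by
    rw [postcomp_comp_postcomp, hτ, postcomp_eId]
  change ((c b ≫ H'.map L (S.obj b)) ≫ EnrichedModels.postcomp (τ.app (S.obj b)) _) ≫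
    EnrichedModels.precomp (θ.app L) (H.obj (S.obj b)) = c b ≫ H.map L (S.obj b)
  rw [Category.assoc, Category.assoc, ← precomp_postcomp, ← reassoc_of% e1, e2, Category.comp_id]

lemma PhiContinuous.comp [BraidedCategory V] {K'' : Type u₃} [EnrichedCategory V K'']
    {Φ : WeightClass.{w} V}
    {H : EnrichedFunctor V K K'} {H' : EnrichedFunctor V K' K''} (h : PhiContinuous Φ H)
    (h' : PhiContinuous Φ H') : PhiContinuous Φ (H.comp V H') := by
  intro A _ W hW S L c hc
  refine (h' A W hW _ _ _ (h A W hW S L c hc)).of_map_eq (fun a b => ?_)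
    (fun b => ?_)
  · exact Category.assoc _ _ _
  · exact Category.assoc _ _ _

end Limits

end EnrichedModels

end

noncomputable section

namespace EnrichedModels

/-! ### Limits in the base category -/

section Base

variable {V : Type u} [Category.{v} V] [MonoidalCategory V] [MonoidalClosed V]
variable {B : Type w} [EnrichedCategory V B] {K : Type u₁} [EnrichedCategory V K]

lemma uncurry_elemComp {X Y Z P Q : V} (f : P ⟶ eHom V X Y) (g : Q ⟶ eHom V Y Z) :
    uncurry (f ⊙ g) = (α_ X P Q).inv ≫ (uncurry f ▷ Q) ≫ uncurry g :=
  uncurry_eComp f g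

lemma uncurry_comp_left {X Y P Q : V} (u : P ⟶ Q) (f : Q ⟶ eHom V X Y) :
    uncurry (u ≫ f) = X ◁ u ≫ uncurry f :=
  uncurry_natural_left u f

/-- The arrow of the `V`-category `V` given by a morphism of `V`. -/
def toArrow {X Y : V} (f : X ⟶ Y) : 𝟙_ V ⟶ eHom V X Y := curry ((ρ_ X).hom ≫ f)

/-- The morphism of `V` given by an arrow of the `V`-category `V`. -/
def ofArrow {X Y : V} (r : 𝟙_ V ⟶ eHom V X Y) : X ⟶ Y := (ρ_ X).inv ≫ uncurry r

lemma uncurry_toArrow {X Y : V} (f : X ⟶ Y) : uncurry (toArrow f) = (ρ_ X).hom ≫ f :=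
  uncurry_curry _

lemma ofArrow_toArrow {X Y : V} (f : X ⟶ Y) : ofArrow (toArrow f) = f := by
  rw [ofArrow, uncurry_toArrow, Iso.inv_hom_id_assoc]

lemma toArrow_ofArrow {X Y : V} (r : 𝟙_ V ⟶ eHom V X Y) : toArrow (ofArrow r) = r := by
  apply uncurry_injective
  rw [uncurry_toArrow, ofArrow, Iso.hom_inv_id_assoc]

lemma uncurry_comp_postcomp {X Y Z P : V} (f : P ⟶ eHom V X Y) (r : 𝟙_ V ⟶ eHom V Y Z) :
    uncurry (f ≫ postcomp r X) = uncurry f ≫ ofArrow r := by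
  rw [comp_postcomp, uncurry_comp_left, uncurry_elemComp, ofArrow, rightUnitor_inv_naturality_assoc]
  simp

lemma uncurry_comp_precomp {X Y Z P : V} (f : P ⟶ eHom V Y Z) (r : 𝟙_ V ⟶ eHom V X Y) :
    uncurry (f ≫ precomp r Z) = ofArrow r ▷ P ≫ uncurry f := by
  rw [comp_precomp, uncurry_comp_left, uncurry_elemComp, ofArrow]
  simp

lemma ofArrow_comp_postcomp {X Y Z : V} (r : 𝟙_ V ⟶ eHom V X Y) (s : 𝟙_ V ⟶ eHom V Y Z) :
    ofArrow (r ≫ postcomp s X) = ofArrow r ≫ ofArrow s := by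
  rw [ofArrow, uncurry_comp_postcomp, ← Category.assoc, ← ofArrow]

lemma ofArrow_eId (X : V) : ofArrow (eId V X) = 𝟙 X := by
  rw [ofArrow, uncurry_eId, Iso.inv_hom_id]

lemma isIsoArrow_iff_isIso_ofArrow {X Y : V} (r : 𝟙_ V ⟶ eHom V X Y) :
    IsIsoArrow r ↔ IsIso (ofArrow r) := by
  rw [isIsoArrow_iff]
  constructor
  · rintro ⟨s, h1, h2⟩
    exact ⟨ofArrow s, by rw [← ofArrow_comp_postcomp, h1, ofArrow_eId],
      by rw [← ofArrow_comp_postcomp, h2, ofArrow_eId]⟩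
  · rintro ⟨s, h1, h2⟩
    have key : ∀ {X Y : V} (a : 𝟙_ V ⟶ eHom V X Y) (b : Y ⟶ X), ofArrow a ≫ b = 𝟙 _ →
        a ≫ postcomp (toArrow b) X = eId V X := by
      intro X Y a b h
      rw [← toArrow_ofArrow (a ≫ _), ofArrow_comp_postcomp, ofArrow_toArrow, h, ← ofArrow_eId,
        toArrow_ofArrow]
    refine ⟨toArrow s, key _ _ h1, ?_⟩
    have := key (toArrow s) (ofArrow r) (by rwa [ofArrow_toArrow])
    rwa [toArrow_ofArrow] at this

/-- The family `d b : Z ⊗ W b ⟶ S b` is `V`-natural in `b`. -/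
def IsBaseCone (W S : EnrichedFunctor V B V) (Z : V) (d : ∀ b, Z ⊗ W.obj b ⟶ S.obj b) : Prop :=
  ∀ a b, Z ◁ act W a b ≫ d b = (α_ _ _ _).inv ≫ d a ▷ _ ≫ act S a b

variable {W S : EnrichedFunctor V B V}

lemma IsBaseCone.comp_left {Z Z' : V} {d : ∀ b, Z ⊗ W.obj b ⟶ S.obj b} (h : IsBaseCone W S Z d)
    (u : Z' ⟶ Z) : IsBaseCone W S Z' (fun b => u ▷ _ ≫ d b) := by
  intro a b
  rw [whisker_exchange_assoc, h a b]
  simp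

lemma isWeightedCone_base_iff {L : V} (c : ∀ b, W.obj b ⟶ eHom V L (S.obj b)) :
    IsWeightedCone W S L c ↔ IsBaseCone W S L (fun b => uncurry (c b)) := by
  refine forall₂_congr fun a b => ?_
  change act W a b ≫ c b = c a ⊙ S.map a b ↔ _
  rw [← uncurry_injective.eq_iff, uncurry_comp_left, uncurry_elemComp]
  rfl

lemma isIndexedCone_base_iff {X Z : V} (d : ∀ b, Z ⊗ W.obj b ⟶ eHom V X (S.obj b)) :
    IsIndexedCone W S X Z d ↔
      IsBaseCone W S (X ⊗ Z) (fun b => (α_ _ _ _).hom ≫ uncurry (d b)) := by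
  refine forall₂_congr fun a b => ?_
  change Z ◁ act W a b ≫ d b = (α_ _ _ _).inv ≫ (d a ⊙ S.map a b) ↔ _
  rw [← uncurry_injective.eq_iff, uncurry_comp_left, uncurry_comp_left, uncurry_elemComp,
    ← cancel_epi (α_ X Z (W.obj a ⊗ eHom V a b)).hom]
  have e : (α_ X Z (W.obj a ⊗ eHom V a b)).hom ≫ X ◁ (α_ Z (W.obj a) (eHom V a b)).inv ≫
      (α_ X (Z ⊗ W.obj a) (eHom V a b)).inv =
      (α_ (X ⊗ Z) (W.obj a) (eHom V a b)).inv ≫ (α_ X Z (W.obj a)).hom ▷ _ := by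
    monoidal
  rw [reassoc_of% e, comp_whiskerRight, Category.assoc, associator_naturality_right_assoc]
  rfl

/-- Limits in `V` can be tested on ordinary morphisms of `V`. -/
lemma isWeightedLimit_base_iff {L : V} (c : ∀ b, W.obj b ⟶ eHom V L (S.obj b)) :
    IsWeightedLimit W S L c ↔ IsBaseCone W S L (fun b => uncurry (c b)) ∧
      ∀ (Z : V) (d : ∀ b, Z ⊗ W.obj b ⟶ S.obj b), IsBaseCone W S Z d →
        ∃! f : Z ⟶ L, ∀ b, f ▷ _ ≫ uncurry (c b) = d b := by
  have key : ∀ {X Z : V} (f : Z ⟶ eHom V X L) (d : ∀ b, Z ⊗ W.obj b ⟶ eHom V X (S.obj b)) b,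
      f ⊙ c b = d b ↔ uncurry f ▷ _ ≫ uncurry (c b) = (α_ _ _ _).hom ≫ uncurry (d b) := by
    intro X Z f d b
    rw [← uncurry_injective.eq_iff, uncurry_elemComp, Iso.inv_comp_eq]
  rw [← isWeightedCone_base_iff]
  refine and_congr_right fun hc => ⟨fun h Z d hd => ?_, fun h X Z d hd => ?_⟩
  · have e : ∀ b, (α_ (𝟙_ V) Z (W.obj b)).hom ≫ uncurry (curry ((λ_ _).hom ≫ d b)) =
        (λ_ Z).hom ▷ _ ≫ d b := by
      intro b
      rw [uncurry_curry]
      simp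
    obtain ⟨f, hf, hu⟩ := h (𝟙_ V) Z (fun b => curry ((λ_ _).hom ≫ d b))
      ((isIndexedCone_base_iff _).2 (by simpa only [e] using hd.comp_left (λ_ Z).hom))
    refine ⟨(λ_ Z).inv ≫ uncurry f, fun b => ?_, fun g hg => ?_⟩
    · have := (key f (fun b => curry ((λ_ _).hom ≫ d b)) b).1 (hf b)
      rw [comp_whiskerRight, Category.assoc, this, e]
      simp
    · have := hu (curry ((λ_ Z).hom ≫ g)) fun b =>
        (key _ (fun b => curry ((λ_ _).hom ≫ d b)) b).2 (by
          rw [uncurry_curry, e, comp_whiskerRight, Category.assoc, hg])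
      rw [← this, uncurry_curry, Iso.inv_hom_id_assoc]
  · obtain ⟨f, hf, hu⟩ := h _ _ ((isIndexedCone_base_iff _).1 hd)
    refine ⟨curry f, fun b => (key _ _ b).2 ?_, fun g hg => ?_⟩
    · rw [uncurry_curry, hf]
    · rw [← hu (uncurry g) fun b => (key _ _ b).1 (hg b), MonoidalClosed.curry_uncurry]

variable {S : EnrichedFunctor V B K} {L : K} {c : ∀ b, W.obj b ⟶ eHom V L (S.obj b)}

/-- Cones with vertex `X` are cones in `V` over the diagram `K(X, S -)`. -/
lemma isBaseCone_homFunctor_iff (X : K) {Z : V} (d : ∀ b, Z ⊗ W.obj b ⟶ eHom V X (S.obj b)) :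
    IsBaseCone W (S.comp V (homFunctor X)) Z d ↔ IsIndexedCone W S X Z d := by
  refine forall₂_congr fun a b => ?_
  have e : act (S.comp V (homFunctor X)) a b = _ ◁ S.map a b ≫ eComp V X (S.obj a) (S.obj b) := by
    refine (uncurry_comp_left (S.map a b) (curry (eComp V X (S.obj a) (S.obj b)))).trans ?_
    rw [uncurry_curry]
  rw [e, MonoidalCategory.tensorHom_def, Category.assoc]
  rfl

/-- The universal property with respect to `X` says that the representable `K(X, -)` takes the cone
to a limit cone in `V`. -/
lemma isLimitAt_iff_homFunctor (hc : IsWeightedCone W S L c) (X : K) :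
    IsLimitAt W S L c X ↔ IsWeightedLimit W (S.comp V (homFunctor X)) (eHom V X L)
      (fun b => c b ≫ (homFunctor X).map L (S.obj b)) := by
  have e : ∀ b {Z : V} (f : Z ⟶ eHom V X L),
      f ▷ _ ≫ uncurry (c b ≫ (homFunctor X).map L (S.obj b)) = f ⊙ c b := by
    intro b Z f
    refine (congrArg (_ ≫ ·) (uncurry_comp_left (c b)
      (curry (eComp V X L (S.obj b))))).trans ?_
    rw [uncurry_curry, elemComp, MonoidalCategory.tensorHom_def, Category.assoc]
  rw [isWeightedLimit_base_iff, ← isWeightedCone_base_iff]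
  refine ⟨fun h => ⟨hc.map (homFunctor X), fun Z d hd => ?_⟩, fun h Z d hd => ?_⟩
  · obtain ⟨f, hf, hu⟩ := h Z d ((isBaseCone_homFunctor_iff X d).1 hd)
    exact ⟨f, fun b => (e b f).trans (hf b), fun g hg => hu g fun b => (e b g).symm.trans (hg b)⟩
  · obtain ⟨f, hf, hu⟩ := h.2 Z d ((isBaseCone_homFunctor_iff X d).2 hd)
    exact ⟨f, fun b => (e b f).symm.trans (hf b), fun g hg => hu g fun b => (e b g).trans (hg b)⟩

/-- Representables preserve weighted limits. -/
lemma IsWeightedLimit.map_homFunctor (h : IsWeightedLimit W S L c) (X : K) :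
    IsWeightedLimit W (S.comp V (homFunctor X)) (eHom V X L)
      (fun b => c b ≫ (homFunctor X).map L (S.obj b)) :=
  (isLimitAt_iff_homFunctor h.1 X).1 (h.2 X)

end Base

section SmallLimits

variable {V : Type u} [Category.{v} V] [MonoidalCategory V] [BraidedCategory V] [MonoidalClosed V]

/-- For `V`-valued functors, families of transformations `Z ⟶ [W b, S b]` are, by transposition,
natural families `Z ⊗ W b ⟶ S b`. -/
lemma isNatFamily_base_iff {B : Type w} [EnrichedCategory V B] (W S : EnrichedFunctor V B V)
    {Z : V} (g : ∀ b, Z ⟶ eHom V (W.obj b) (S.obj b)) :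
    IsNatFamily W S Z g ↔ IsBaseCone W S Z (fun b => (β_ _ _).hom ≫ uncurry (g b)) := by
  refine forall₂_congr fun a b => ?_
  change (β_ _ _).hom ≫ (W.map a b ⊙ g b) = g a ⊙ S.map a b ↔ _
  rw [← uncurry_injective.eq_iff, uncurry_comp_left, uncurry_elemComp, uncurry_elemComp,
    ← cancel_epi (α_ _ _ _).hom, ← cancel_epi ((β_ Z (W.obj a)).hom ▷ eHom V a b),
    ← cancel_epi (α_ _ _ _).inv, Iso.hom_inv_id_assoc, ← braiding_tensor_right_hom_assoc,
    ← braiding_naturality_right_assoc, comp_whiskerRight, Category.assoc]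
  rfl

variable [HasLimits V]

/-- `V` has all limits with small weights: `{W, S}` is the hom-object `[B, V](W, S)`. -/
lemma exists_isWeightedLimit_base {B : Type v} [EnrichedCategory V B]
    (W S : EnrichedFunctor V B V) : ∃ L c, IsWeightedLimit W S L c := by
  refine ⟨homObj W S, fun b => curry ((β_ _ _).hom ≫ uncurry (homπ W S b)),
    (isWeightedLimit_base_iff _).2 ⟨?_, fun Z d hd => ?_⟩⟩
  · simp only [uncurry_curry]
    exact (isNatFamily_base_iff W S _).1 (isNatFamily_homπ W S)
  · have hg : IsNatFamily W S Z (fun b => curry ((β_ _ _).inv ≫ d b)) :=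
      (isNatFamily_base_iff W S _).2 (by simpa [uncurry_curry] using hd)
    have e : ∀ (f : Z ⟶ homObj W S) b,
        f ▷ _ ≫ uncurry (curry ((β_ _ _).hom ≫ uncurry (homπ W S b))) =
          (β_ _ _).hom ≫ uncurry (f ≫ homπ W S b) := by
      intro f b
      rw [uncurry_curry, braiding_naturality_left_assoc]
      exact congrArg (_ ≫ ·) (uncurry_comp_left f (homπ W S b)).symm
    refine ⟨homLift _ hg, fun b => ?_, fun f hf => homObj_ext fun b => ?_⟩
    · rw [e, homLift_π]
      exact (congrArg (_ ≫ ·) (uncurry_curry _)).trans (Iso.hom_inv_id_assoc _ _)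
    · rw [homLift_π]
      apply uncurry_injective
      refine Eq.trans ?_ (uncurry_curry _).symm
      rw [Iso.eq_inv_comp, ← e, hf]

end SmallLimits

section Reduction

variable {V : Type u} [Category.{v} V] [MonoidalCategory V] [BraidedCategory V] [MonoidalClosed V]

/-- A weight is a small colimit of representables; this is its universal property in terms of
morphisms of `V`. -/
lemma IsWeight.exists_restriction {A : Type w} [EnrichedCategory V A]
    {W : EnrichedFunctor V Aᵒᵖ V} (hW : IsWeight W) :
    ∃ (B : Type v) (_ : EnrichedCategory V B) (J : EnrichedFunctor V Bᵒᵖ Aᵒᵖ)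
      (G : EnrichedFunctor V Bᵒᵖ V) (h : ∀ b, G.obj b ⟶ W.obj (J.obj b)),
      (∀ a b, act G a b ≫ h b = h a ▷ _ ≫ _ ◁ J.map a b ≫ act W (J.obj a) (J.obj b)) ∧
      ∀ (H : EnrichedFunctor V Aᵒᵖ V) (Z : V) (d : ∀ b, Z ⊗ G.obj b ⟶ H.obj (J.obj b)),
        IsBaseCone G (J.comp V H) Z d →
          ∃! e : ∀ a, Z ⊗ W.obj a ⟶ H.obj a, IsBaseCone W H Z e ∧
            ∀ b, Z ◁ h b ≫ e (J.obj b) = d b := by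
  obtain ⟨B, _, J, G, η, hη⟩ := hW
  refine ⟨B, _, opFunctor J, G, fun b => ofArrow (η.app b), fun a b => ?_, fun H Z d hd => ?_⟩
  · have h2 := congrArg uncurry (η.naturality a b)
    rw [uncurry_comp_postcomp, uncurry_comp_precomp] at h2
    exact h2.trans (congrArg (_ ≫ ·) (uncurry_comp_left _ _))
  · have hd' : IsNatFamily G ((opFunctor J).comp V H) Z (fun b => curry ((β_ _ _).inv ≫ d b)) := by
      have e2 : ∀ b, (β_ _ _).hom ≫ uncurry (curry ((β_ _ _).inv ≫ d b)) = d b := fun b => by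
        rw [uncurry_curry, Iso.hom_inv_id_assoc]
      refine (isNatFamily_base_iff _ _ _).2 fun a b => ?_
      exact (congrArg (_ ≫ ·) (e2 b)).trans ((hd a b).trans
        (congrArg (fun z => _ ≫ z ▷ _ ≫ _) (e2 a).symm))
    have e1 : ∀ (b : Bᵒᵖ) (f : Z ⟶ eHom V (W.obj ((opFunctor J).obj b))
          (H.obj ((opFunctor J).obj b))),
        (f ≫ precomp (η.app b) _ = curry ((β_ _ _).inv ≫ d b)) ↔
          Z ◁ ofArrow (η.app b) ≫ (β_ _ _).hom ≫ uncurry f = d b := by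
      intro b f
      rw [← uncurry_injective.eq_iff]
      refine (Eq.congr (uncurry_comp_precomp _ _) (uncurry_curry _)).trans ?_
      rw [Iso.eq_inv_comp]
      exact Eq.congr (braiding_naturality_right_assoc _ _ _).symm rfl
    obtain ⟨f, ⟨hf, hf'⟩, hu⟩ := hη H Z _ hd'
    refine ⟨fun a => (β_ _ _).hom ≫ uncurry (f a),
      ⟨(isNatFamily_base_iff _ _ _).1 hf, fun b => (e1 b _).1 (hf' b)⟩, fun e he => ?_⟩
    have e2 : ∀ a, (β_ _ _).hom ≫ uncurry (curry ((β_ _ _).inv ≫ e a)) = e a := fun a => by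
      rw [uncurry_curry, Iso.hom_inv_id_assoc]
    have h2 := hu (fun a => curry ((β_ _ _).inv ≫ e a))
      ⟨(isNatFamily_base_iff _ _ _).2 (by simpa only [e2] using he.1), fun b => (e1 b _).2
        ((congrArg (_ ≫ ·) (e2 _)).trans (he.2 b))⟩
    funext a
    rw [← h2, e2]

/-- If `K` has limits with small weights, then it has all limits whose weight is a small colimit
of representables. -/
lemma exists_isWeightedLimit_of_isWeight {K : Type u₁} [EnrichedCategory V K]
    (hK : ∀ (B : Type v) [EnrichedCategory V B] (W : EnrichedFunctor V Bᵒᵖ V)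
      (S : EnrichedFunctor V Bᵒᵖ K), ∃ L c, IsWeightedLimit W S L c)
    {A : Type w} [EnrichedCategory V A] (W : EnrichedFunctor V Aᵒᵖ V) (hW : IsWeight W)
    (S : EnrichedFunctor V Aᵒᵖ K) : ∃ L c, IsWeightedLimit W S L c := by
  obtain ⟨B, _, J, G, h, hh, hη⟩ := hW.exists_restriction
  -- the universal property of `W`, in terms of cones over `S`
  have key : ∀ (X : K) (Z : V) (d : ∀ b, Z ⊗ G.obj b ⟶ eHom V X (S.obj (J.obj b))),
      IsIndexedCone G (J.comp V S) X Z d →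
      ∃! e : ∀ a, Z ⊗ W.obj a ⟶ eHom V X (S.obj a), IsIndexedCone W S X Z e ∧
        ∀ b, Z ◁ h b ≫ e (J.obj b) = d b := by
    intro X Z d hd
    have h1 : IsBaseCone G (J.comp V (S.comp V (homFunctor X))) Z d := by
      intro a b
      refine ((isBaseCone_homFunctor_iff (S := J.comp V S) X d).2 hd a b).trans ?_
      exact congrArg (fun m => (α_ _ _ _).inv ≫ d a ▷ _ ≫
        uncurry (A := eHom V X (S.obj (J.obj a))) m) (Category.assoc _ _ _)
    obtain ⟨e, ⟨he, he'⟩, hu⟩ := hη (S.comp V (homFunctor X)) Z d h1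
    exact ⟨e, ⟨(isBaseCone_homFunctor_iff X _).1 he, he'⟩, fun e' h' =>
      hu e' ⟨(isBaseCone_homFunctor_iff X _).2 h'.1, h'.2⟩⟩
  -- `L` is the limit of `S J` weighted by `G`; its cone extends along `h` to a cone over `S`
  obtain ⟨L, c, hc⟩ := hK B G (J.comp V S)
  obtain ⟨e, ⟨he, he'⟩, -⟩ := key L (𝟙_ V) _ hc.1.isIndexedCone_unit
  have hcone : IsWeightedCone W S L (fun a => (λ_ _).inv ≫ e a) := by
    intro a b
    change act W a b ≫ (λ_ _).inv ≫ e b = ((λ_ _).inv ≫ e a) ⊙ S.map a b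
    rw [leftUnitor_inv_naturality_assoc, he.eq, comp_elemComp]
    simp
  have hη' : ∀ b, h b ≫ (λ_ _).inv ≫ e (J.obj b) = c b := by
    intro b
    rw [leftUnitor_inv_naturality_assoc, he']
    exact Iso.inv_hom_id_assoc _ _
  refine ⟨L, fun a => (λ_ _).inv ≫ e a, hcone, fun X Z d hd => ?_⟩
  have hd' : IsIndexedCone G (J.comp V S) X Z (fun b => Z ◁ h b ≫ d (J.obj b)) := by
    intro a b
    change Z ◁ act G a b ≫ Z ◁ h b ≫ d (J.obj b) = (α_ _ _ _).inv ≫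
      ((Z ◁ h a ≫ d (J.obj a)) ⊙ (J.map a b ≫ S.map (J.obj a) (J.obj b)))
    rw [← MonoidalCategory.whiskerLeft_comp_assoc, hh, MonoidalCategory.whiskerLeft_comp,
      MonoidalCategory.whiskerLeft_comp, Category.assoc, Category.assoc, hd.eq, comp_elemComp,
      elemComp_comp]
    simp
  obtain ⟨f, hf, hu⟩ := hc.2 X Z _ hd'
  refine ⟨f, fun a => ?_, fun g hg => hu g fun b => ?_⟩
  · refine congrFun ((key X Z _ hd').unique ⟨hcone.isIndexedCone f, fun b => ?_⟩
      ⟨hd, fun b => rfl⟩) a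
    rw [← elemComp_comp, hη']
    exact hf b
  · rw [← hη' b]
    exact (elemComp_comp _ _ _).trans (congrArg (_ ≫ ·) (hg _))

end Reduction

end EnrichedModels

end

noncomputable section

namespace EnrichedModels

/-! ### Colimits as limits in the opposite category -/

section Opposite

variable {V : Type u} [Category.{v} V] [MonoidalCategory V] [BraidedCategory V]
variable {K : Type u₁} [EnrichedCategory V K]

lemma elemComp_op {X Y Z : K} {P Q : V} (f : P ⟶ eHom V Y X) (g : Q ⟶ eHom V Z Y) :
    elemComp (K := Kᵒᵖ) (X := op X) (Y := op Y) (Z := op Z) f g = (β_ P Q).hom ≫ (g ⊙ f) :=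
  tensorHom_eComp_op_eq V (x := op Z) (y := op Y) (z := op X) f g

lemma postcomp_op {X Y : K} (r : 𝟙_ V ⟶ eHom V X Y) (Z : K) :
    postcomp (K := Kᵒᵖ) (X := op Y) (Y := op X) r (op Z) = precomp r Z := by
  have h1 := comp_postcomp (K := Kᵒᵖ) (X := op Z) (Y := op Y) (Z := op X) r (𝟙 (eHom V Y Z))
  have h2 := comp_precomp r (𝟙 (eHom V Y Z))
  rw [Category.id_comp] at h2
  refine ((Category.id_comp _).symm.trans h1).trans ?_
  rw [h2, elemComp_op, braiding_tensorUnit_right]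
  simp

lemma isIsoArrow_op_iff {X Y : K} (r : 𝟙_ V ⟶ eHom V X Y) :
    IsIsoArrow (K := Kᵒᵖ) (X := op Y) (Y := op X) r ↔ IsIsoArrow r := by
  rw [isIsoArrow_iff, isIsoArrow_iff]
  have e1 : ∀ g : 𝟙_ V ⟶ eHom V Y X,
      r ≫ postcomp (K := Kᵒᵖ) (X := op X) (Y := op Y) g (op Y) = g ≫ postcomp r Y :=
    fun g => (congrArg (r ≫ ·) (postcomp_op g Y)).trans (comp_precomp_eq_comp_postcomp _ _)
  have e2 : ∀ g : 𝟙_ V ⟶ eHom V Y X,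
      g ≫ postcomp (K := Kᵒᵖ) (X := op Y) (Y := op X) r (op X) = r ≫ postcomp g X :=
    fun g => (congrArg (g ≫ ·) (postcomp_op r X)).trans (comp_precomp_eq_comp_postcomp _ _)
  constructor
  · rintro ⟨g, h1, h2⟩
    exact ⟨g, (e2 g).symm.trans h2, (e1 g).symm.trans h1⟩
  · rintro ⟨g, h1, h2⟩
    exact ⟨g, (e1 g).trans h2, (e2 g).trans h1⟩

variable [MonoidalClosed V] {B : Type w} [EnrichedCategory V B]

/-- The condition on a family `d b : Z ⊗ W b ⟶ K(S b, Y)` to be a cocone. -/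
def IsIndexedCocone (W : EnrichedFunctor V B V) (S : EnrichedFunctor V B Kᵒᵖ) (Y : K) (Z : V)
    (d : ∀ b, Z ⊗ W.obj b ⟶ eHom V (S.obj b).unop Y) : Prop :=
  ∀ a b, Z ◁ act W a b ≫ d b = (α_ _ _ _).inv ≫ (β_ _ _).hom ≫
    elemComp (K := K) (X := (S.obj b).unop) (Y := (S.obj a).unop) (S.map a b) (d a)

lemma isIndexedCone_op_iff {W : EnrichedFunctor V B V} {S : EnrichedFunctor V B Kᵒᵖ} {Y : K} {Z : V}
    (d : ∀ b, Z ⊗ W.obj b ⟶ eHom V (S.obj b).unop Y) :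
    IsIndexedCone W S (op Y) Z d ↔ IsIndexedCocone W S Y Z d := by
  refine forall₂_congr fun a b => ?_
  exact Eq.congr rfl
    (congrArg (_ ≫ ·) (elemComp_op (X := Y) (Y := (S.obj a).unop) (d a) (S.map a b)))

lemma isWeightedCone_op_iff {W : EnrichedFunctor V B V} {S : EnrichedFunctor V B Kᵒᵖ} {C : K}
    (c : ∀ b, W.obj b ⟶ eHom V (S.obj b).unop C) :
    IsWeightedCone W S (op C) c ↔ ∀ a b, act W a b ≫ c b = (β_ _ _).hom ≫
      elemComp (K := K) (X := (S.obj b).unop) (Y := (S.obj a).unop) (S.map a b) (c a) := by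
  refine forall₂_congr fun a b => ?_
  exact Eq.congr rfl (elemComp_op (X := C) (Y := (S.obj a).unop) (c a) (S.map a b))

/-- Limits in the opposite `V`-category, expressed in the original one. -/
lemma isWeightedLimit_op_iff {W : EnrichedFunctor V B V} {S : EnrichedFunctor V B Kᵒᵖ} {C : K}
    (c : ∀ b, W.obj b ⟶ eHom V (S.obj b).unop C) :
    IsWeightedLimit W S (op C) c ↔ IsWeightedCone W S (op C) c ∧
      ∀ (Y : K) (Z : V) (d : ∀ b, Z ⊗ W.obj b ⟶ eHom V (S.obj b).unop Y),
        IsIndexedCocone W S Y Z d →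
          ∃! f : Z ⟶ eHom V C Y, ∀ b, (β_ _ _).hom ≫ (c b ⊙ f) = d b := by
  refine and_congr_right fun _ => ?_
  refine ⟨fun h Y Z d hd => ?_, fun h X Z d hd => ?_⟩
  · obtain ⟨f, hf, hu⟩ := h (op Y) Z d ((isIndexedCone_op_iff d).2 hd)
    exact ⟨f, fun b => (elemComp_op (X := Y) (Y := C) f (c b)).symm.trans (hf b), fun g hg =>
      hu g fun b => (elemComp_op (X := Y) (Y := C) g (c b)).trans (hg b)⟩
  · obtain ⟨f, hf, hu⟩ := h X.unop Z d ((isIndexedCone_op_iff (Y := X.unop) d).1 hd)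
    exact ⟨f, fun b => (elemComp_op (X := X.unop) (Y := C) f (c b)).trans (hf b), fun g hg =>
      hu g fun b => (elemComp_op (X := X.unop) (Y := C) g (c b)).symm.trans (hg b)⟩

end Opposite

section SmallColimits

/-- The coherence identity that relates moving `Z` past `s ⊗ b` before and after an action. -/
lemma braid_coherence {V : Type u} [Category.{v} V] [MonoidalCategory V] [BraidedCategory V]
    (Z s a b : V) :
    (α_ Z s (a ⊗ b)).inv ≫ (β_ Z s).hom ▷ (a ⊗ b) ≫ (α_ s Z (a ⊗ b)).hom ≫
      s ◁ ((α_ Z a b).inv ≫ (β_ (Z ⊗ a) b).hom) ≫ (α_ s b (Z ⊗ a)).inv =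
    Z ◁ (s ◁ (β_ a b).hom ≫ (α_ s b a).inv) ≫ (α_ Z (s ⊗ b) a).inv ≫
      (β_ Z (s ⊗ b)).hom ▷ a ≫ (α_ (s ⊗ b) Z a).hom := by
  rw [braiding_tensor_left_hom, Iso.inv_hom_id_assoc, MonoidalCategory.whiskerLeft_comp,
    MonoidalCategory.whiskerLeft_comp, Category.assoc, ← associator_naturality_right_assoc,
    ← whisker_exchange_assoc, ← associator_inv_naturality_right_assoc, Category.assoc,
    braiding_tensor_right_hom, MonoidalCategory.whiskerLeft_comp Z, Category.assoc]
  refine congrArg (Z ◁ s ◁ (β_ a b).hom ≫ ·) ?_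
  simp

variable {V : Type u} [Category.{v} V] [MonoidalCategory V] [BraidedCategory V] [MonoidalClosed V]
  [HasColimits V]

/-- `V`, as a `V`-category, has all colimits with small weights. Colimits are expressed as limits in
`Vᵒᵖ`. -/
lemma exists_isWeightedLimit_base_op {B : Type v} [EnrichedCategory V B]
    (W : EnrichedFunctor V B V) (S : EnrichedFunctor V B Vᵒᵖ) : ∃ L c, IsWeightedLimit W S L c := by
  let s : B → V := fun b => (S.obj b).unop
  let m : ∀ a b, s b ⊗ eHom V a b ⟶ s a := fun a b => uncurry (A := s b) (S.map a b)
  -- the colimit is the coequalizer of the actions of `B(a, b)` on the weight and on the diagram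
  let p : (∐ fun p : B × B => s p.2 ⊗ (W.obj p.1 ⊗ eHom V p.1 p.2)) ⟶
    ∐ fun b => s b ⊗ W.obj b := Sigma.desc fun p =>
      s p.2 ◁ act W p.1 p.2 ≫ Sigma.ι (fun b => s b ⊗ W.obj b) p.2
  let q : (∐ fun p : B × B => s p.2 ⊗ (W.obj p.1 ⊗ eHom V p.1 p.2)) ⟶
    ∐ fun b => s b ⊗ W.obj b := Sigma.desc fun p => s p.2 ◁ (β_ _ _).hom ≫ (α_ _ _ _).inv ≫
      m p.1 p.2 ▷ _ ≫ Sigma.ι (fun b => s b ⊗ W.obj b) p.1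
  let i : ∀ b, s b ⊗ W.obj b ⟶ coequalizer p q := fun b =>
    Sigma.ι (fun b => s b ⊗ W.obj b) b ≫ coequalizer.π p q
  have hi : ∀ a b, s b ◁ act W a b ≫ i b =
      s b ◁ (β_ _ _).hom ≫ (α_ _ _ _).inv ≫ m a b ▷ _ ≫ i a := by
    intro a b
    have h := congrArg (Sigma.ι (fun p : B × B => s p.2 ⊗ (W.obj p.1 ⊗ eHom V p.1 p.2)) (a, b) ≫ ·)
      (coequalizer.condition p q)
    simpa [p, q, i, Category.assoc] using h
  refine ⟨op (coequalizer p q), fun b => curry (i b),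
    (isWeightedLimit_op_iff (C := coequalizer p q) _).2
      ⟨(isWeightedCone_op_iff (C := coequalizer p q) _).2 fun a b => ?_, fun Y Z d hd => ?_⟩⟩
  · apply uncurry_injective
    refine (uncurry_comp_left _ _).trans (Eq.trans ?_ (uncurry_comp_left _ _).symm)
    rw [uncurry_curry]
    refine (hi a b).trans (congrArg (_ ≫ ·) ?_)
    refine Eq.trans ?_ (uncurry_elemComp (X := s b) (Y := s a) (Z := coequalizer p q)
      (S.map a b) (curry (i a))).symm
    rw [uncurry_curry]
  · let e : ∀ b, s b ⊗ (Z ⊗ W.obj b) ⟶ Y := fun b => uncurry (A := s b) (d b)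
    have he : ∀ a b, s b ◁ (Z ◁ act W a b) ≫ e b = s b ◁ ((α_ _ _ _).inv ≫ (β_ _ _).hom) ≫
        (α_ _ _ _).inv ≫ m a b ▷ _ ≫ e a := by
      intro a b
      have h := congrArg (uncurry (A := s b)) (hd a b)
      refine (uncurry_comp_left _ _).symm.trans (h.trans ?_)
      rw [← Category.assoc]
      refine (uncurry_comp_left _ _).trans (congrArg (_ ≫ ·) ?_)
      exact uncurry_elemComp (X := s b) (Y := s a) (Z := Y) (S.map a b) (d a)
    -- transposing `Z` to the codomain makes the cocone a cofork of `p` and `q`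
    let k : ∀ b, s b ⊗ W.obj b ⟶ (ihom Z).obj Y := fun b =>
      curry ((α_ Z (s b) (W.obj b)).inv ≫ (β_ Z (s b)).hom ▷ W.obj b ≫ (α_ _ _ _).hom ≫ e b)
    have hk : ∀ a b, s b ◁ act W a b ≫ k b =
        s b ◁ (β_ _ _).hom ≫ (α_ _ _ _).inv ≫ m a b ▷ _ ≫ k a := by
      intro a b
      have h := braid_coherence Z (s b) (W.obj a) (eHom V a b)
      simp only [k]
      rw [← curry_natural_left, ← curry_natural_left, ← curry_natural_left, ← curry_natural_left]
      congr 1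
      calc _ = ((α_ Z (s b) (W.obj a ⊗ eHom V a b)).inv ≫ (β_ Z (s b)).hom ▷ _ ≫ (α_ _ _ _).hom ≫
            s b ◁ ((α_ _ _ _).inv ≫ (β_ _ _).hom) ≫ (α_ _ _ _).inv) ≫ m a b ▷ _ ≫ e a := by
            simp only [Category.assoc]
            rw [← he a b, associator_inv_naturality_right_assoc, whisker_exchange_assoc,
              associator_naturality_right_assoc]
        _ = _ := by
            rw [h]
            simp only [Category.assoc, MonoidalCategory.whiskerLeft_comp]
            rw [associator_inv_naturality_middle_assoc, ← comp_whiskerRight_assoc,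
              braiding_naturality_right, comp_whiskerRight_assoc,
              associator_naturality_left_assoc]
    have key : ∀ f : Z ⟶ eHom V (coequalizer p q) Y,
        (∀ b, (β_ _ _).hom ≫ (elemComp (X := s b) (curry (i b)) f) = d b) ↔
          ∀ b, i b ≫ curry ((β_ Z (coequalizer p q)).hom ≫ uncurry f) = k b := by
      intro f
      refine forall_congr' fun b => ?_
      rw [← uncurry_injective.eq_iff, uncurry_comp_left, uncurry_elemComp, uncurry_curry,
        ← curry_natural_left, curry_injective.eq_iff, braiding_naturality_right_assoc,
        braiding_tensor_right_hom]
      simp only [Category.assoc]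
      rw [cancel_epi, cancel_epi, cancel_epi]
    have hk' : p ≫ Sigma.desc k = q ≫ Sigma.desc k := by
      apply Sigma.hom_ext
      rintro ⟨a, b⟩
      simpa [p, q] using hk a b
    refine ⟨curry ((β_ Z (coequalizer p q)).inv ≫ uncurry (coequalizer.desc (Sigma.desc k) hk')),
      (key _).2 fun b => ?_, fun g hg => ?_⟩
    · rw [uncurry_curry, Iso.hom_inv_id_assoc, MonoidalClosed.curry_uncurry]
      simp [i]
    · have h := (key g).1 hg
      apply uncurry_injective
      rw [uncurry_curry, Iso.eq_inv_comp]
      apply curry_injective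
      rw [MonoidalClosed.curry_uncurry]
      apply coequalizer.hom_ext
      apply Sigma.hom_ext
      intro b
      simpa [i] using h b

end SmallColimits

end EnrichedModels

end

noncomputable section

namespace EnrichedModels

/-! ### Limits in functor categories -/

section Pointwise

variable {V : Type u} [Category.{v} V] [MonoidalCategory V] [SymmetricCategory V]
  [MonoidalClosed V] [HasLimits V]
variable {A : Type v} [EnrichedCategory V A] {D : Type u₂} [EnrichedCategory V D]

/-- Evaluation at `a`, as a `V`-functor `[A, D] → D`. -/
def evalAt (a : A) : EnrichedFunctor V (EnrichedFunctor V A D) D where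
  obj F := F.obj a
  map F G := homπ F G a
  map_id F := homLift_π _ (isNatFamily_id F) a
  map_comp F G H := homComp_π F G H a

/-- Composition in `[A, D]` is pointwise. -/
lemma elemComp_homπ {F G H : EnrichedFunctor V A D} {P Q : V} (x : P ⟶ eHom V F G)
    (y : Q ⟶ eHom V G H) (a : A) :
    (x ⊙ y) ≫ homπ F H a = (x ≫ homπ F G a) ⊙ (y ≫ homπ G H a) :=
  elemComp_map (evalAt a) x y

lemma isNatFamily_comp_homπ {F G : EnrichedFunctor V A D} {P : V} (x : P ⟶ eHom V F G) :
    IsNatFamily F G P (fun a => x ≫ homπ F G a) :=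
  (isNatFamily_homπ F G).comp_left x

variable {B : Type w} [EnrichedCategory V B] {W : EnrichedFunctor V B V}
  {S : EnrichedFunctor V B (EnrichedFunctor V A D)}

/-- Limits in functor categories can be detected pointwise. -/
lemma isWeightedLimit_of_evalAt {L : EnrichedFunctor V A D} {c : ∀ b, W.obj b ⟶ eHom V L (S.obj b)}
    (h : ∀ a, IsWeightedLimit W (S.comp V (evalAt a)) (L.obj a)
      (fun b => c b ≫ homπ L (S.obj b) a)) : IsWeightedLimit W S L c := by
  refine ⟨fun a b => homObj_ext fun t => ?_, fun X Z d hd => ?_⟩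
  · refine (Category.assoc _ _ _).trans (((h t).1.eq a b).trans ?_)
    exact (elemComp_homπ (c a) (S.map a b) t).symm
  · have hd' : ∀ t, IsIndexedCone W (S.comp V (evalAt t)) (X.obj t) Z
        (fun b => d b ≫ homπ X (S.obj b) t) := fun t => hd.map (evalAt t)
    choose f hf hu using fun t => (h t).2 (X.obj t) Z _ (hd' t)
    have hf' : ∀ t b, f t ⊙ (c b ≫ homπ L (S.obj b) t) = d b ≫ homπ X (S.obj b) t := hf
    -- the pointwise factorizations form a natural family, by uniqueness
    have hnat : IsNatFamily X L Z f := by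
      intro s t
      refine (h t).ext (X := X.obj s) fun b => ?_
      change ((β_ Z (eHom V s t)).hom ≫ (X.map s t ⊙ f t)) ⊙ (c b ≫ homπ L (S.obj b) t) =
        (f s ⊙ L.map s t) ⊙ (c b ≫ homπ L (S.obj b) t)
      have h1 := (isNatFamily_comp_homπ (c b)).eq s t
      have h2 := (isNatFamily_comp_homπ (d b)).eq s t
      rw [comp_elemComp, elemComp_assoc, hf', elemComp_assoc, ← cancel_epi (α_ _ _ _).inv,
        Iso.inv_hom_id_assoc, ← cancel_epi (Z ◁ (β_ (W.obj b) (eHom V s t)).hom), ← elemComp_comp,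
        h1, elemComp_assoc', hf', ← cancel_epi (α_ _ _ _).hom, Iso.hom_inv_id_assoc, ← h2,
        braiding_tensor_left_hom]
      simp only [Category.assoc]
    refine ⟨homLift f hnat, fun b => homObj_ext fun t => ?_, fun g hg => homObj_ext fun t => ?_⟩
    · refine (elemComp_homπ (homLift f hnat) (c b) t).trans ?_
      rw [homLift_π]
      exact hf' t b
    · rw [homLift_π]
      refine hu t _ fun b => ?_
      exact (elemComp_homπ g (c b) t).symm.trans (congrArg (· ≫ homπ X (S.obj b) t) (hg b))

/-- Limits in functor categories exist pointwise. -/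
lemma exists_isWeightedLimit_evalAt
    (h : ∀ a, ∃ L c, IsWeightedLimit W (S.comp V (evalAt a)) L c) :
    ∃ L c, IsWeightedLimit W S L c ∧ ∀ a, IsWeightedLimit W (S.comp V (evalAt a)) (L.obj a)
      (fun b => c b ≫ homπ L (S.obj b) a) := by
  replace h : ∀ a, ∃ (L : D) (c : ∀ b, W.obj b ⟶ eHom V L ((S.obj b).obj a)),
      IsWeightedLimit W (S.comp V (evalAt a)) L c := h
  choose L c hc using h
  have hcone : ∀ s t, IsIndexedCone W (S.comp V (evalAt t)) (L s) (eHom V s t)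
      (fun b => (β_ _ _).hom ≫ (c s b ⊙ (S.obj b).map s t)) := by
    intro s t a b
    change eHom V s t ◁ act W a b ≫ (β_ _ _).hom ≫
        (c s b ⊙ (S.obj b).map s t) =
      (α_ _ _ _).inv ≫ (((β_ _ _).hom ≫
        (c s a ⊙ (S.obj a).map s t)) ⊙
          (S.map a b ≫ homπ (S.obj a) (S.obj b) t))
    have h1 : act W a b ≫ c s b = c s a ⊙
      (S.map a b ≫ homπ (S.obj a) (S.obj b) s) := (hc s).1.eq a b
    have h2 := (isNatFamily_comp_homπ (S.map a b)).eq s t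
    rw [braiding_naturality_right_assoc, ← comp_elemComp, h1, elemComp_assoc, ← h2, elemComp_comp,
      comp_elemComp, elemComp_assoc, braiding_tensor_right_hom]
    simp only [Category.assoc, Iso.inv_hom_id_assoc]
    rw [← MonoidalCategory.whiskerLeft_comp_assoc, SymmetricCategory.symmetry,
      MonoidalCategory.whiskerLeft_id, Category.id_comp]
  -- the action of the limit functor on hom-objects, induced by the universal property at `t`
  choose m hm using fun s t => ((hc t).2 (L s) _ _ (hcone s t)).exists
  replace hm : ∀ s t b, m s t ⊙ c t b =
    (β_ _ _).hom ≫ (c s b ⊙ (S.obj b).map s t) := hm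
  let L' : EnrichedFunctor V A D :=
    { obj := L
      map := m
      map_id := fun a => by
        refine (hc a).ext fun b => ?_
        change (eId V a ≫ m a a) ⊙ c a b = eId V (L a) ⊙ c a b
        rw [comp_elemComp, hm, braiding_naturality_left_assoc, ← elemComp_comp,
          (S.obj b).map_id, elemComp_eId, eId_elemComp, braiding_tensorUnit_left]
        simp
      map_comp := fun r s t => by
        refine (hc t).ext fun b => ?_
        change (eComp V r s t ≫ m r t) ⊙ c t b = (m r s ⊙ m s t) ⊙ c t b
        have h3 : eComp V r s t ≫ (S.obj b).map r t = (S.obj b).map r s ⊙ (S.obj b).map s t :=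
          (S.obj b).map_comp r s t
        rw [comp_elemComp, hm, braiding_naturality_left_assoc, ← elemComp_comp, h3,
          elemComp_assoc, hm, elemComp_comp, elemComp_assoc' (m r s), hm,
          comp_elemComp, elemComp_assoc, braiding_tensor_left_hom]
        simp only [Category.assoc] }
  have hnat : ∀ b, IsNatFamily L' (S.obj b) (W.obj b) (fun a => c a b) := by
    intro b s t
    change (β_ _ _).hom ≫ (m s t ⊙ c t b) = c s b ⊙ (S.obj b).map s t
    rw [hm, SymmetricCategory.symmetry_assoc]
  have hpt : ∀ a, IsWeightedLimit W (S.comp V (evalAt a)) (L'.obj a)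
      (fun b => homLift _ (hnat b) ≫ homπ L' (S.obj b) a) := fun a =>
    (hc a).of_eq fun b => (homLift_π _ (hnat b) a).symm
  exact ⟨L', fun b => homLift _ (hnat b), isWeightedLimit_of_evalAt hpt, hpt⟩

end Pointwise

end EnrichedModels

end

noncomputable section

namespace EnrichedModels

/-! ### Limits and fully faithful functors -/

section FullyFaithful

variable {V : Type u} [Category.{v} V] [MonoidalCategory V] [MonoidalClosed V]
variable {B : Type w} [EnrichedCategory V B] {K : Type u₁} [EnrichedCategory V K]
  {K' : Type u₂} [EnrichedCategory V K']
variable {W : EnrichedFunctor V B V} {S : EnrichedFunctor V B K}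

lemma IsLimitAt.of_isIsoArrow {L X Y : K} {c : ∀ b, W.obj b ⟶ eHom V L (S.obj b)}
    (h : IsLimitAt W S L c X) {e : 𝟙_ V ⟶ eHom V Y X} (he : IsIsoArrow e) :
    IsLimitAt W S L c Y := by
  intro Z d hd
  have hi : ∀ Q : K, IsIso (precomp e Q) := fun Q => he.isIso_precomp Q
  have hd' : IsIndexedCone W S X Z (fun b => d b ≫ inv (precomp e (S.obj b))) := by
    intro a b
    change Z ◁ act W a b ≫ d b ≫ inv (precomp e (S.obj b)) =
      (α_ _ _ _).inv ≫ ((d a ≫ inv (precomp e (S.obj a))) ⊙ S.map a b)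
    rw [← cancel_mono (precomp e (S.obj b))]
    simp only [Category.assoc, IsIso.inv_hom_id, Category.comp_id]
    rw [← comp_precomp_elemComp, Category.assoc, IsIso.inv_hom_id, Category.comp_id, hd.eq]
  obtain ⟨f, hf, hu⟩ := h Z _ hd'
  refine ⟨f ≫ precomp e L, fun b => ?_, fun g hg => ?_⟩
  · rw [comp_precomp_elemComp, hf, Category.assoc, IsIso.inv_hom_id, Category.comp_id]
  · rw [← hu (g ≫ inv (precomp e L)) fun b => ?_, Category.assoc, IsIso.inv_hom_id,
      Category.comp_id]
    rw [← cancel_mono (precomp e (S.obj b)), Category.assoc, IsIso.inv_hom_id, Category.comp_id,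
      ← comp_precomp_elemComp, Category.assoc, IsIso.inv_hom_id, Category.comp_id, hg]

variable (Θ : EnrichedFunctor V K K') [∀ X Y, IsIso (Θ.map X Y)]

lemma isIndexedCone_map_iff {X : K} {Z : V} (d : ∀ b, Z ⊗ W.obj b ⟶ eHom V X (S.obj b)) :
    IsIndexedCone W (S.comp V Θ) (Θ.obj X) Z (fun b => d b ≫ Θ.map X (S.obj b)) ↔
      IsIndexedCone W S X Z d := by
  refine ⟨fun h a b => ?_, fun h => h.map Θ⟩
  have h1 := h a b
  change Z ◁ act W a b ≫ d b = (α_ _ _ _).inv ≫ (d a ⊙ S.map a b)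
  rw [← cancel_mono (Θ.map X (S.obj b)), Category.assoc, Category.assoc, elemComp_map]
  exact h1

lemma isWeightedCone_map_iff {X : K} (d : ∀ b, W.obj b ⟶ eHom V X (S.obj b)) :
    IsWeightedCone W (S.comp V Θ) (Θ.obj X) (fun b => d b ≫ Θ.map X (S.obj b)) ↔
      IsWeightedCone W S X d := by
  refine ⟨fun h a b => ?_, fun h => h.map Θ⟩
  have h1 := h a b
  change act W a b ≫ d b = d a ⊙ S.map a b
  rw [← cancel_mono (Θ.map X (S.obj b)), Category.assoc, elemComp_map]
  exact h1

/-- A fully faithful `V`-functor preserves and reflects the universal property of a limit with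
respect to the objects in its image. -/
lemma isLimitAt_map_iff {L X : K} (c : ∀ b, W.obj b ⟶ eHom V L (S.obj b)) :
    IsLimitAt W (S.comp V Θ) (Θ.obj L) (fun b => c b ≫ Θ.map L (S.obj b)) (Θ.obj X) ↔
      IsLimitAt W S L c X := by
  have key : ∀ {Z : V} (f : Z ⟶ eHom V X L) (d : ∀ b, Z ⊗ W.obj b ⟶ eHom V X (S.obj b)) b,
      (f ≫ Θ.map X L) ⊙ (c b ≫ Θ.map L (S.obj b)) = d b ≫ Θ.map X (S.obj b) ↔ f ⊙ c b = d b := by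
    intro Z f d b
    rw [← elemComp_map, cancel_mono]
  constructor
  · intro h Z d hd
    obtain ⟨f, hf, hu⟩ := h Z _ (hd.map Θ)
    refine ⟨f ≫ inv (Θ.map X L), fun b => (key _ d b).1 ?_, fun g hg => ?_⟩
    · rw [Category.assoc, IsIso.inv_hom_id, Category.comp_id]
      exact hf b
    · rw [← hu (g ≫ Θ.map X L) fun b => (key g d b).2 (hg b), Category.assoc, IsIso.hom_inv_id,
        Category.comp_id]
  · intro h Z d hd
    let m : ∀ b, eHom V (Θ.obj X) (Θ.obj (S.obj b)) ⟶ eHom V X (S.obj b) :=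
      fun b => inv (Θ.map X (S.obj b))
    have hm : ∀ b, m b ≫ Θ.map X (S.obj b) = 𝟙 _ := fun b => IsIso.inv_hom_id _
    obtain ⟨d', rfl⟩ : ∃ d' : ∀ b, Z ⊗ W.obj b ⟶ eHom V X (S.obj b),
        (fun b => d' b ≫ Θ.map X (S.obj b)) = d :=
      ⟨fun b => d b ≫ m b, funext fun b => (Category.assoc _ _ _).trans
        ((congrArg (d b ≫ ·) (hm b)).trans (Category.comp_id _))⟩
    obtain ⟨f, hf, hu⟩ := h Z d' ((isIndexedCone_map_iff Θ d').1 hd)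
    refine ⟨f ≫ Θ.map X L, fun b => (key f d' b).2 (hf b), fun g hg => ?_⟩
    obtain ⟨g', rfl⟩ : ∃ g' : Z ⟶ eHom V X L, g' ≫ Θ.map X L = g :=
      ⟨g ≫ inv (Θ.map X L), by simp⟩
    rw [hu g' fun b => (key g' d' b).1 (hg b)]

/-- Fully faithful `V`-functors reflect limits. -/
lemma IsWeightedLimit.of_map {L : K} {c : ∀ b, W.obj b ⟶ eHom V L (S.obj b)}
    (h : IsWeightedLimit W (S.comp V Θ) (Θ.obj L) (fun b => c b ≫ Θ.map L (S.obj b))) :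
    IsWeightedLimit W S L c :=
  ⟨(isWeightedCone_map_iff Θ c).1 h.1, fun X => (isLimitAt_map_iff Θ c).1 (h.2 (Θ.obj X))⟩

/-- Fully faithful and essentially surjective `V`-functors preserve limits. -/
lemma IsWeightedLimit.map_of_essSurj
    (hΘ : ∀ Y : K', ∃ (X : K) (e : 𝟙_ V ⟶ eHom V Y (Θ.obj X)), IsIsoArrow e)
    {L : K} {c : ∀ b, W.obj b ⟶ eHom V L (S.obj b)} (h : IsWeightedLimit W S L c) :
    IsWeightedLimit W (S.comp V Θ) (Θ.obj L) (fun b => c b ≫ Θ.map L (S.obj b)) := by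
  refine ⟨h.1.map Θ, fun Y => ?_⟩
  obtain ⟨X, e, he⟩ := hΘ Y
  exact ((isLimitAt_map_iff Θ c).2 (h.2 X)).of_isIsoArrow he

/-- If a limit of `S` in the target of a fully faithful `V`-functor lies in the essential image,
then `S` has a limit. -/
lemma IsWeightedLimit.exists_of_map {L' : K'} {c' : ∀ b, W.obj b ⟶ eHom V L' (Θ.obj (S.obj b))}
    (h : IsWeightedLimit W (S.comp V Θ) L' c') {L : K} {e : 𝟙_ V ⟶ eHom V (Θ.obj L) L'}
    (he : IsIsoArrow e) :
    ∃ c : ∀ b, W.obj b ⟶ eHom V L (S.obj b), IsWeightedLimit W S L c ∧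
      ∀ b, c b ≫ Θ.map L (S.obj b) = c' b ≫ precomp e (Θ.obj (S.obj b)) := by
  have hc : ∀ b, (c' b ≫ precomp e (Θ.obj (S.obj b)) ≫ inv (Θ.map L (S.obj b))) ≫
      Θ.map L (S.obj b) = c' b ≫ precomp e (Θ.obj (S.obj b)) := fun b => by
    simp
  exact ⟨_, IsWeightedLimit.of_map Θ ((h.of_isIsoArrow he).of_eq fun b => (hc b).symm), hc⟩

end FullyFaithful

section EId

variable {V : Type u} [Category.{v} V] [MonoidalCategory V]

lemma isIsoArrow_eId {K : Type u₁} [EnrichedCategory V K] (X : K) : IsIsoArrow (eId V X) :=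
  (isIsoArrow_iff _).2 ⟨eId V X, eId_postcomp _, eId_postcomp _⟩

instance {K : Type u₁} [EnrichedCategory V K] (P : K → Prop) (X Y : FullSub P) :
    IsIso ((FullSub.ι (V := V) P).map X Y) :=
  inferInstanceAs (IsIso (𝟙 (eHom V X.obj Y.obj)))

end EId

/-! ### Colimits in functor categories -/

section PointwiseColimits

variable {V : Type u} [Category.{v} V] [MonoidalCategory V] [SymmetricCategory V]

lemma IsNatFamily.op {A : Type u₁} [EnrichedCategory V A] {D : Type u₂} [EnrichedCategory V D]
    {F G : EnrichedFunctor V A D} {Z : V} {s : ∀ a, Z ⟶ eHom V (F.obj a) (G.obj a)}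
    (h : IsNatFamily F G Z s) :
    IsNatFamily (opFunctor G) (opFunctor F) Z (fun a : Aᵒᵖ => s a.unop) := by
  intro a b
  have h1 := h.eq b.unop a.unop
  change (β_ Z (eHom V b.unop a.unop)).hom ≫ elemComp (K := Dᵒᵖ) (X := Opposite.op (G.obj a.unop))
      (Y := Opposite.op (G.obj b.unop)) (Z := Opposite.op (F.obj b.unop))
      (G.map b.unop a.unop) (s b.unop) =
    elemComp (K := Dᵒᵖ) (X := Opposite.op (G.obj a.unop)) (Y := Opposite.op (F.obj a.unop))
      (Z := Opposite.op (F.obj b.unop)) (s a.unop) (F.map b.unop a.unop)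
  rw [elemComp_op, elemComp_op, h1, SymmetricCategory.symmetry_assoc]

lemma IsNatFamily.unop {A : Type u₁} [EnrichedCategory V A] {D : Type u₂} [EnrichedCategory V D]
    {F G : EnrichedFunctor V A D} {Z : V} {s : ∀ a, Z ⟶ eHom V (F.obj a) (G.obj a)}
    (h : IsNatFamily (opFunctor G) (opFunctor F) Z (fun a : Aᵒᵖ => s a.unop)) :
    IsNatFamily F G Z s := by
  intro a b
  have h1 : (β_ Z (eHom V a b)).hom ≫ elemComp (K := Dᵒᵖ) (X := Opposite.op (G.obj b))
      (Y := Opposite.op (G.obj a)) (Z := Opposite.op (F.obj a)) (G.map a b) (s a) =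
    elemComp (K := Dᵒᵖ) (X := Opposite.op (G.obj b)) (Y := Opposite.op (F.obj b))
      (Z := Opposite.op (F.obj a)) (s b) (F.map a b) := h (Opposite.op b) (Opposite.op a)
  rw [elemComp_op, elemComp_op, SymmetricCategory.symmetry_assoc] at h1
  exact h1.symm

variable [MonoidalClosed V] [HasLimits V]
variable (A : Type v) [EnrichedCategory V A] (D : Type u₂) [EnrichedCategory V D]

/-- The isomorphism of `V`-categories between `[A, D]ᵒᵖ` and `[Aᵒᵖ, Dᵒᵖ]`. -/
def opFunctorCategory :
    EnrichedFunctor V (EnrichedFunctor V A D)ᵒᵖ (EnrichedFunctor V Aᵒᵖ Dᵒᵖ) where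
  obj F := opFunctor F.unop
  map F G := homLift _ (isNatFamily_homπ G.unop F.unop).op
  map_id F := by
    apply homObj_ext
    intro a
    refine (Category.assoc _ _ _).trans ((congrArg (_ ≫ ·) (homLift_π _ _ a)).trans ?_)
    exact (homLift_π _ (isNatFamily_id F.unop) a.unop).trans
      (homLift_π _ (isNatFamily_id (opFunctor F.unop)) a).symm
  map_comp F G H := by
    apply homObj_ext
    intro a
    refine (Category.assoc _ _ _).trans ((congrArg (_ ≫ ·) (homLift_π _ _ a)).trans ?_)
    refine Eq.trans ?_ (elemComp_homπ (homLift _ (isNatFamily_homπ G.unop F.unop).op)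
      (homLift _ (isNatFamily_homπ H.unop G.unop).op) a).symm
    refine Eq.trans ?_ (congrArg₂ elemComp
      (homLift_π _ (isNatFamily_homπ G.unop F.unop).op a)
      (homLift_π _ (isNatFamily_homπ H.unop G.unop).op a)).symm
    refine Eq.trans ?_ (elemComp_op (K := D) (homπ G.unop F.unop a.unop)
      (homπ H.unop G.unop a.unop)).symm
    refine (Category.assoc _ _ _).trans (congrArg (_ ≫ ·) ?_)
    exact homComp_π H.unop G.unop F.unop a.unop

variable {A D}

lemma opFunctorCategory_map_homπ (F G : EnrichedFunctor V A D) (a : A) :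
    (opFunctorCategory A D).map (op F) (op G) ≫ homπ (opFunctor F) (opFunctor G) (op a) =
      homπ G F a :=
  homLift_π _ (isNatFamily_homπ G F).op (op a)

instance (F G : (EnrichedFunctor V A D)ᵒᵖ) : IsIso ((opFunctorCategory A D).map F G) := by
  have h : IsNatFamily G.unop F.unop _
      (fun a => homπ (opFunctor F.unop) (opFunctor G.unop) (op a)) :=
    IsNatFamily.unop (isNatFamily_homπ (opFunctor F.unop) (opFunctor G.unop))
  refine ⟨homLift _ h, homObj_ext fun a => ?_, homObj_ext fun a => ?_⟩
  · refine (Category.assoc _ _ _).trans ((congrArg (_ ≫ ·) (homLift_π _ h a)).trans ?_)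
    exact (opFunctorCategory_map_homπ F.unop G.unop a).trans (Category.id_comp _).symm
  · refine (Category.assoc _ _ _).trans
      ((congrArg (_ ≫ ·) (opFunctorCategory_map_homπ F.unop G.unop a.unop)).trans ?_)
    exact (homLift_π _ h a.unop).trans (Category.id_comp _).symm

variable {B : Type w} [EnrichedCategory V B] {W : EnrichedFunctor V B V}
  {S : EnrichedFunctor V B (EnrichedFunctor V A D)ᵒᵖ}

/-- Colimits in functor categories exist pointwise: this is the statement on limits for
`[Aᵒᵖ, Dᵒᵖ] ≅ [A, D]ᵒᵖ`. -/
lemma exists_isWeightedLimit_evalAt_op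
    (h : ∀ a, ∃ L c, IsWeightedLimit W (S.comp V (opFunctor (evalAt a))) L c) :
    ∃ L c, IsWeightedLimit W S L c ∧
      ∀ a, IsWeightedLimit W (S.comp V (opFunctor (evalAt a))) ((opFunctor (evalAt a)).obj L)
        (fun b => c b ≫ (opFunctor (evalAt a)).map L (S.obj b)) := by
  have h' : ∀ a : Aᵒᵖ, ∃ L c, IsWeightedLimit W
      ((S.comp V (opFunctorCategory A D)).comp V (evalAt a)) L c := by
    intro a
    obtain ⟨L, c, hc⟩ := h a.unop
    refine ⟨L, c, hc.of_map_eq (fun x y => ?_) fun b => rfl⟩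
    refine Eq.symm ((Category.assoc _ _ _).trans (congrArg (S.map x y ≫ ·) ?_))
    exact opFunctorCategory_map_homπ (S.obj x).unop (S.obj y).unop a.unop
  obtain ⟨L', c', hL', hpt⟩ := exists_isWeightedLimit_evalAt h'
  let L : EnrichedFunctor V A D :=
    { obj := fun a => (L'.obj (op a)).unop
      map := fun a b => L'.map (op b) (op a)
      map_id := fun a => L'.map_id (op a)
      map_comp := fun a b c => by
        have h1 := L'.map_comp (op c) (op b) (op a)
        have h2 : (β_ _ _).hom ≫ eComp V a b c ≫ L'.map (op c) (op a) =
            (β_ _ _).hom ≫ elemComp (K := D) (X := (L'.obj (op a)).unop)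
              (Y := (L'.obj (op b)).unop) (Z := (L'.obj (op c)).unop)
              (L'.map (op b) (op a)) (L'.map (op c) (op b)) :=
          (Category.assoc _ _ _).symm.trans (h1.trans (elemComp_op (K := D)
            (X := (L'.obj (op c)).unop) (Y := (L'.obj (op b)).unop)
            (L'.map (op c) (op b)) (L'.map (op b) (op a))))
        exact (cancel_epi _).1 h2 }
  have hL : (opFunctorCategory A D).obj (op L) = L' := rfl
  obtain ⟨c, hc, hcc⟩ := hL'.exists_of_map (opFunctorCategory A D) (L := op L)
    (isIsoArrow_eId L')
  refine ⟨op L, c, hc, fun a => (hpt (op a)).of_map_eq (fun x y => ?_) fun b => ?_⟩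
  · refine ((Category.assoc _ _ _).trans (congrArg (S.map x y ≫ ·) ?_))
    exact opFunctorCategory_map_homπ (S.obj x).unop (S.obj y).unop a
  · have h1 := congrArg (· ≫ homπ L' (opFunctor (S.obj b).unop) (op a)) (hcc b)
    have h2 : precomp (eId V L') (opFunctor (S.obj b).unop) = 𝟙 _ := precomp_eId _ _
    have h3 := opFunctorCategory_map_homπ L (S.obj b).unop a
    refine Eq.trans ?_ (h1.symm.trans ((Category.assoc _ _ _).trans (congrArg (c b ≫ ·) h3)))
    exact congrArg (· ≫ homπ L' (opFunctor (S.obj b).unop) (op a))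
      ((Category.comp_id _).symm.trans (congrArg (c' b ≫ ·) h2.symm))

end PointwiseColimits

section Completeness

variable {V : Type u} [Category.{v} V] [MonoidalCategory V] [SymmetricCategory V]
  [MonoidalClosed V] [HasLimits V]
variable {T : Type v} [EnrichedCategory V T]
variable {A : Type w} [EnrichedCategory V A] {W : EnrichedFunctor V Aᵒᵖ V}

/-- `[T, V]` is complete, with limits computed pointwise. -/
lemma IsWeight.exists_limit (hW : IsWeight W) (S : EnrichedFunctor V Aᵒᵖ (EnrichedFunctor V T V)) :
    ∃ L c, IsWeightedLimit W S L c ∧ ∀ t, IsWeightedLimit W (S.comp V (evalAt t))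
      ((evalAt t).obj L) (fun b => c b ≫ (evalAt t).map L (S.obj b)) :=
  exists_isWeightedLimit_evalAt fun _ => exists_isWeightedLimit_of_isWeight
    (fun _ _ W S => exists_isWeightedLimit_base W S) W hW _

/-- `[T, V]` is cocomplete, with colimits computed pointwise. -/
lemma IsWeight.exists_colimit [HasColimits V] (hW : IsWeight W)
    (S : EnrichedFunctor V Aᵒᵖ (EnrichedFunctor V T V)ᵒᵖ) :
    ∃ L c, IsWeightedLimit W S L c ∧
      ∀ t, IsWeightedLimit W (S.comp V (opFunctor (evalAt t))) ((opFunctor (evalAt t)).obj L)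
        (fun b => c b ≫ (opFunctor (evalAt t)).map L (S.obj b)) :=
  exists_isWeightedLimit_evalAt_op fun _ => exists_isWeightedLimit_of_isWeight
    (fun _ _ W S => exists_isWeightedLimit_base_op W S) W hW _

/-- Evaluation preserves all colimits in `[T, V]`, since it preserves the pointwise ones. -/
lemma IsWeight.map_evalAt_op [HasColimits V] (hW : IsWeight W)
    {S : EnrichedFunctor V Aᵒᵖ (EnrichedFunctor V T V)ᵒᵖ} {L c} (h : IsWeightedLimit W S L c)
    (t : T) :
    IsWeightedLimit W (S.comp V (opFunctor (evalAt t))) ((opFunctor (evalAt t)).obj L)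
      (fun b => c b ≫ (opFunctor (evalAt t)).map L (S.obj b)) := by
  obtain ⟨L', c', h', hpt⟩ := hW.exists_colimit S
  exact h'.map_of_map h (opFunctor (evalAt t)) (hpt t)

end Completeness

end EnrichedModels

end

noncomputable section

namespace EnrichedModels

/-! ### The Yoneda lemma -/

section Action

variable {V : Type u} [Category.{v} V] [MonoidalCategory V] [MonoidalClosed V]

lemma act_comp {C : Type u₁} [EnrichedCategory V C] (F : EnrichedFunctor V C V) (a b c : C) :
    _ ◁ eComp V a b c ≫ act F a c = (α_ _ _ _).inv ≫ act F a b ▷ _ ≫ act F b c := by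
  have h := congrArg uncurry ((F.map_comp a b c).trans
    (rfl : _ = elemComp (F.map a b) (F.map b c)))
  rw [uncurry_comp_left, uncurry_elemComp] at h
  exact h

lemma act_id {C : Type u₁} [EnrichedCategory V C] (F : EnrichedFunctor V C V) (a : C) :
    _ ◁ eId V a ≫ act F a a = (ρ_ _).hom := by
  have h := congrArg uncurry (F.map_id a)
  rw [uncurry_comp_left, uncurry_eId] at h
  exact h

lemma act_homFunctor {C : Type u₁} [EnrichedCategory V C] (t a b : C) :
    act (homFunctor (V := V) t) a b = eComp V t a b :=
  uncurry_curry _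

/-- The naturality of a base cone out of a representable determines it by its value at the
identity. -/
lemma IsBaseCone.eq_of_homFunctor {C : Type u₁} [EnrichedCategory V C]
    {F : EnrichedFunctor V C V} {t : C} {Z : V} {d : ∀ a, Z ⊗ eHom V t a ⟶ F.obj a}
    (h : IsBaseCone (homFunctor t) F Z d) (a : C) :
    d a = ((ρ_ Z).inv ≫ Z ◁ eId V t ≫ d t) ▷ _ ≫ act F t a := by
  have h1 : Z ◁ act (homFunctor t) t a ≫ d a =
    (α_ Z (eHom V t t) (eHom V t a)).inv ≫ d t ▷ eHom V t a ≫ act F t a := h t a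
  have h1 : Z ◁ eComp V t t a ≫ d a =
      (α_ Z (eHom V t t) (eHom V t a)).inv ≫ d t ▷ eHom V t a ≫ act F t a :=
    (congrArg (fun z => Z ◁ z ≫ d a) (act_homFunctor t t a).symm).trans h1
  rw [comp_whiskerRight, comp_whiskerRight, Category.assoc, Category.assoc]
  have h2 := (Iso.inv_comp_eq _).1 h1.symm
  refine Eq.trans ?_ (congrArg (fun z => (ρ_ Z).inv ▷ _ ≫ (Z ◁ eId V t) ▷ _ ≫ z) h2.symm)
  rw [associator_naturality_middle_assoc, ← MonoidalCategory.whiskerLeft_comp_assoc]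
  have h3 : eId V t ▷ eHom V t a ≫ eComp V t t a = (λ_ _).hom := by
    have h := e_id_comp V t a
    rwa [Iso.inv_comp_eq, Category.comp_id] at h
  refine Eq.trans ?_ (congrArg (fun z => (ρ_ Z).inv ▷ _ ≫ (α_ _ _ _).hom ≫ Z ◁ z ≫ d a) h3.symm)
  simp

end Action

section Yoneda

variable {V : Type u} [Category.{v} V] [MonoidalCategory V] [SymmetricCategory V]

lemma braid_hexagon_left (Z A B : V) :
    (β_ (Z ⊗ A) B).hom ≫ B ◁ (β_ Z A).hom ≫ (α_ B A Z).inv ≫ (β_ B A).hom ▷ Z =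
      (α_ Z A B).hom ≫ (β_ Z (A ⊗ B)).hom := by
  rw [← braiding_naturality_left_assoc, braiding_tensor_left_hom, braiding_tensor_right_hom]
  simp only [Category.assoc, Iso.hom_inv_id_assoc]
  rw [← comp_whiskerRight, SymmetricCategory.symmetry, id_whiskerRight, Category.comp_id]

lemma braid_hexagon_right (A Z B : V) :
    (β_ (A ⊗ Z) B).hom ≫ (α_ B A Z).inv ≫ (β_ B A).hom ▷ Z =
      (α_ A Z B).hom ≫ A ◁ (β_ Z B).hom ≫ (α_ A B Z).inv := by
  rw [braiding_tensor_left_hom]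
  simp only [Category.assoc, Iso.hom_inv_id_assoc]
  rw [← comp_whiskerRight, SymmetricCategory.symmetry, id_whiskerRight, Category.comp_id]

variable [MonoidalClosed V]

/-- A `V`-natural transformation between `V`-valued `V`-functors, given by morphisms of `V`
compatible with the actions. -/
def VNat.ofHom {C : Type u₁} [EnrichedCategory V C] {F G : EnrichedFunctor V C V}
    (f : ∀ a, F.obj a ⟶ G.obj a) (h : ∀ a b, act F a b ≫ f b = f a ▷ _ ≫ act G a b) :
    VNat F G where
  app a := toArrow (f a)
  natural := (isNatFamily_unit_iff _).2 fun a b => by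
    apply uncurry_injective
    rw [uncurry_comp_postcomp, uncurry_comp_precomp, ofArrow_toArrow, ofArrow_toArrow]
    exact h a b

lemma VNat.ofHom_isIso {C : Type u₁} [EnrichedCategory V C] {F G : EnrichedFunctor V C V}
    (f : ∀ a, F.obj a ⟶ G.obj a) (h : ∀ a b, act F a b ≫ f b = f a ▷ _ ≫ act G a b)
    (hf : ∀ a, CategoryTheory.IsIso (f a)) : (VNat.ofHom f h).IsIso := fun a => by
  refine (isIsoArrow_iff_isIso_ofArrow (toArrow (f a))).2 ?_
  rw [ofArrow_toArrow]
  exact hf a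

lemma act_comp_homFunctor_op {B : Type u₁} [EnrichedCategory V B] {K : Type u₂}
    [EnrichedCategory V K] (H : EnrichedFunctor V B Kᵒᵖ) (X : K) (s t : B) :
    act (H.comp V (homFunctor (op X))) s t = (β_ _ _).hom ≫
      elemComp (X := (H.obj t).unop) (Y := (H.obj s).unop) (H.map s t)
        (𝟙 (eHom V (H.obj s).unop X)) := by
  refine (uncurry_comp_left (H.map s t) (curry (eComp V (op X) (H.obj s) (H.obj t)))).trans ?_
  rw [uncurry_curry]
  refine Eq.trans ?_ (elemComp_op (K := K) (𝟙 (eHom V (H.obj s).unop X)) (H.map s t))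
  rw [elemComp]
  exact congrArg (· ≫ _) (id_tensorHom _ _).symm

variable [HasLimits V]
variable {T : Type v} [EnrichedCategory V T]

/-- The family `Z ⊗ F a ⟶ G a` corresponding to a generalized element of `[T, V](F, G)`. -/
def flatten {F G : EnrichedFunctor V T V} {Z : V} (x : Z ⟶ homObj F G) (a : T) :
    Z ⊗ F.obj a ⟶ G.obj a :=
  (β_ _ _).hom ≫ uncurry (x ≫ homπ F G a)

lemma flatten_isBaseCone {F G : EnrichedFunctor V T V} {Z : V} (x : Z ⟶ homObj F G) :
    IsBaseCone F G Z (flatten x) :=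
  (isNatFamily_base_iff F G _).1 (isNatFamily_comp_homπ x)

lemma flatten_ext {F G : EnrichedFunctor V T V} {Z : V} {x y : Z ⟶ homObj F G}
    (h : ∀ a, flatten x a = flatten y a) : x = y :=
  homObj_ext fun a => uncurry_injective ((cancel_epi _).1 (h a))

lemma flatten_comp {F G : EnrichedFunctor V T V} {Z Z' : V} (f : Z' ⟶ Z) (x : Z ⟶ homObj F G)
    (a : T) : flatten (f ≫ x) a = f ▷ _ ≫ flatten x a := by
  rw [flatten, flatten, braiding_naturality_left_assoc, ← uncurry_comp_left, Category.assoc]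

/-- The Yoneda map `F t ⟶ [T, V](T(t, -), F)`. -/
def yonedaHom (F : EnrichedFunctor V T V) (t : T) : F.obj t ⟶ homObj (homFunctor t) F :=
  homLift (fun a => curry ((β_ _ _).hom ≫ act F t a)) <| (isNatFamily_base_iff _ _ _).2 <| by
    intro a b
    have e : ∀ a, (β_ _ _).hom ≫ uncurry (curry ((β_ (eHom V t a) (F.obj t)).hom ≫ act F t a)) =
        act F t a := fun a => by
      rw [uncurry_curry, SymmetricCategory.symmetry_assoc]
    have h := act_comp F t a b
    rw [act_homFunctor]
    exact (congrArg (_ ≫ ·) (e b)).trans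
      (h.trans (congrArg (fun z => (α_ _ _ _).inv ≫ z ▷ _ ≫ act F a b) (e a).symm))

lemma yonedaHom_homπ (F : EnrichedFunctor V T V) (t a : T) :
    yonedaHom F t ≫ homπ (homFunctor t) F a = curry ((β_ _ _).hom ≫ act F t a) :=
  homLift_π _ _ a

lemma flatten_yonedaHom (F : EnrichedFunctor V T V) (t a : T) :
    flatten (yonedaHom F t) a = act F t a := by
  refine (congrArg (fun z => (β_ _ _).hom ≫ uncurry z) (yonedaHom_homπ F t a)).trans ?_
  exact (congrArg (_ ≫ ·) (uncurry_curry _)).trans (SymmetricCategory.symmetry_assoc _ _ _)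

/-- The Yoneda lemma: the inverse of `yonedaHom F t` is evaluation at the identity of `t`. -/
instance isIso_yonedaHom (F : EnrichedFunctor V T V) (t : T) : IsIso (yonedaHom F t) := by
  have h1 : ∀ {Z : V} (x : Z ⟶ homObj (homFunctor t) F),
      ((ρ_ Z).inv ≫ Z ◁ eId V t ≫ flatten x t) ≫ yonedaHom F t = x := by
    intro Z x
    refine flatten_ext fun a => ?_
    rw [flatten_comp, flatten_yonedaHom]
    exact ((flatten_isBaseCone x).eq_of_homFunctor a).symm
  have h2 : ∀ {Z : V} (f : Z ⟶ F.obj t),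
      (ρ_ Z).inv ≫ Z ◁ eId V t ≫ flatten (f ≫ yonedaHom F t) t = f := by
    intro Z f
    rw [flatten_comp, flatten_yonedaHom, Iso.inv_comp_eq]
    refine (whisker_exchange_assoc f (eId V t) (act F t t)).trans ?_
    rw [act_id, rightUnitor_naturality]
  refine isIso_of_bijective _ fun Z g => ⟨_, h1 g, fun f hf => ?_⟩
  rw [← h2 f, hf]

/-- The action of the contravariant Yoneda embedding on hom-objects. -/
def yonedaElem (s t : T) : eHom V s t ⟶ homObj (homFunctor (V := V) t) (homFunctor s) :=
  homLift _ (isNatFamily_yoneda s t)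

/-- A generalized element `x` of `[T, V](T(s, -), F)`, precomposed with the transformations
`T(t, -) ⟶ T(s, -)` given by `T(s, t)`, corresponds to the family obtained from that of `x` by
composing in `T` first. -/
lemma flatten_yonedaElem_elemComp {F : EnrichedFunctor V T V} {s t : T} {Z : V}
    (x : Z ⟶ homObj (homFunctor s) F) (a : T) :
    flatten (F := homFunctor t) (G := F) ((β_ _ _).hom ≫
      elemComp (K := EnrichedFunctor V T V) (X := homFunctor t) (Y := homFunctor s) (Z := F)
        (yonedaElem s t) x) a =
      (α_ Z (eHom V s t) (eHom V t a)).hom ≫ Z ◁ eComp V s t a ≫ flatten x a := by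
  have h1 : elemComp (K := EnrichedFunctor V T V) (X := homFunctor t) (Y := homFunctor s) (Z := F)
        (yonedaElem s t) x ≫ homπ (homFunctor t) F a =
      elemComp (X := eHom V t a) (Y := eHom V s a) (Z := F.obj a)
        (curry ((β_ (eHom V t a) (eHom V s t)).hom ≫ eComp V s t a))
        (x ≫ homπ (homFunctor s) F a) :=
    (elemComp_homπ (F := homFunctor t) (G := homFunctor s) (H := F) (yonedaElem s t) x a).trans
      (congrArg (fun z => elemComp z (x ≫ homπ (homFunctor s) F a))
        (homLift_π _ (isNatFamily_yoneda s t) a))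
  have h4 : uncurry ((β_ Z (eHom V s t)).hom ≫
      elemComp (X := eHom V t a) (Y := eHom V s a) (Z := F.obj a)
        (curry ((β_ (eHom V t a) (eHom V s t)).hom ≫ eComp V s t a))
        (x ≫ homπ (homFunctor s) F a)) =
      eHom V t a ◁ (β_ Z (eHom V s t)).hom ≫ (α_ _ _ _).inv ≫
        (β_ (eHom V t a) (eHom V s t)).hom ▷ Z ≫ eComp V s t a ▷ Z ≫
          uncurry (x ≫ homπ (homFunctor s) F a) := by
    rw [uncurry_comp_left, uncurry_elemComp, uncurry_curry, comp_whiskerRight, Category.assoc]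
    rfl
  rw [flatten, Category.assoc, h1]
  refine (congrArg (_ ≫ ·) h4).trans ?_
  have h2 := braid_hexagon_left Z (eHom V s t) (eHom V t a)
  have h3 := congrArg (· ≫ eComp V s t a ▷ Z ≫ uncurry (x ≫ homπ (homFunctor s) F a)) h2
  simp only [Category.assoc] at h3
  refine h3.trans (congrArg ((α_ Z (eHom V s t) (eHom V t a)).hom ≫ ·) ?_)
  exact (braiding_naturality_right_assoc Z (eComp V s t a) _).symm

/-- The Yoneda isomorphism `F t ≅ [T, V](T(t, -), F)`, as a `V`-natural transformation in `t`. -/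
def yonedaNat (F : EnrichedFunctor V T V) :
    VNat F ((yonedaOp T).comp V (homFunctor (op F))) :=
  VNat.ofHom (fun t => yonedaHom F t) fun s t => by
    refine flatten_ext (F := homFunctor t) (G := F) fun a => ?_
    refine (flatten_comp (F := homFunctor t) (G := F) (act F s t) (yonedaHom F t) a).trans ?_
    rw [flatten_yonedaHom]
    refine Eq.trans ?_ (congrArg
      (fun z => flatten (F := homFunctor t) (G := F) (yonedaHom F s ▷ eHom V s t ≫ z) a)
      (act_comp_homFunctor_op (yonedaOp T) F s t).symm)
    refine Eq.trans ?_ (flatten_comp (F := homFunctor t) (G := F)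
      (yonedaHom F s ▷ eHom V s t) _ a).symm
    refine Eq.trans ?_ (congrArg
      (fun z => (yonedaHom F s ▷ eHom V s t) ▷ eHom V t a ≫ z)
      (flatten_yonedaElem_elemComp (F := F) (t := t) (𝟙 (homObj (homFunctor s) F)) a).symm)
    have h2 : yonedaHom F s ▷ eHom V s a ≫ flatten (𝟙 (homObj (homFunctor s) F)) a =
        act F s a := by
      refine (flatten_comp (yonedaHom F s) (𝟙 (homObj (homFunctor s) F)) a).symm.trans ?_
      rw [Category.comp_id, flatten_yonedaHom]
    refine Eq.trans ?_ (associator_naturality_left_assoc (yonedaHom F s) (eHom V s t)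
      (eHom V t a) _).symm
    refine Eq.trans ?_ (congrArg ((α_ (F.obj s) (eHom V s t) (eHom V t a)).hom ≫ ·)
      (whisker_exchange_assoc (yonedaHom F s) (eComp V s t a)
        (flatten (𝟙 (homObj (homFunctor s) F)) a)))
    refine Eq.trans ?_ (congrArg (fun z => (α_ (F.obj s) (eHom V s t) (eHom V t a)).hom ≫
      F.obj s ◁ eComp V s t a ≫ z) h2.symm)
    rw [act_comp]
    exact (Iso.hom_inv_id_assoc _ _).symm

lemma yonedaNat_isIso (F : EnrichedFunctor V T V) : (yonedaNat F).IsIso :=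
  VNat.ofHom_isIso (G := (yonedaOp T).comp V (homFunctor (op F))) (fun t => yonedaHom F t) _
    fun t => isIso_yonedaHom F t

/-- The Yoneda isomorphism `F t ≅ [T, V](T(t, -), F)`, as a `V`-natural transformation in `F`. -/
def evalNat (t : T) :
    VNat (evalAt (D := V) t) (homFunctor (K := EnrichedFunctor V T V) (homFunctor t)) :=
  VNat.ofHom (fun F => yonedaHom F t) fun F G => by
    refine flatten_ext (F := homFunctor t) fun a => ?_
    refine (flatten_comp _ _ _).trans ?_
    refine (congrArg (fun z => act (evalAt t) F G ▷ eHom V t a ≫ z)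
      (flatten_yonedaHom G t a)).trans ?_
    rw [act_homFunctor]
    have h1 : yonedaHom F t ▷ homObj F G ≫ eComp V (homFunctor t) F G =
        elemComp (K := EnrichedFunctor V T V) (yonedaHom F t) (𝟙 (homObj F G)) := by
      rw [elemComp]
      exact congrArg (· ≫ _) (tensorHom_id _ _).symm
    refine Eq.trans ?_ (congrArg (fun z => flatten (F := homFunctor t) z a) h1.symm)
    have h2 : elemComp (K := EnrichedFunctor V T V) (yonedaHom F t) (𝟙 (homObj F G)) ≫
        homπ (homFunctor t) G a =
        elemComp (X := eHom V t a) (curry ((β_ (eHom V t a) (F.obj t)).hom ≫ act F t a))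
          (homπ F G a) :=
      (elemComp_homπ (yonedaHom F t) (𝟙 (homObj F G)) a).trans
        (congrArg₂ elemComp (yonedaHom_homπ F t a) (Category.id_comp _))
    refine Eq.trans ?_ (congrArg (fun z => (β_ _ _).hom ≫ uncurry z) h2.symm)
    have h5 : uncurry (elemComp (X := eHom V t a)
        (curry ((β_ (eHom V t a) (F.obj t)).hom ≫ act F t a)) (homπ F G a)) =
        (α_ (eHom V t a) (F.obj t) (homObj F G)).inv ≫ (β_ _ _).hom ▷ homObj F G ≫
          act F t a ▷ homObj F G ≫ uncurry (homπ F G a) := by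
      rw [uncurry_elemComp, uncurry_curry, comp_whiskerRight, Category.assoc]
    refine Eq.trans ?_ (congrArg (_ ≫ ·) h5.symm)
    have h3 := congrArg (fun z => z ≫ act F t a ▷ homObj F G ≫ uncurry (homπ F G a))
      (braid_hexagon_right (F.obj t) (homObj F G) (eHom V t a))
    simp only [Category.assoc] at h3
    refine Eq.trans ?_ h3.symm
    have h4 := congrArg uncurry ((isNatFamily_homπ F G).eq t a)
    rw [uncurry_comp_left, uncurry_elemComp, uncurry_elemComp] at h4
    refine Eq.trans ?_ (congrArg ((α_ _ _ _).hom ≫ ·) h4.symm)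
    exact (Iso.hom_inv_id_assoc _ _).symm

lemma evalNat_isIso (t : T) : (evalNat (V := V) t).IsIso :=
  VNat.ofHom_isIso (F := evalAt (D := V) t)
    (G := homFunctor (K := EnrichedFunctor V T V) (homFunctor t)) (fun F => yonedaHom F t) _
    fun F => isIso_yonedaHom F t

lemma yonedaOp_map_eq (s t : T) :
    (yonedaOp (V := V) T).map s t = yonedaHom (homFunctor s) t := by
  apply homObj_ext
  intro a
  refine (homLift_π _ (isNatFamily_yoneda s t) a).trans (Eq.symm ?_)
  exact (yonedaHom_homπ (homFunctor s) t a).trans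
    (congrArg (fun z => curry ((β_ (eHom V t a) (eHom V s t)).hom ≫ z)) (act_homFunctor s t a))

/-- The Yoneda embedding is fully faithful. -/
instance (s t : T) : IsIso ((yonedaOp (V := V) T).map s t) := by
  rw [yonedaOp_map_eq]
  exact isIso_yonedaHom (homFunctor s) t

end Yoneda

end EnrichedModels

end

noncomputable section

namespace EnrichedModels

/-! ### Models as objects orthogonal to the comparison maps -/

section Orthogonality

variable {V : Type u} [Category.{v} V] [MonoidalCategory V] [MonoidalClosed V]
variable {K : Type u₁} [EnrichedCategory V K]

/-- The two bracketings of `H G S` are not definitionally equal, but have the same limits. -/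
lemma isWeightedLimit_comp_assoc_iff {B : Type w} [EnrichedCategory V B]
    {W : EnrichedFunctor V B V} {K' : Type u₂} [EnrichedCategory V K'] {K'' : Type u₃}
    [EnrichedCategory V K''] {S : EnrichedFunctor V B K} {L : K}
    {c : ∀ b, W.obj b ⟶ eHom V L (S.obj b)} (G : EnrichedFunctor V K K')
    (H : EnrichedFunctor V K' K'') :
    IsWeightedLimit W ((S.comp V G).comp V H) (H.obj (G.obj L))
      (fun b => (c b ≫ G.map L (S.obj b)) ≫ H.map (G.obj L) (G.obj (S.obj b))) ↔
    IsWeightedLimit W (S.comp V (G.comp V H)) ((G.comp V H).obj L)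
      (fun b => c b ≫ (G.comp V H).map L (S.obj b)) :=
  ⟨fun h => h.of_map_eq (fun _ _ => Category.assoc _ _ _) fun _ => Category.assoc _ _ _,
    fun h => h.of_map_eq (fun _ _ => (Category.assoc _ _ _).symm)
      fun _ => (Category.assoc _ _ _).symm⟩

/-- The objects to which `k` is orthogonal are closed under limits. -/
lemma closedUnderLimits_isIso_precomp [BraidedCategory V] {Q L : K} (k : 𝟙_ V ⟶ eHom V Q L) :
    ClosedUnderLimits.{w} V (fun X : K => IsIso (precomp k X)) := by
  intro A _ W _ S hS X c h
  refine isIso_of_bijective _ fun Z g => ?_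
  -- over each `S b`, the element `g ⊙ c b` extends uniquely along `k`
  have hd : IsIndexedCone W S L Z (fun b => (g ⊙ c b) ≫ inv (precomp k (S.obj b))) := by
    intro a b
    change Z ◁ act W a b ≫ (g ⊙ c b) ≫ inv (precomp k (S.obj b)) =
      (α_ _ _ _).inv ≫ (((g ⊙ c a) ≫ inv (precomp k (S.obj a))) ⊙ S.map a b)
    rw [← cancel_mono (precomp k (S.obj b))]
    simp only [Category.assoc, IsIso.inv_hom_id, Category.comp_id]
    rw [← comp_precomp_elemComp, Category.assoc, IsIso.inv_hom_id, Category.comp_id,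
      (h.1.isIndexedCone g).eq]
  obtain ⟨f, hf, hu⟩ := h.2 L Z _ hd
  refine ⟨f, h.ext fun b => ?_, fun f' hf' => hu f' fun b => ?_⟩
  · rw [comp_precomp_elemComp]
    refine (congrArg (· ≫ precomp k (S.obj b)) (hf b)).trans ?_
    rw [Category.assoc, IsIso.inv_hom_id, Category.comp_id]
  · change f' ⊙ c b = _
    rw [← hf', comp_precomp_elemComp, Category.assoc, IsIso.hom_inv_id, Category.comp_id]

end Orthogonality

section Models

variable {V : Type u} [Category.{v} V] [MonoidalCategory V] [SymmetricCategory V]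
  [MonoidalClosed V] [HasLimits V]
variable {T : Type v} [EnrichedCategory V T]

/-- `F` preserves the limit cone `c` if and only if the image of `c` under the contravariant
Yoneda embedding has the universal property of a limit with respect to `F`. -/
lemma preserves_iff_isLimitAt_yonedaOp (F : EnrichedFunctor V T V) {A : Type w}
    [EnrichedCategory V A] {W : EnrichedFunctor V A V} {S : EnrichedFunctor V A T} {L : T}
    {c : ∀ b, W.obj b ⟶ eHom V L (S.obj b)} (hc : IsWeightedCone W S L c) :
    IsWeightedLimit W (S.comp V F) (F.obj L) (fun b => c b ≫ F.map L (S.obj b)) ↔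
      IsLimitAt W (S.comp V (yonedaOp T)) (op (homFunctor L))
        (fun b => c b ≫ (yonedaOp T).map L (S.obj b)) (op F) := by
  refine Iff.trans ?_ (isLimitAt_iff_homFunctor (hc.map (yonedaOp T)) (op F)).symm
  refine Iff.trans ⟨fun h => ?_, fun h => ?_⟩
    (isWeightedLimit_comp_assoc_iff (yonedaOp T) (homFunctor (op F))).symm
  · obtain ⟨τ, hτ, hτ'⟩ := (yonedaNat_isIso F).exists_inv
    exact IsWeightedLimit.map_of_iso τ (fun a => (isIsoArrow_iff _).2 ⟨_, hτ' a, hτ a⟩) c h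
  · exact IsWeightedLimit.map_of_iso (yonedaNat F) (yonedaNat_isIso F) c h

variable [HasColimits V]

/-- Preservation of a limit cone is orthogonality to the comparison map from the colimit of the
corresponding representables to the representable of the limit. -/
lemma IsWeight.exists_preserves_iff {A : Type w} [EnrichedCategory V A]
    {W : EnrichedFunctor V Aᵒᵖ V} (hW : IsWeight W) {S : EnrichedFunctor V Aᵒᵖ T} {L : T}
    {c : ∀ b, W.obj b ⟶ eHom V L (S.obj b)} (hc : IsWeightedCone W S L c) :
    ∃ (Q : EnrichedFunctor V T V) (k : 𝟙_ V ⟶ eHom V Q (homFunctor L)),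
      ∀ F : EnrichedFunctor V T V,
        IsWeightedLimit W (S.comp V F) (F.obj L) (fun b => c b ≫ F.map L (S.obj b)) ↔
          IsIso (precomp k F) := by
  obtain ⟨Q, q, hq, -⟩ := hW.exists_colimit (S.comp V (yonedaOp T))
  obtain ⟨k, hk⟩ := hq.exists_lift (hc.map (yonedaOp T))
  refine ⟨Q.unop, k, fun F => (preserves_iff_isLimitAt_yonedaOp F hc).trans
    ((hq.isLimitAt_iff_isIso hk (op F)).trans ?_)⟩
  have e := postcomp_op (X := Q.unop) (Y := homFunctor L) k F
  exact Iff.of_eq (congrArg (fun f => IsIso f) e)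

/-- Being a model means being orthogonal to the comparison maps of all `Φ`-limit cones in `T`. -/
lemma closedUnderLimits_isModel (Φ : WeightClass.{w} V) :
    ClosedUnderLimits.{w₂} V (IsModel Φ (T := T)) := by
  intro B _ W hW S hS F d hF A _ W' hW' S' L c hc
  obtain ⟨Q, k, hk⟩ := (Φ.isWeight _ hW').exists_preserves_iff hc.1
  exact (hk F).2 (closedUnderLimits_isIso_precomp k B W hW S
    (fun b => (hk (S.obj b)).1 (hS b A W' hW' S' L c hc)) F d hF)

lemma isVComplete_phiMod (Φ : WeightClass.{w} V) : IsVComplete.{w₁} V (PhiMod Φ T) := by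
  intro A _ W hW S
  obtain ⟨L, c, hc, -⟩ := hW.exists_limit (S.comp V (FullSub.ι (IsModel Φ)))
  have hL : IsModel Φ L := closedUnderLimits_isModel Φ A W hW _
    (fun a => (S.obj a).property) L c hc
  obtain ⟨c', hc', -⟩ := IsWeightedLimit.exists_of_map (FullSub.ι (IsModel Φ)) hc
    (L := ⟨L, hL⟩) (isIsoArrow_eId L)
  exact ⟨_, c', hc'⟩

end Models

end EnrichedModels

end

noncomputable section

namespace EnrichedModels

/-! ### Adjoints constructed pointwise -/

section Reflection

variable {V : Type u} [Category.{v} V] [MonoidalCategory V] [BraidedCategory V]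
variable {K : Type u₁} [EnrichedCategory V K]

/-- A full subcategory is reflective as soon as every object has a reflection: the universal
properties of the reflections determine the action on hom-objects. -/
lemma isReflective_of_pointwise {P : K → Prop}
    (h : ∀ X : K, ∃ (L : K) (r : 𝟙_ V ⟶ eHom V X L), P L ∧ ∀ Y, P Y → IsIso (precomp r Y)) :
    IsReflective V P := by
  choose L r hL hr using h
  have hi : ∀ X Y, IsIso (precomp (r X) (L Y)) := fun X Y => hr X _ (hL Y)
  have hm : ∀ X Y, (postcomp (r Y) X ≫ inv (precomp (r X) (L Y))) ≫ precomp (r X) (L Y) =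
      postcomp (r Y) X := fun X Y => by simp
  let F : EnrichedFunctor V K (FullSub P) :=
    { obj := fun X => ⟨L X, hL X⟩
      map := fun X Y => postcomp (r Y) X ≫ inv (precomp (r X) (L Y))
      map_id := fun X => by
        refine (cancel_mono (precomp (r X) (L X))).1 ((Category.assoc _ _ _).trans ?_)
        rw [hm, eId_postcomp]
        exact (eId_precomp (r X)).symm
      map_comp := fun X Y Z => by
        refine (cancel_mono (precomp (r X) (L Z))).1 ((Category.assoc _ _ _).trans ?_)
        change eComp V X Y Z ≫ _ = ((postcomp (r Y) X ≫ inv (precomp (r X) (L Y))) ⊙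
          (postcomp (r Z) Y ≫ inv (precomp (r Y) (L Z)))) ≫ precomp (r X) (L Z)
        rw [hm, ← comp_precomp_elemComp, hm, ← Category.id_comp (postcomp (r Y) X),
          comp_postcomp_elemComp, hm, eComp_eq_elemComp, ← elemComp_comp_postcomp,
          Category.id_comp] }
  refine ⟨F, ⟨⟨⟨r, (isNatFamily_unit_iff _).2 fun X Y => ?_⟩, fun X Y => ?_⟩⟩⟩
  · change 𝟙 _ ≫ postcomp (r Y) X =
      ((postcomp (r Y) X ≫ inv (precomp (r X) (L Y))) ≫ 𝟙 _) ≫ precomp (r X) (L Y)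
    rw [Category.comp_id, hm, Category.id_comp]
  · have := hr X Y.obj Y.property
    change IsIso (𝟙 _ ≫ precomp (r X) Y.obj)
    infer_instance

end Reflection

section RightAdjoint

variable {V : Type u} [Category.{v} V] [MonoidalCategory V]
variable {C : Type u₁} [EnrichedCategory V C] {M : Type u₂} [EnrichedCategory V M]
  {B : Type u₃} [EnrichedCategory V B]

/-- The map `C(t, R) ⟶ M(J t, X)` induced by an arrow `ε : J R ⟶ X`. -/
def adjunct (J : EnrichedFunctor V C M) {R : C} {X : M} (ε : 𝟙_ V ⟶ eHom V (J.obj R) X) (t : C) :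
    eHom V t R ⟶ eHom V (J.obj t) X :=
  J.map t R ≫ postcomp ε (J.obj t)

lemma elemComp_adjunct (J : EnrichedFunctor V C M) {R : C} {X : M}
    (ε : 𝟙_ V ⟶ eHom V (J.obj R) X) {t s : C} {P Q : V} (f : P ⟶ eHom V t s)
    (g : Q ⟶ eHom V s R) : (f ⊙ g) ≫ adjunct J ε t = (f ≫ J.map t s) ⊙ (g ≫ adjunct J ε s) := by
  rw [adjunct, adjunct, ← Category.assoc, elemComp_map, ← elemComp_comp_postcomp,
    Category.assoc]

lemma precomp_adjunct (J : EnrichedFunctor V C M) {R : C} {X : M}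
    (ε : 𝟙_ V ⟶ eHom V (J.obj R) X) {t s : C} (r : 𝟙_ V ⟶ eHom V t s) :
    precomp r R ≫ adjunct J ε t = adjunct J ε s ≫ precomp (r ≫ J.map t s) X := by
  rw [adjunct, adjunct, reassoc_of% (precomp_map J r R), Category.assoc, precomp_postcomp]

lemma adjunct_eId (J : EnrichedFunctor V C M) (R t : C) :
    adjunct J (eId V (J.obj R)) t = J.map t R := by
  rw [adjunct, postcomp_eId, Category.comp_id]

/-- The object `X` has a value `R` of the right adjoint of `J`, with counit `ε : J R ⟶ X`. -/
def HasRightValue (J : EnrichedFunctor V C M) (X : M) : Prop :=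
  ∃ (R : C) (ε : 𝟙_ V ⟶ eHom V (J.obj R) X), ∀ t, IsIso (adjunct J ε t)

section Relative

variable (J : EnrichedFunctor V C M) (S : EnrichedFunctor V B M) (R : B → C)
  (ε : ∀ b, 𝟙_ V ⟶ eHom V (J.obj (R b)) (S.obj b)) [∀ b t, IsIso (adjunct J (ε b) t)]

/-- The action on hom-objects of the right adjoint of `J` relative to `S`. -/
def relativeRightAdjointMap (a b : B) : eHom V a b ⟶ eHom V (R a) (R b) :=
  S.map a b ≫ precomp (ε a) (S.obj b) ≫ inv (adjunct J (ε b) (R a))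

lemma relativeRightAdjointMap_adjunct (a b : B) :
    relativeRightAdjointMap J S R ε a b ≫ adjunct J (ε b) (R a) =
      S.map a b ≫ precomp (ε a) (S.obj b) := by
  simp [relativeRightAdjointMap]

/-- The right adjoint of `J` relative to `S`, constructed from its values at the `S b`. -/
def relativeRightAdjoint : EnrichedFunctor V B C where
  obj := R
  map a b := relativeRightAdjointMap J S R ε a b
  map_id b := by
    rw [← cancel_mono (adjunct J (ε b) (R b)), Category.assoc, relativeRightAdjointMap_adjunct,
      ← Category.assoc, S.map_id, eId_precomp, adjunct, ← Category.assoc, J.map_id, eId_postcomp]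
  map_comp a b c := by
    have h := relativeRightAdjointMap_adjunct J S R ε a b
    rw [adjunct, ← Category.assoc] at h
    have h2 : eComp V a b c ≫ S.map a c = S.map a b ⊙ S.map b c := S.map_comp a b c
    rw [← cancel_mono (adjunct J (ε c) (R a)), Category.assoc, relativeRightAdjointMap_adjunct]
    refine Eq.trans ?_ (elemComp_adjunct J (ε c) _ _).symm
    rw [relativeRightAdjointMap_adjunct, ← comp_postcomp_elemComp, h, comp_precomp_elemComp,
      ← h2, Category.assoc]

/-- The counit of the relative right adjoint. -/
def relativeCounit [BraidedCategory V] :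
    VNat ((relativeRightAdjoint J S R ε).comp V J) S where
  app := ε
  natural := (isNatFamily_unit_iff _).2 fun a b =>
    (Category.assoc _ _ _).trans (relativeRightAdjointMap_adjunct J S R ε a b)

end Relative

/-- If `C` has `W`-limits, then the objects at which the right adjoint of `J : C → M` is defined
are closed under `W`-limits. -/
lemma HasRightValue.of_isWeightedLimit [MonoidalClosed V] [BraidedCategory V]
    {J : EnrichedFunctor V C M} {W : EnrichedFunctor V B V}
    (hC : ∀ S : EnrichedFunctor V B C, ∃ L c, IsWeightedLimit W S L c)
    {S : EnrichedFunctor V B M} (hS : ∀ b, HasRightValue J (S.obj b)) {L : M}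
    {c : ∀ b, W.obj b ⟶ eHom V L (S.obj b)} (h : IsWeightedLimit W S L c) :
    HasRightValue J L := by
  -- the value at `L` is the limit of the values at the `S b`
  choose R ε hε using hS
  obtain ⟨L', c', h'⟩ : ∃ (L' : C) (c' : ∀ b, W.obj b ⟶ eHom V L' (R b)),
    IsWeightedLimit W (relativeRightAdjoint J S R ε) L' c' := hC (relativeRightAdjoint J S R ε)
  obtain ⟨e, he⟩ := h.exists_lift ((h'.1.map J).postcomp (relativeCounit J S R ε))
  refine ⟨L', e, fun t => isIso_of_bijective _ fun Z g => ?_⟩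
  replace he : ∀ b, c b ≫ precomp e (S.obj b) =
      c' b ≫ adjunct J (ε b) L' := fun b =>
    (he b).trans (Category.assoc _ _ _)
  have key : ∀ (f : Z ⟶ eHom V t L') b, (f ≫ adjunct J e t) ⊙ c b =
      (f ⊙ c' b) ≫ adjunct J (ε b) t := by
    intro f b
    rw [elemComp_adjunct, adjunct, ← Category.assoc, comp_postcomp_elemComp, he]
  let m : ∀ b, eHom V (J.obj t) (S.obj b) ⟶ eHom V t (R b) := fun b => inv (adjunct J (ε b) t)
  have hm : ∀ b, m b ≫ adjunct J (ε b) t = 𝟙 _ := fun b => IsIso.inv_hom_id _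
  have hd : IsIndexedCone W (relativeRightAdjoint J S R ε) t Z (fun b => (g ⊙ c b) ≫ m b) := by
    intro a b
    change Z ◁ act W a b ≫ (g ⊙ c b) ≫ m b = (α_ _ _ _).inv ≫
      (((g ⊙ c a) ≫ m a) ⊙ relativeRightAdjointMap J S R ε a b)
    have hma := hm a
    rw [adjunct] at hma
    rw [← cancel_mono (adjunct J (ε b) t)]
    simp only [Category.assoc, hm, Category.comp_id]
    rw [elemComp_adjunct, relativeRightAdjointMap_adjunct, ← comp_postcomp_elemComp,
      Category.assoc, Category.assoc, hma, Category.comp_id]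
    exact (h.1.isIndexedCone g).eq a b
  obtain ⟨f, hf, hu⟩ := h'.2 t Z _ hd
  refine ⟨f, h.ext fun b => ?_, fun f' hf' => hu f' fun b => ?_⟩
  · rw [key]
    refine (congrArg (· ≫ adjunct J (ε b) t) (hf b)).trans ?_
    exact (Category.assoc _ _ _).trans
      ((congrArg (_ ≫ ·) (hm b)).trans (Category.comp_id _))
  · change f' ⊙ c' b = (g ⊙ c b) ≫ m b
    rw [← cancel_mono (adjunct J (ε b) t), ← key, hf', Category.assoc, hm, Category.comp_id]

/-- A `V`-functor has a right adjoint as soon as the right adjoint has a value at each object. -/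
lemma exists_adjunction_of_hasRightValue [BraidedCategory V] {J : EnrichedFunctor V C M}
    (h : ∀ X, HasRightValue J X) : ∃ R : EnrichedFunctor V M C, Nonempty (VAdjunction J R) := by
  choose R ε hε using h
  have hε' : ∀ X t, IsIso (adjunct J (X := (EnrichedFunctor.id V M).obj X) (ε X) t) := hε
  let G := relativeRightAdjoint J (EnrichedFunctor.id V M) R ε
  let m : ∀ X Y, eHom V X Y ⟶ eHom V (R X) (R Y) := fun X Y => G.map X Y
  have hm : ∀ X Y, m X Y ≫ adjunct J (ε Y) (R X) = precomp (ε X) Y := fun X Y =>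
    (relativeRightAdjointMap_adjunct J (EnrichedFunctor.id V M) R ε X Y).trans (Category.id_comp _)
  let η : ∀ t, 𝟙_ V ⟶ eHom V t (R (J.obj t)) :=
    fun t => eId V (J.obj t) ≫ inv (adjunct J (ε (J.obj t)) t)
  have hη : ∀ t, (η t ≫ J.map t (R (J.obj t))) ≫ postcomp (ε (J.obj t)) (J.obj t) =
      eId V (J.obj t) := fun t => by
    rw [Category.assoc, ← adjunct, Category.assoc, IsIso.inv_hom_id, Category.comp_id]
  -- the hom-map `M(J t, Y) ⟶ C(t, R Y)` of the adjunction is a section of the invertible `adjunct`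
  have key : ∀ t Y, (m (J.obj t) Y ≫ precomp (η t) (R Y)) ≫ adjunct J (ε Y) t = 𝟙 _ := by
    intro t Y
    rw [Category.assoc, precomp_adjunct, reassoc_of% (hm (J.obj t) Y), precomp_comp_precomp,
      comp_precomp_eq_comp_postcomp, hη, precomp_eId]
  refine ⟨G, ⟨⟨⟨η, (isNatFamily_unit_iff _).2 fun s t => ?_⟩, fun t Y => ?_⟩⟩⟩
  · change 𝟙 (eHom V s t) ≫ postcomp (η t) s =
      (J.map s t ≫ m (J.obj s) (J.obj t)) ≫ precomp (η s) (R (J.obj t))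
    rw [← cancel_mono (adjunct J (ε (J.obj t)) s), Category.assoc, Category.assoc,
      Category.assoc, ← Category.assoc (m (J.obj s) (J.obj t)), key, Category.id_comp,
      Category.comp_id, adjunct, reassoc_of% (postcomp_map J (η t) s), postcomp_comp_postcomp, hη,
      postcomp_eId, Category.comp_id]
  · have h := IsIso.inv_eq_of_inv_hom_id (key t Y)
    have h' : IsIso (m (J.obj t) Y ≫ precomp (η t) (R Y)) := by
      rw [← h]
      infer_instance
    exact h'

end RightAdjoint

section FreeCompletion

variable {V : Type u} [Category.{v} V] [MonoidalCategory V] [SymmetricCategory V]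
  [MonoidalClosed V] [HasLimits V]

/-- If `T` has `Φ`-limits, then the inclusion of `T` in its free completion under `Φ`-limits has a
right adjoint. -/
lemma exists_rightAdjoint_toFreeCompletion {Φ : WeightClass.{w} V} {T : Type v}
    [EnrichedCategory V T] (hT : HasPhiLimits Φ T) :
    ∃ R : EnrichedFunctor V (FreeCompletion Φ T) T,
      Nonempty (VAdjunction (toFreeCompletion Φ T) R) := by
  refine exists_adjunction_of_hasRightValue fun X => ?_
  have h : HasRightValue (yonedaOp T) X.obj := by
    obtain ⟨X, hX⟩ := X
    change HasRightValue (yonedaOp T) X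
    induction hX with
    | base X hX =>
      obtain ⟨t, rfl⟩ := hX
      refine ⟨t, eId V ((yonedaOp T).obj t), fun s => ?_⟩
      have h : IsIso (adjunct (yonedaOp T) (eId V ((yonedaOp T).obj t)) s) := by
        rw [adjunct_eId]
        infer_instance
      exact h
    | limit A W hW S _ L c h ih => exact HasRightValue.of_isWeightedLimit (hT A W hW) ih h
  exact h

end FreeCompletion

end EnrichedModels

end

noncomputable section

namespace EnrichedModels

/-! ### Extending functors to the free completion -/

section Extension

variable {V : Type u} [Category.{v} V] [MonoidalCategory V] [SymmetricCategory V]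
  [MonoidalClosed V] [HasLimits V]
variable {T : Type v} [EnrichedCategory V T] {Φ : WeightClass.{w} V}

variable (Φ) in
/-- The extension of `F : T → V` to the free completion: it sends `X` to `[T, V](X, F)`. -/
def freeExtension (F : EnrichedFunctor V T V) : EnrichedFunctor V (FreeCompletion Φ T) V :=
  (FullSub.ι (InFreeCompletion Φ T)).comp V (homFunctor (op F))

variable (Φ) in
/-- By the Yoneda lemma, `freeExtension Φ F` extends `F`. -/
def freeExtensionNat (F : EnrichedFunctor V T V) :
    VNat F ((toFreeCompletion Φ T).comp V (freeExtension Φ F)) where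
  app := (yonedaNat F).app
  natural a b := by
    have h : ((toFreeCompletion Φ T).comp V (freeExtension Φ F)).map a b =
        ((yonedaOp T).comp V (homFunctor (op F))).map a b :=
      congrArg ((yonedaOp T).map a b ≫ ·) (Category.id_comp _)
    rw [h]
    exact (yonedaNat F).natural a b

lemma freeExtensionNat_isIso (F : EnrichedFunctor V T V) : (freeExtensionNat Φ F).IsIso :=
  yonedaNat_isIso F

variable [HasColimits V]

/-- The closure under `Φ`-limits is closed under `Φ`-limits, so its inclusion preserves them. -/
lemma phiContinuous_ι_freeCompletion : PhiContinuous Φ (FullSub.ι (InFreeCompletion Φ T)) := by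
  intro A _ W hW S L c hc
  obtain ⟨Q, q, hq, -⟩ := (Φ.isWeight W hW).exists_colimit (S.comp V (FullSub.ι _))
  have hQ : InFreeCompletion Φ T Q :=
    LimitClosure.limit A W hW (S.comp V (FullSub.ι _)) (fun a => (S.obj a).property) Q q hq
  obtain ⟨q', hq', h⟩ := IsWeightedLimit.exists_of_map (FullSub.ι (InFreeCompletion Φ T)) hq
    (L := ⟨Q, hQ⟩) (isIsoArrow_eId Q)
  exact hq'.map_of_map hc (FullSub.ι _) (hq.of_isIsoArrow' (isIsoArrow_eId Q) fun b => (h b).symm)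

/-- A representable functor composed with the inclusion, both of which are `Φ`-continuous. -/
lemma phiContinuous_freeExtension (F : EnrichedFunctor V T V) :
    PhiContinuous Φ (freeExtension Φ F) :=
  phiContinuous_ι_freeCompletion.comp fun _ _ _ _ _ _ _ hc => hc.map_homFunctor (op F)

end Extension

/-! ### Continuous functors on the free completion are right Kan extensions -/

section Weights

variable {V : Type u} [Category.{v} V] [MonoidalCategory V] [MonoidalClosed V]
variable {B : Type w} [EnrichedCategory V B] {K : Type u₁} [EnrichedCategory V K]

/-- Weighted limits are invariant under isomorphisms of weights. -/
lemma IsWeightedLimit.of_weight_iso {W W' : EnrichedFunctor V B V} {S : EnrichedFunctor V B K}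
    {L : K} {c : ∀ b, W.obj b ⟶ eHom V L (S.obj b)} (h : IsWeightedLimit W S L c)
    (θ : ∀ b, W'.obj b ⟶ W.obj b) (hi : ∀ b, IsIso (θ b))
    (hθ : ∀ a b, act W' a b ≫ θ b = θ a ▷ _ ≫ act W a b) :
    IsWeightedLimit W' S L (fun b => θ b ≫ c b) := by
  have hθ' : ∀ a b, act W a b ≫ inv (θ b) = inv (θ a) ▷ _ ≫ act W' a b := fun a b => by
    rw [IsIso.comp_inv_eq, Category.assoc, hθ, ← comp_whiskerRight_assoc, IsIso.inv_hom_id,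
      id_whiskerRight, Category.id_comp]
  refine ⟨fun a b => ?_, fun X Z d hd => ?_⟩
  · change act W' a b ≫ θ b ≫ c b = (θ a ≫ c a) ⊙ S.map a b
    rw [reassoc_of% hθ, h.1.eq, comp_elemComp]
  · have hd' : IsIndexedCone W S X Z (fun b => Z ◁ inv (θ b) ≫ d b) := by
      intro a b
      change Z ◁ act W a b ≫ Z ◁ inv (θ b) ≫ d b =
        (α_ _ _ _).inv ≫ ((Z ◁ inv (θ a) ≫ d a) ⊙ S.map a b)
      rw [← MonoidalCategory.whiskerLeft_comp_assoc, hθ', MonoidalCategory.whiskerLeft_comp,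
        Category.assoc, hd.eq, comp_elemComp]
      simp
    obtain ⟨f, hf, hu⟩ := h.2 X Z _ hd'
    refine ⟨f, fun b => ?_, fun g hg => hu g fun b => ?_⟩
    · change f ⊙ (θ b ≫ c b) = d b
      rw [elemComp_comp]
      refine (congrArg (Z ◁ θ b ≫ ·) (hf b)).trans ?_
      rw [← MonoidalCategory.whiskerLeft_comp_assoc, IsIso.hom_inv_id,
        MonoidalCategory.whiskerLeft_id, Category.id_comp]
    · have h1 : g ⊙ (θ b ≫ c b) = d b := hg b
      change g ⊙ c b = Z ◁ inv (θ b) ≫ d b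
      rw [← h1, elemComp_comp, ← MonoidalCategory.whiskerLeft_comp_assoc, IsIso.inv_hom_id,
        MonoidalCategory.whiskerLeft_id, Category.id_comp]

/-- The Yoneda lemma: `H s` is the limit of `H` weighted by `B(s, -)`. -/
lemma isWeightedLimit_homFunctor (H : EnrichedFunctor V B K) (s : B) :
    IsWeightedLimit (homFunctor s) H (H.obj s) (fun b => H.map s b) := by
  refine ⟨fun a b => ?_, fun X Z (d : ∀ b, Z ⊗ eHom V s b ⟶ eHom V X (H.obj b)) hd => ?_⟩
  · rw [act_homFunctor]
    exact H.map_comp s a b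
  · have hs : ∀ b, (d s) ⊙ H.map s b = (α_ _ _ _).hom ≫ Z ◁ eComp V s s b ≫ d b := fun b => by
      have h : Z ◁ act (homFunctor s) s b ≫ d b =
        (α_ Z (eHom V s s) (eHom V s b)).inv ≫ (d s ⊙ H.map s b) := hd.eq s b
      rw [act_homFunctor] at h
      exact (Iso.inv_comp_eq _).1 h.symm
    have h3 : ∀ b, eId V s ▷ eHom V s b ≫ eComp V s s b = (λ_ _).hom := fun b => by
      have h := e_id_comp V s b
      rwa [Iso.inv_comp_eq, Category.comp_id] at h
    refine ⟨(ρ_ Z).inv ≫ Z ◁ eId V s ≫ d s, fun b => ?_, fun f hf => ?_⟩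
    · change ((ρ_ Z).inv ≫ Z ◁ eId V s ≫ d s) ⊙ H.map s b = d b
      have e1 : ((ρ_ Z).inv ≫ Z ◁ eId V s ≫ d s) ⊙ H.map s b =
          (ρ_ Z).inv ▷ _ ≫ (Z ◁ eId V s) ▷ _ ≫ (d s ⊙ H.map s b) := by
        rw [comp_elemComp]
        exact congrArg ((ρ_ Z).inv ▷ _ ≫ ·) (comp_elemComp (Z ◁ eId V s) (d s) (H.map s b))
      rw [e1]
      refine (congrArg (fun z => (ρ_ Z).inv ▷ _ ≫ (Z ◁ eId V s) ▷ _ ≫ z) (hs b)).trans ?_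
      rw [associator_naturality_middle_assoc, ← MonoidalCategory.whiskerLeft_comp_assoc]
      refine (congrArg (fun z => (ρ_ Z).inv ▷ _ ≫ (α_ _ _ _).hom ≫ Z ◁ z ≫ d b) (h3 b)).trans ?_
      simp
    · have h1 : f ⊙ H.map s s = d s := hf s
      have h2 : f ⊙ (eId V s ≫ H.map s s) = (ρ_ Z).hom ≫ f := by rw [H.map_id, elemComp_eId]
      rw [elemComp_comp, h1] at h2
      rw [Iso.eq_inv_comp]
      exact h2.symm

end Weights

end EnrichedModels

end

noncomputable section

namespace EnrichedModels

section JointlyEpi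

variable {V : Type u} [Category.{v} V] [MonoidalCategory V] [SymmetricCategory V]

/-- The opposite of a `V`-natural transformation. -/
def VNat.op {C : Type u₁} [EnrichedCategory V C] {D : Type u₂} [EnrichedCategory V D]
    {F G : EnrichedFunctor V C D} (α : VNat F G) : VNat (opFunctor G) (opFunctor F) where
  app a := α.app a.unop
  natural := α.natural.op

lemma VNat.IsIso.op {C : Type u₁} [EnrichedCategory V C] {D : Type u₂} [EnrichedCategory V D]
    {F G : EnrichedFunctor V C D} {α : VNat F G} (h : α.IsIso) : α.op.IsIso :=
  fun a => (isIsoArrow_op_iff (α.app a.unop)).2 (h a.unop)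

variable [MonoidalClosed V]

/-- If `K(Y, -)` preserves a colimit `C` then the composition maps `K(Y, S b) ⊗ W b ⟶ K(Y, C)` are
jointly epimorphic, in the enriched sense. -/
lemma jointly_epi_of_isWeightedLimit {B : Type w} [EnrichedCategory V B] {K : Type u₁}
    [EnrichedCategory V K] {W : EnrichedFunctor V B V} {S : EnrichedFunctor V B Kᵒᵖ} {C : K}
    {c : ∀ b, W.obj b ⟶ eHom V (S.obj b).unop C} (Y : K)
    (h : IsWeightedLimit W (S.comp V (opFunctor (homFunctor Y))) (op (eHom V Y C))
      (fun b => c b ≫ (homFunctor Y).map (S.obj b).unop C))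
    {P Q : V} {x y : P ⊗ eHom V Y C ⟶ Q}
    (hxy : ∀ b, P ◁ (𝟙 (eHom V Y (S.obj b).unop) ⊙ c b) ≫ x =
      P ◁ (𝟙 (eHom V Y (S.obj b).unop) ⊙ c b) ≫ y) : x = y := by
  have key : ∀ (z : P ⊗ eHom V Y C ⟶ Q) (b : B),
      elemComp (K := Vᵒᵖ) (X := op Q) (Y := op (eHom V Y C))
        (Z := op (eHom V Y (S.obj b).unop)) (curry ((β_ _ _).hom ≫ z))
        (c b ≫ (homFunctor Y).map (S.obj b).unop C) =
      (β_ _ _).hom ≫ curry ((α_ _ _ _).inv ≫ (β_ _ _).hom ≫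
        P ◁ (𝟙 (eHom V Y (S.obj b).unop) ⊙ c b) ≫ z) := by
    intro z b
    refine (elemComp_op (X := Q) (Y := eHom V Y C) _ _).trans (congrArg (_ ≫ ·) ?_)
    apply uncurry_injective
    have e1 : uncurry (c b ≫ curry (eComp V Y (S.obj b).unop C)) =
        𝟙 (eHom V Y (S.obj b).unop) ⊙ c b := by
      rw [uncurry_comp_left, uncurry_curry, elemComp, id_tensorHom]
    refine (uncurry_elemComp (c b ≫ curry (eComp V Y (S.obj b).unop C))
      (curry ((β_ _ _).hom ≫ z))).trans ?_
    rw [e1, uncurry_curry, uncurry_curry, braiding_naturality_left_assoc]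
  have h1 : curry ((β_ _ _).hom ≫ x) = curry ((β_ _ _).hom ≫ y) :=
    IsWeightedLimit.ext (X := op Q) h fun b => by
      refine (key x b).trans (Eq.trans ?_ (key y b).symm)
      rw [hxy]
  exact (cancel_epi _).1 (curry_injective h1)

variable [HasLimits V] [HasColimits V] {T : Type v} [EnrichedCategory V T]
  {Φ : WeightClass.{w} V}

/-- Colimit cocones in `[T, V]` remain jointly epimorphic under `[T, V](T(t, -), -)`, because this
representable is evaluation at `t`, which preserves colimits. -/
lemma functorCategory_jointly_epi {A : Type w} [EnrichedCategory V A]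
    {W : EnrichedFunctor V Aᵒᵖ V} (hW : IsWeight W)
    {S : EnrichedFunctor V Aᵒᵖ (EnrichedFunctor V T V)ᵒᵖ} {L : EnrichedFunctor V T V}
    {c : ∀ a, W.obj a ⟶ eHom V (S.obj a).unop L} (h : IsWeightedLimit W S (op L) c) (t : T)
    {P Q : V} {x y : P ⊗ eHom V (homFunctor t) L ⟶ Q}
    (hxy : ∀ a, P ◁ (𝟙 (eHom V (homFunctor t) (S.obj a).unop) ⊙ c a) ≫ x =
      P ◁ (𝟙 (eHom V (homFunctor t) (S.obj a).unop) ⊙ c a) ≫ y) : x = y := by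
  have h2 := hW.map_evalAt_op h t
  have h3 : IsWeightedLimit W (S.comp V (opFunctor (homFunctor (homFunctor t))))
      ((opFunctor (homFunctor (homFunctor t))).obj (op L))
      (fun a => c a ≫ (opFunctor (homFunctor (homFunctor t))).map (op L) (S.obj a)) :=
    IsWeightedLimit.map_of_iso (VNat.op (evalNat (V := V) t)) (evalNat_isIso t).op c h2
  exact jointly_epi_of_isWeightedLimit (K := EnrichedFunctor V T V) (homFunctor t) h3 hxy

/-- For a `Φ`-limit `L` of `S` in the free completion, the composition maps
`W a ⊗ FT(S a, t) ⟶ FT(L, t)` are jointly epimorphic, in the enriched sense. -/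
lemma freeCompletion_jointly_epi {A : Type w} [EnrichedCategory V A]
    {W : EnrichedFunctor V Aᵒᵖ V} (hW : Φ.mem W) {S : EnrichedFunctor V Aᵒᵖ (FreeCompletion Φ T)}
    {L : FreeCompletion Φ T} {c : ∀ a, W.obj a ⟶ eHom V L (S.obj a)}
    (h : IsWeightedLimit W S L c) (t : T) {P Q : V}
    {x y : P ⊗ eHom V L ((toFreeCompletion Φ T).obj t) ⟶ Q}
    (hxy : ∀ a, P ◁ (c a ⊙ 𝟙 (eHom V (S.obj a) ((toFreeCompletion Φ T).obj t))) ≫ x =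
      P ◁ (c a ⊙ 𝟙 (eHom V (S.obj a) ((toFreeCompletion Φ T).obj t))) ≫ y) : x = y := by
  have h1 : IsWeightedLimit W (S.comp V (FullSub.ι (InFreeCompletion Φ T))) (op L.obj.unop) c :=
    (phiContinuous_ι_freeCompletion A W hW S L c h).of_eq fun a => Category.comp_id (c a)
  refine functorCategory_jointly_epi (Φ.isWeight W hW) h1 t fun a => ?_
  have e : elemComp (c a) (𝟙 (eHom V (S.obj a) ((toFreeCompletion Φ T).obj t))) =
      (β_ _ _).hom ≫ elemComp (K := EnrichedFunctor V T V) (X := homFunctor t)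
        (Y := (S.obj a).obj.unop) (Z := L.obj.unop)
        (𝟙 (eHom V (homFunctor t) (S.obj a).obj.unop)) (c a) :=
    elemComp_op (K := EnrichedFunctor V T V) (X := L.obj.unop) (Y := (S.obj a).obj.unop)
      (Z := homFunctor t) (c a) (𝟙 (eHom V (homFunctor t) (S.obj a).obj.unop))
  have h4 : ∀ z : P ⊗ eHom V L ((toFreeCompletion Φ T).obj t) ⟶ Q,
      P ◁ elemComp (K := EnrichedFunctor V T V) (X := homFunctor t)
        (Y := (S.obj a).obj.unop) (Z := L.obj.unop)
        (𝟙 (eHom V (homFunctor t) (S.obj a).obj.unop)) (c a) ≫ z =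
      P ◁ (β_ _ _).inv ≫ P ◁ (c a ⊙ 𝟙 (eHom V (S.obj a) ((toFreeCompletion Φ T).obj t))) ≫ z := by
    intro z
    have h5 := congrArg (fun f => P ◁ f ≫ z) ((Iso.eq_inv_comp _).2 e.symm)
    refine h5.trans ?_
    exact (congrArg (· ≫ z) (MonoidalCategory.whiskerLeft_comp _ _ _)).trans (Category.assoc _ _ _)
  exact (h4 x).trans ((congrArg (_ ≫ ·) (hxy a)).trans (h4 y).symm)

end JointlyEpi

section Density

variable {V : Type u} [Category.{v} V] [MonoidalCategory V] [MonoidalClosed V]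
variable {C : Type w} [EnrichedCategory V C] {M : Type u₁} [EnrichedCategory V M]
  {D : Type u₂} [EnrichedCategory V D]

lemma act_comp_homFunctor (J : EnrichedFunctor V C M) (X : M) (s t : C) :
    act (J.comp V (homFunctor X)) s t = 𝟙 (eHom V X (J.obj s)) ⊙ J.map s t := by
  refine (uncurry_comp_left (J.map s t) (curry (eComp V X (J.obj s) (J.obj t)))).trans ?_
  rw [uncurry_curry, elemComp, id_tensorHom]

/-- `E` is at `X` the pointwise right Kan extension of its restriction along `J`. -/
def IsRightKanAt (J : EnrichedFunctor V C M) (E : EnrichedFunctor V M D) (X : M) : Prop :=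
  IsWeightedLimit (J.comp V (homFunctor X)) (J.comp V E) (E.obj X) (fun t => E.map X (J.obj t))

lemma isRightKanAt_iff (J : EnrichedFunctor V C M) (E : EnrichedFunctor V M D) (X : M) :
    IsRightKanAt J E X ↔
      ∀ (Y : D) (Z : V) (d : ∀ t, Z ⊗ eHom V X (J.obj t) ⟶ eHom V Y (E.obj (J.obj t))),
      (∀ s t, Z ◁ (𝟙 (eHom V X (J.obj s)) ⊙ J.map s t) ≫ d t =
        (α_ _ _ _).inv ≫ (d s ⊙ (J.map s t ≫ E.map (J.obj s) (J.obj t)))) →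
      ∃! f : Z ⟶ eHom V Y (E.obj X), ∀ t, f ⊙ E.map X (J.obj t) = d t := by
  have hc : IsWeightedCone (J.comp V (homFunctor X)) (J.comp V E) (E.obj X)
      (fun t => E.map X (J.obj t)) := by
    intro s t
    rw [act_comp_homFunctor]
    refine (elemComp_map E (𝟙 (eHom V X (J.obj s))) (J.map s t)).trans ?_
    rw [Category.id_comp]
    rfl
  refine (and_iff_right hc).trans (forall₃_congr fun Y Z d => imp_congr ?_ Iff.rfl)
  exact forall₂_congr fun s t =>
    Eq.congr (congrArg (fun z => Z ◁ z ≫ d t) (act_comp_homFunctor J X s t)) rfl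

/-- Every `V`-functor is at `J s` the right Kan extension of its restriction along a fully faithful
`J`. -/
lemma isRightKanAt_obj (J : EnrichedFunctor V C M) [∀ s t, IsIso (J.map s t)]
    (E : EnrichedFunctor V M D) (s : C) : IsRightKanAt J E (J.obj s) := by
  have h := isWeightedLimit_homFunctor (J.comp V E) s
  let θ : ∀ t, eHom V (J.obj s) (J.obj t) ⟶ eHom V s t := fun t => inv (J.map s t)
  have hθ : ∀ t, IsIso (θ t) := fun t => inferInstanceAs (IsIso (inv (J.map s t)))
  have hθJ : ∀ t, θ t ≫ J.map s t = 𝟙 _ := fun t => IsIso.inv_hom_id _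
  have e : ∀ a b, (𝟙 (eHom V (J.obj s) (J.obj a)) ⊙ J.map a b) ≫ θ b =
      θ a ▷ eHom V a b ≫ eComp V s a b := fun a b => by
    have e1 : eComp V s a b ≫ J.map s b = J.map s a ⊙ J.map a b := J.map_comp s a b
    rw [← cancel_mono (J.map s b), Category.assoc, Category.assoc, hθJ, e1, ← comp_elemComp, hθJ,
      Category.comp_id]
  have h' := h.of_weight_iso (W' := J.comp V (homFunctor (J.obj s))) θ hθ fun a b => by
    rw [act_comp_homFunctor, act_homFunctor]
    exact e a b
  exact h'.of_eq fun t => (Category.assoc _ _ _).symm.trans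
    ((congrArg (· ≫ E.map (J.obj s) (J.obj t)) (hθJ t)).trans (Category.id_comp _))

/-- The objects at which `E` is the right Kan extension of its restriction along `J` are closed
under the limits that `E` preserves and the functors `M(-, J t)` turn into colimits. Of the latter,
only the joint epimorphy of the cocone is used. -/
lemma IsRightKanAt.of_isWeightedLimit {J : EnrichedFunctor V C M} {E : EnrichedFunctor V M D}
    {A : Type w₁} [EnrichedCategory V A] {W : EnrichedFunctor V A V} {S : EnrichedFunctor V A M}
    {L : M} {c : ∀ a, W.obj a ⟶ eHom V L (S.obj a)} (hc : IsWeightedCone W S L c)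
    (hE : IsWeightedLimit W (S.comp V E) (E.obj L) (fun a => c a ≫ E.map L (S.obj a)))
    (hS : ∀ a, IsRightKanAt J E (S.obj a))
    (hJ : ∀ (t : C) {P Q : V} (x y : P ⊗ eHom V L (J.obj t) ⟶ Q),
      (∀ a, P ◁ (c a ⊙ 𝟙 (eHom V (S.obj a) (J.obj t))) ≫ x =
        P ◁ (c a ⊙ 𝟙 (eHom V (S.obj a) (J.obj t))) ≫ y) → x = y) :
    IsRightKanAt J E L := by
  rw [isRightKanAt_iff]
  intro Y Z d hd
  -- restriction along `c` turns `f ⊙ E.map L (J t)` into an expression at `S a`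
  have key : ∀ (f : Z ⟶ eHom V Y (E.obj L)) a t,
      (f ⊙ (c a ≫ E.map L (S.obj a))) ⊙ E.map (S.obj a) (J.obj t) = (α_ _ _ _).hom ≫
        Z ◁ (c a ⊙ 𝟙 (eHom V (S.obj a) (J.obj t))) ≫ (f ⊙ E.map L (J.obj t)) := by
    intro f a t
    rw [elemComp_assoc, ← elemComp_comp, elemComp_map, Category.id_comp]
  -- the restriction of `d` to `S a` is given by a unique `g a`, by the Kan property at `S a`
  have hg : ∀ a, ∃! g : Z ⊗ W.obj a ⟶ eHom V Y (E.obj (S.obj a)),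
      ∀ t, g ⊙ E.map (S.obj a) (J.obj t) =
        (α_ _ _ _).hom ≫ Z ◁ (c a ⊙ 𝟙 (eHom V (S.obj a) (J.obj t))) ≫ d t := by
    intro a
    refine (isRightKanAt_iff J E (S.obj a)).1 (hS a) Y (Z ⊗ W.obj a) _ fun s t => ?_
    have e1 : W.obj a ◁ (𝟙 (eHom V (S.obj a) (J.obj s)) ⊙ J.map s t) ≫
        (c a ⊙ 𝟙 (eHom V (S.obj a) (J.obj t))) = (α_ _ _ _).inv ≫
          (c a ⊙ 𝟙 (eHom V (S.obj a) (J.obj s))) ▷ _ ≫ (𝟙 (eHom V L (J.obj s)) ⊙ J.map s t) := by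
      rw [← elemComp_comp, ← comp_elemComp, Category.comp_id, Category.comp_id, elemComp_assoc']
    rw [associator_naturality_right_assoc, ← MonoidalCategory.whiskerLeft_comp_assoc, e1,
      comp_elemComp, comp_elemComp]
    simp only [MonoidalCategory.whiskerLeft_comp, Category.assoc]
    rw [hd]
    simp
  choose g hg hgu using hg
  have hgc : IsIndexedCone W (S.comp V E) Y Z g := by
    intro a b
    change Z ◁ act W a b ≫ g b =
      (α_ _ _ _).inv ≫ (g a ⊙ (S.map a b ≫ E.map (S.obj a) (S.obj b)))
    refine IsWeightedLimit.ext (hS b) fun t => ?_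
    refine (comp_elemComp (Z ◁ act W a b) (g b) (E.map (S.obj b) (J.obj t))).trans ?_
    refine (congrArg ((Z ◁ act W a b) ▷ _ ≫ ·) (hg b t)).trans ?_
    have e2 : act W a b ▷ _ ≫ (c b ⊙ 𝟙 (eHom V (S.obj b) (J.obj t))) = (α_ _ _ _).hom ≫
        W.obj a ◁ (S.map a b ⊙ 𝟙 (eHom V (S.obj b) (J.obj t))) ≫
          (c a ⊙ 𝟙 (eHom V (S.obj a) (J.obj t))) := by
      rw [← comp_elemComp, hc.eq, elemComp_assoc, ← elemComp_comp, Category.comp_id]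
    have e3 : (g a ⊙ (S.map a b ≫ E.map (S.obj a) (S.obj b))) ⊙ E.map (S.obj b) (J.obj t) =
        (α_ _ _ _).hom ≫ _ ◁ (S.map a b ⊙ 𝟙 (eHom V (S.obj b) (J.obj t))) ≫
          (g a ⊙ E.map (S.obj a) (J.obj t)) := by
      rw [elemComp_assoc, ← elemComp_comp, elemComp_map, Category.id_comp]
    refine Eq.trans ?_ (comp_elemComp _ _ _).symm
    rw [e3, hg, associator_naturality_middle_assoc, ← MonoidalCategory.whiskerLeft_comp_assoc, e2]
    simp
  -- the `g a` form a cone, which factors through the limit `E L`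
  obtain ⟨f, hf, hfu⟩ := hE.2 Y Z g hgc
  refine ⟨f, fun t => hJ t _ _ fun a => ?_, fun f' hf' => hfu f' fun a => hgu a _ fun t => ?_⟩
  · rw [← cancel_epi (α_ _ _ _).hom, ← key, ← hg a t]
    exact congrArg (· ⊙ E.map (S.obj a) (J.obj t)) (hf a)
  · rw [← hf' t]
    exact key f' a t

end Density

section DensityFree

/-- The factorization of a `V`-functor through a full sub-`V`-category. -/
def FullSub.lift {V : Type u} [Category.{v} V] [MonoidalCategory V] {B : Type u₁}
    [EnrichedCategory V B] {K : Type u₂} [EnrichedCategory V K] {P : K → Prop}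
    (S : EnrichedFunctor V B K) (hS : ∀ b, P (S.obj b)) : EnrichedFunctor V B (FullSub P) where
  obj b := ⟨S.obj b, hS b⟩
  map a b := S.map a b
  map_id a := S.map_id a
  map_comp a b c := S.map_comp a b c

variable {V : Type u} [Category.{v} V] [MonoidalCategory V] [SymmetricCategory V]
  [MonoidalClosed V] [HasLimits V] {T : Type v} [EnrichedCategory V T]
  {Φ : WeightClass.{w} V}

instance (s t : T) : IsIso ((toFreeCompletion Φ T).map s t) :=
  inferInstanceAs (IsIso ((yonedaOp T).map s t))

/-- A `Φ`-continuous functor on the free completion of `T` is the right Kan extension of its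
restriction to `T`. -/
lemma isRightKanAt_of_phiContinuous [HasColimits V] {D : Type u₂} [EnrichedCategory V D]
    {E : EnrichedFunctor V (FreeCompletion Φ T) D}
    (hE : PhiContinuous Φ E) (X : FreeCompletion Φ T) :
    IsRightKanAt (toFreeCompletion Φ T) E X := by
  obtain ⟨X, hX⟩ := X
  induction hX with
  | base X hX =>
    obtain ⟨s, rfl⟩ := hX
    exact isRightKanAt_obj (toFreeCompletion Φ T) E s
  | limit A W hW S hS L c h ih =>
    have h' : IsWeightedLimit W (FullSub.lift S hS) ⟨L, .limit A W hW S hS L c h⟩ c :=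
      IsWeightedLimit.of_map (FullSub.ι (InFreeCompletion Φ T))
        (h.of_map_eq (fun _ _ => (Category.comp_id _).symm) fun _ => (Category.comp_id _).symm)
    exact IsRightKanAt.of_isWeightedLimit h'.1 (hE A W hW _ _ _ h') ih
      fun t _ _ _ _ hxy => freeCompletion_jointly_epi hW h' t hxy

end DensityFree

end EnrichedModels

end

noncomputable section

namespace EnrichedModels

/-! ### Families of transformations and Kan extensions -/

section Families

variable {V : Type u} [Category.{v} V] [MonoidalCategory V] [SymmetricCategory V]
  [MonoidalClosed V]
variable {C : Type w} [EnrichedCategory V C] {M : Type u₁} [EnrichedCategory V M]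
  {D : Type u₂} [EnrichedCategory V D]

/-- Families of transformations into a right Kan extension along `J` are determined by their
restrictions along `J`. -/
lemma IsNatFamily.existsUnique_extension {J : EnrichedFunctor V C M}
    [∀ s t, IsIso (J.map s t)] {E E' : EnrichedFunctor V M D}
    (hE' : ∀ X, IsRightKanAt J E' X) {Z : V}
    {g : ∀ t, Z ⟶ eHom V (E.obj (J.obj t)) (E'.obj (J.obj t))}
    (hg : IsNatFamily (J.comp V E) (J.comp V E') Z g) :
    ∃! f : ∀ X, Z ⟶ eHom V (E.obj X) (E'.obj X), IsNatFamily E E' Z f ∧ ∀ t, f (J.obj t) = g t := by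
  have hg' : ∀ s t, (β_ Z (eHom V s t)).hom ≫ ((J.map s t ≫ E.map _ _) ⊙ g t) =
      g s ⊙ (J.map s t ≫ E'.map _ _) := fun s t => hg s t
  have hd : ∀ X, ∃! f : Z ⟶ eHom V (E.obj X) (E'.obj X), ∀ t,
      f ⊙ E'.map X (J.obj t) = (β_ _ _).hom ≫ (E.map X (J.obj t) ⊙ g t) := by
    intro X
    refine (isRightKanAt_iff J E' X).1 (hE' X) (E.obj X) Z _ fun s t => ?_
    have e1 : (E.map X (J.obj s) ⊙ g s) ⊙ (J.map s t ≫ E'.map (J.obj s) (J.obj t)) =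
        (α_ _ _ _).hom ≫ _ ◁ (β_ _ _).hom ≫ (α_ _ _ _).inv ≫
          ((E.map X (J.obj s) ⊙ (J.map s t ≫ E.map (J.obj s) (J.obj t))) ⊙ g t) := by
      rw [elemComp_assoc, ← hg', elemComp_comp, elemComp_assoc (E.map X (J.obj s)),
        Iso.inv_hom_id_assoc]
    rw [comp_elemComp, e1, braiding_naturality_right_assoc, ← comp_elemComp, elemComp_map,
      Category.id_comp, braiding_tensor_right_hom]
    simp only [Category.assoc]
  choose f hf hfu using hd
  -- at `J t`, the family `g t` has the defining property of `f (J t)`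
  have hJ : ∀ t, f (J.obj t) = g t := by
    intro t
    refine ((hfu (J.obj t) (g t) fun s => ?_)).symm
    rw [← cancel_epi (Z ◁ J.map t s), ← elemComp_comp, ← hg',
      braiding_naturality_right_assoc, ← comp_elemComp]
  refine ⟨f, ⟨fun X Y => ?_, hJ⟩, fun f' hf' => funext fun X => hfu X _ fun t => ?_⟩
  · refine IsWeightedLimit.ext (hE' Y) fun t => ?_
    change ((β_ Z (eHom V X Y)).hom ≫ (E.map X Y ⊙ f Y)) ⊙ E'.map Y (J.obj t) =
      (f X ⊙ E'.map X Y) ⊙ E'.map Y (J.obj t)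
    have e1 : E'.map X Y ⊙ E'.map Y (J.obj t) = eComp V X Y (J.obj t) ≫ E'.map X (J.obj t) :=
      (E'.map_comp X Y (J.obj t)).symm
    have e2 : E.map X Y ⊙ E.map Y (J.obj t) = eComp V X Y (J.obj t) ≫ E.map X (J.obj t) :=
      (E.map_comp X Y (J.obj t)).symm
    rw [comp_elemComp, elemComp_assoc, hf, elemComp_comp, elemComp_assoc', e2, elemComp_assoc,
      e1, elemComp_comp, hf, braiding_naturality_right_assoc, ← comp_elemComp]
    rw [← Iso.inv_comp_eq, braiding_tensor_right_hom]
    simp only [Category.assoc]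
  · rw [← hf'.2 t]
    exact (hf'.1 X (J.obj t)).symm

end Families

section LeftKan

variable {V : Type u} [Category.{v} V] [MonoidalCategory V] [SymmetricCategory V]
  [MonoidalClosed V]
variable {A : Type u₁} [EnrichedCategory V A] {B : Type u₂} [EnrichedCategory V B]
  {D : Type u₃} [EnrichedCategory V D]

/-- The universal property of a left Kan extension, for families of transformations. -/
lemma IsLeftKan.existsUnique_family {K : EnrichedFunctor V A B} {F : EnrichedFunctor V A D}
    {L : EnrichedFunctor V B D} {η : VNat F (K.comp V L)} (h : IsLeftKan K F L η)
    {M : EnrichedFunctor V B D} {Z : V} {g : ∀ a, Z ⟶ eHom V (F.obj a) (M.obj (K.obj a))}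
    (hg : IsNatFamily F (K.comp V M) Z g) :
    ∃! f : ∀ b, Z ⟶ eHom V (L.obj b) (M.obj b), IsNatFamily L M Z f ∧
      ∀ a, f (K.obj a) ≫ precomp (η.app a) (M.obj (K.obj a)) = g a := by
  have hg' : ∀ a a', (β_ Z (eHom V a a')).hom ≫ (F.map a a' ⊙ g a') =
      g a ⊙ (K.map a a' ≫ M.map (K.obj a) (K.obj a')) := fun a a' => hg a a'
  -- the cocone on `F` with vertex `L b`
  let c : ∀ a b, eHom V (K.obj a) b ⟶ eHom V (F.obj a) (L.obj b) :=
    fun a b => L.map (K.obj a) b ≫ precomp (η.app a) (L.obj b)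
  -- generalized elements out of the colimit `L b` are determined by their restrictions
  have hc : ∀ b (Y : D) (P : V) (x y : P ⟶ eHom V (L.obj b) Y),
      (∀ a, c a b ⊙ x = c a b ⊙ y) → x = y := fun b Y P x y hxy =>
    IsWeightedLimit.ext (X := op Y) (h b) fun a =>
      (elemComp_op (X := Y) (Y := L.obj b) x (c a.unop b)).trans
        ((congrArg ((β_ _ _).hom ≫ ·) (hxy a.unop)).trans
          (elemComp_op (X := Y) (Y := L.obj b) y (c a.unop b)).symm)
  have hd : ∀ b, ∃! f : Z ⟶ eHom V (L.obj b) (M.obj b), ∀ a,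
      (β_ _ _).hom ≫ (c a b ⊙ f) = g a ⊙ M.map (K.obj a) b := by
    intro b
    have hcone : IsIndexedCocone ((opFunctor K).comp V (homFunctor (op b))) (opFunctor F) (M.obj b)
        Z (fun a => g a.unop ⊙ M.map (K.obj a.unop) b) := by
      intro a a'
      have e1 : act ((opFunctor K).comp V (homFunctor (op b))) a a' = (β_ _ _).hom ≫
          (K.map a'.unop a.unop ⊙ 𝟙 (eHom V (K.obj a.unop) b)) :=
        act_comp_homFunctor_op (opFunctor K) b a a'
      have e2 : ∀ s t, Z ◁ (K.map s t ⊙ 𝟙 (eHom V (K.obj t) b)) ≫ (g s ⊙ M.map (K.obj s) b) =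
          (α_ _ _ _).inv ≫ (β_ _ _).hom ▷ _ ≫ (α_ _ _ _).hom ≫
            (F.map s t ⊙ (g t ⊙ M.map (K.obj t) b)) := fun s t => by
        rw [← elemComp_comp, elemComp_map, Category.id_comp, elemComp_assoc', ← hg', comp_elemComp,
          elemComp_assoc]
      have e3 : Z ◁ (β_ (eHom V (K.obj a.unop) b) (eHom V a'.unop a.unop)).hom ≫
          Z ◁ (K.map a'.unop a.unop ⊙ 𝟙 (eHom V (K.obj a.unop) b)) ≫
            (g a'.unop ⊙ M.map (K.obj a'.unop) b) = (α_ _ _ _).inv ≫ (β_ _ _).hom ≫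
            (F.map a'.unop a.unop ⊙ (g a.unop ⊙ M.map (K.obj a.unop) b)) := by
        rw [e2, braiding_tensor_left_hom]
        simp only [Category.assoc, Iso.inv_hom_id_assoc]
      refine (congrArg (fun z => Z ◁ z ≫ (g a'.unop ⊙ M.map (K.obj a'.unop) b)) e1).trans ?_
      refine Eq.trans ?_ e3
      exact (congrArg (· ≫ _) (MonoidalCategory.whiskerLeft_comp _ _ _)).trans
        (Category.assoc _ _ _)
    obtain ⟨f, hf, hfu⟩ := ((isWeightedLimit_op_iff _).1 (h b)).2 (M.obj b) Z _ hcone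
    exact ⟨f, fun a => hf (op a), fun f' hf' => hfu f' fun a => hf' a.unop⟩
  choose f hf hfu using hd
  have hcf : ∀ a b, c a b ⊙ f b = (β_ _ _).hom ≫ (g a ⊙ M.map (K.obj a) b) := fun a b => by
    rw [← hf, SymmetricCategory.symmetry_assoc]
  refine ⟨f, ⟨fun b b' => ?_, fun a => ?_⟩, fun f' hf' => funext fun b => hfu b _ fun a => ?_⟩
  · change (β_ _ _).hom ≫ (L.map b b' ⊙ f b') = f b ⊙ M.map b b'
    refine hc b _ _ _ _ fun a => ?_
    have e1 : c a b ⊙ L.map b b' = eComp V (K.obj a) b b' ≫ c a b' := by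
      have e : eComp V (K.obj a) b b' ≫ L.map (K.obj a) b' = L.map (K.obj a) b ⊙ L.map b b' :=
        L.map_comp _ _ _
      exact (comp_precomp_elemComp (X := L.obj (K.obj a)) (η.app a) (L.map (K.obj a) b)
        (L.map b b')).trans ((congrArg
          (· ≫ precomp (Y := L.obj (K.obj a)) (η.app a) (L.obj b')) e.symm).trans
            (Category.assoc _ _ _))
    have e2 : M.map (K.obj a) b ⊙ M.map b b' = eComp V (K.obj a) b b' ≫ M.map (K.obj a) b' :=
      (M.map_comp _ _ _).symm
    rw [elemComp_comp, elemComp_assoc', e1, comp_elemComp, hcf, elemComp_assoc' (c a b), hcf,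
      comp_elemComp, elemComp_assoc, e2, elemComp_comp, braiding_naturality_left_assoc,
      braiding_tensor_left_hom]
    simp only [Category.assoc, Iso.inv_hom_id_assoc]
    rw [← MonoidalCategory.whiskerLeft_comp_assoc, SymmetricCategory.symmetry,
      MonoidalCategory.whiskerLeft_id, Category.id_comp]
  -- the value at `K a` restricts along `η` to `g a`: evaluate the defining property at `eId (K a)`
  · have e1 : eId V (K.obj a) ≫ c a (K.obj a) = η.app a :=
      (Category.assoc _ _ _).symm.trans ((congrArg
        (· ≫ precomp (Y := L.obj (K.obj a)) (η.app a) _) (L.map_id (K.obj a))).trans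
          (eId_precomp (Y := L.obj (K.obj a)) (η.app a)))
    refine (comp_precomp (Y := L.obj (K.obj a)) (η.app a) (f (K.obj a))).trans ?_
    have e2 : elemComp (Y := L.obj (K.obj a)) (η.app a) (f (K.obj a)) =
        (β_ _ _).hom ≫ (ρ_ _).hom ≫ g a := by
      rw [← elemComp_eId, ← M.map_id, elemComp_comp, ← braiding_naturality_left_assoc, ← hcf, ← e1,
        comp_elemComp]
    refine (congrArg ((λ_ Z).inv ≫ ·) e2).trans ?_
    rw [braiding_tensorUnit_left]
    simp
  · have h1 := hf'.1.eq (K.obj a) b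
    have h2 : c a b ⊙ f' b = (L.map (K.obj a) b ⊙ f' b) ≫ precomp (η.app a) (M.obj b) :=
      comp_precomp_elemComp _ _ _
    have h3 := congrArg (· ≫ precomp (η.app a) (M.obj b)) h1
    refine (congrArg ((β_ _ _).hom ≫ ·) h2).trans ((Category.assoc _ _ _).symm.trans
      (h3.trans ?_))
    rw [← hf'.2]
    exact (comp_precomp_elemComp _ _ _).symm

end LeftKan

end EnrichedModels

end

noncomputable section

namespace EnrichedModels

/-! ### A small model of the free completion -/

section Small

variable {V : Type u} [Category.{v} V] [MonoidalCategory V]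

lemma IsIsoArrow.exists_inv {K : Type u₁}
    [EnrichedCategory V K] {X Y : K} {f : 𝟙_ V ⟶ eHom V X Y} (h : IsIsoArrow f) :
    ∃ g : 𝟙_ V ⟶ eHom V Y X, IsIsoArrow g ∧ f ≫ postcomp g X = eId V X ∧
      g ≫ postcomp f Y = eId V Y := by
  obtain ⟨g, h1, h2⟩ := (isIsoArrow_iff f).1 h
  exact ⟨g, (isIsoArrow_iff g).2 ⟨f, h2, h1⟩, h1, h2⟩

/-- An arrow of a full sub-`V`-category is invertible if it is so in the ambient one. -/
lemma isIsoArrow_fullSub_iff {K : Type u₁}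
    [EnrichedCategory V K] {P : K → Prop} {X Y : FullSub P} (f : 𝟙_ V ⟶ eHom V X.obj Y.obj) :
    IsIsoArrow (X := X) (Y := Y) f ↔ IsIsoArrow f := by
  rw [isIsoArrow_iff, isIsoArrow_iff]
  rfl

lemma IsIsoArrow.comp {K : Type u₁} [EnrichedCategory V K] {X Y Z : K}
    {f : 𝟙_ V ⟶ eHom V X Y} (hf : IsIsoArrow f) {g : 𝟙_ V ⟶ eHom V Y Z} (hg : IsIsoArrow g) :
    IsIsoArrow (f ≫ postcomp g X) := by
  obtain ⟨f', -, hf', hf''⟩ := hf.exists_inv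
  obtain ⟨g', -, hg', hg''⟩ := hg.exists_inv
  refine (isIsoArrow_iff _).2 ⟨g' ≫ postcomp f' Z, ?_, ?_⟩
  · rw [← postcomp_comp_postcomp, Category.assoc, ← Category.assoc (postcomp g X),
      postcomp_comp_postcomp, hg', postcomp_eId, Category.id_comp, hf']
  · rw [← postcomp_comp_postcomp, Category.assoc, ← Category.assoc (postcomp f' Z),
      postcomp_comp_postcomp, hf'', postcomp_eId, Category.id_comp, hg'']

/-- The `V`-category with objects `ι` and the hom-objects induced by `y : ι → K`. -/
structure Induced {ι : Type w} {K : Type u₁} (y : ι → K) where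
  index : ι

instance {ι : Type w} {K : Type u₁} [EnrichedCategory V K] (y : ι → K) :
    EnrichedCategory V (Induced y) where
  Hom a b := eHom V (y a.index) (y b.index)
  id a := eId V (y a.index)
  comp a b c := eComp V (y a.index) (y b.index) (y c.index)
  id_comp a b := e_id_comp V (y a.index) (y b.index)
  comp_id a b := e_comp_id V (y a.index) (y b.index)
  assoc a b c d := e_assoc V (y a.index) (y b.index) (y c.index) (y d.index)

/-- The fully faithful `V`-functor from the induced `V`-category. -/
def Induced.functor {ι : Type w} {K : Type u₁} [EnrichedCategory V K] (y : ι → K) :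
    EnrichedFunctor V (Induced y) K where
  obj a := y a.index
  map _ _ := 𝟙 _
  map_id _ := Category.comp_id _
  map_comp a b c := by
    rw [Category.comp_id, id_tensorHom_id, Category.id_comp]
    rfl

instance {ι : Type w} {K : Type u₁} [EnrichedCategory V K] (y : ι → K) (a b : Induced y) :
    IsIso ((Induced.functor (V := V) y).map a b) :=
  inferInstanceAs (IsIso (𝟙 (eHom V (y a.index) (y b.index))))

end Small

section EssSurj

variable {V : Type u} [Category.{v} V] [MonoidalCategory V] [BraidedCategory V] [MonoidalClosed V]

/-- The existence of `Φ`-limits is invariant under equivalence. -/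
lemma HasPhiLimits.of_essSurj {K : Type u₁} [EnrichedCategory V K] {A : Type u₂}
    [EnrichedCategory V A] (I : EnrichedFunctor V A K) [∀ a b, IsIso (I.map a b)]
    (hI : ∀ Y, ∃ (a : A) (e : 𝟙_ V ⟶ eHom V Y (I.obj a)), IsIsoArrow e)
    {Φ : WeightClass.{w} V} (hK : HasPhiLimits Φ K) : HasPhiLimits Φ A := by
  intro B _ W hW S
  obtain ⟨L, c, hc⟩ := hK B W hW (S.comp V I)
  obtain ⟨a, e, he⟩ := hI L
  obtain ⟨e', he', -⟩ := he.exists_inv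
  obtain ⟨c', hc', -⟩ := IsWeightedLimit.exists_of_map I hc he'
  exact ⟨_, c', hc'⟩

end EssSurj

section FreeCompletionSmall

variable {V : Type u} [Category.{v} V] [MonoidalCategory V] [SymmetricCategory V]
  [MonoidalClosed V] [HasLimits V]
variable {T : Type v} [EnrichedCategory V T] {Φ : WeightClass.{w} V}

/-- If `Φ` is locally small, the free completion is equivalent to a small `V`-category. -/
lemma exists_small_freeCompletion (hΦ : IsLocallySmallClass Φ) (T : Type v)
    [EnrichedCategory V T] :
    ∃ (A : Type v) (_ : EnrichedCategory V A) (I : EnrichedFunctor V A (FreeCompletion Φ T)),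
      (∀ a b, IsIso (I.map a b)) ∧
        ∀ Y, ∃ (a : A) (e : 𝟙_ V ⟶ eHom V Y (I.obj a)), IsIsoArrow e := by
  obtain ⟨ι, X, hX⟩ := hΦ T
  -- only the members of the family that are isomorphic to an object of the completion are kept
  let ι' := {i : ι // ∃ (Y : FreeCompletion Φ T) (e : 𝟙_ V ⟶ eHom V Y.obj (X i)), IsIsoArrow e}
  choose y e he using fun i : ι' => i.2
  refine ⟨Induced y, inferInstance, Induced.functor y, inferInstance, fun Y => ?_⟩
  obtain ⟨i, f, hf⟩ := hX Y.obj Y.property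
  let i' : ι' := ⟨i, Y, f, hf⟩
  obtain ⟨e', he', -⟩ := (he i').exists_inv
  exact ⟨⟨i'⟩, f ≫ postcomp e' Y.obj, (isIsoArrow_fullSub_iff (Y := y i') _).2 (hf.comp he')⟩

/-- `Φ`-limits in the free completion are formed in `[T, V]ᵒᵖ`. -/
lemma hasPhiLimits_freeCompletion [HasColimits V] : HasPhiLimits Φ (FreeCompletion Φ T) := by
  intro A _ W hW S
  obtain ⟨Q, q, hq, -⟩ := (Φ.isWeight W hW).exists_colimit (S.comp V (FullSub.ι _))
  have hQ : InFreeCompletion Φ T Q :=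
    LimitClosure.limit A W hW (S.comp V (FullSub.ι _)) (fun a => (S.obj a).property) Q q hq
  obtain ⟨q', hq', -⟩ := IsWeightedLimit.exists_of_map (FullSub.ι (InFreeCompletion Φ T)) hq
    (L := ⟨Q, hQ⟩) (isIsoArrow_eId Q)
  exact ⟨_, q', hq'⟩

end FreeCompletionSmall

/-! ### The functor of weighted colimits -/

section ConeComp

variable {V : Type u} [Category.{v} V] [MonoidalCategory V] [MonoidalClosed V]

/-- Composing a cone with a family of transformations between weights. -/
lemma IsBaseCone.comp_isWeightedCone {B : Type w} [EnrichedCategory V B] {K : Type u₁}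
    [EnrichedCategory V K] {W W' : EnrichedFunctor V B V} {S : EnrichedFunctor V B K} {L : K}
    {c : ∀ b, W'.obj b ⟶ eHom V L (S.obj b)} {Z : V} {d : ∀ b, Z ⊗ W.obj b ⟶ W'.obj b}
    (hd : IsBaseCone W W' Z d) (hc : IsWeightedCone W' S L c) :
    IsIndexedCone W S L Z (fun b => d b ≫ c b) := by
  intro a b
  change Z ◁ act W a b ≫ d b ≫ c b = (α_ _ _ _).inv ≫ ((d a ≫ c a) ⊙ S.map a b)
  rw [reassoc_of% hd a b, hc.eq, comp_elemComp]

end ConeComp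

section ColimitFunctor

variable {V : Type u} [Category.{v} V] [MonoidalCategory V] [SymmetricCategory V]
  [MonoidalClosed V] [HasLimits V] [HasColimits V]

/-- Weighted colimits of a functor to `V` on a small `V`-category are functorial in the weight. -/
lemma nonempty_colimitFunctor {A : Type v} [EnrichedCategory V A] (F : EnrichedFunctor V A V) :
    Nonempty (ColimitFunctor F) := by
  have h : ∀ G : EnrichedFunctor V Aᵒᵖ V, ∃ (C : V) (c : ∀ a : Aᵒᵖ, G.obj a ⟶
      eHom V (F.obj a.unop) C), IsWeightedColimit G F C c := fun G => by
    obtain ⟨C, c, hc⟩ := exists_isWeightedLimit_base_op G (opFunctor F)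
    exact ⟨C.unop, c, hc⟩
  choose C c hc using h
  have hext : ∀ (G : EnrichedFunctor V Aᵒᵖ V) (Y P : V) (x y : P ⟶ eHom V (C G) Y),
      (∀ a, c G a ⊙ x = c G a ⊙ y) → x = y := fun G Y P x y hxy =>
    IsWeightedLimit.ext (X := op Y) (hc G) fun a =>
      (elemComp_op (X := Y) (Y := C G) x (c G a)).trans
        ((congrArg ((β_ _ _).hom ≫ ·) (hxy a)).trans
          (elemComp_op (X := Y) (Y := C G) y (c G a)).symm)
  have hm : ∀ G G' : EnrichedFunctor V Aᵒᵖ V, ∃ m : homObj G G' ⟶ eHom V (C G) (C G'), ∀ a,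
      c G a ⊙ m = uncurry (homπ G G' a) ≫ c G' a := by
    intro G G'
    have hd := (isNatFamily_base_iff G G' _).1 (isNatFamily_homπ G G')
    obtain ⟨m, hm, -⟩ := ((isWeightedLimit_op_iff _).1 (hc G)).2 (C G') _ _
      ((isIndexedCone_op_iff _).1 (hd.comp_isWeightedCone (hc G').1))
    refine ⟨m, fun a => ?_⟩
    have h1 : (β_ (homObj G G') (G.obj a)).hom ≫ (c G a ⊙ m) =
      ((β_ _ _).hom ≫ uncurry (homπ G G' a)) ≫ c G' a := hm a
    rw [Category.assoc] at h1
    exact (cancel_epi _).1 h1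
  choose m hm using hm
  exact ⟨{
    functor := {
      obj := C
      map := m
      map_id := fun G => hext G _ _ _ _ fun a => by
        have e : G.obj a ◁ eId V G ≫ uncurry (homπ G G a) = (ρ_ _).hom :=
          (uncurry_comp_left (eId V G) (homπ G G a)).symm.trans
            ((congrArg uncurry ((evalAt a).map_id G)).trans (uncurry_eId _))
        refine (elemComp_comp (eId V G) (c G a) (m G G)).trans ?_
        rw [hm, elemComp_eId]
        exact (Category.assoc _ _ _).symm.trans (congrArg (· ≫ c G a) e)
      map_comp := fun G G' G'' => hext G _ _ _ _ fun a => by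
        have e : G.obj a ◁ eComp V G G' G'' ≫ uncurry (homπ G G'' a) =
            (α_ _ _ _).inv ≫ uncurry (homπ G G' a) ▷ _ ≫ uncurry (homπ G' G'' a) :=
          (uncurry_comp_left (eComp V G G' G'') (homπ G G'' a)).symm.trans
            ((congrArg uncurry ((evalAt a).map_comp G G' G'')).trans
              (uncurry_elemComp (homπ G G' a) (homπ G' G'' a)))
        refine (elemComp_comp (eComp V G G' G'') (c G a) (m G G'')).trans ?_
        refine Eq.trans ?_ (elemComp_assoc' (c G a) (m G G') (m G' G'')).symm
        rw [hm, hm, comp_elemComp, hm]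
        refine (Category.assoc _ _ _).symm.trans ((congrArg (· ≫ c G'' a) e).trans ?_)
        simp only [Category.assoc] }
    cocone := c
    isColimit := hc
    natural := fun G G' a => (hm G G' a).symm }⟩

end ColimitFunctor

end EnrichedModels

end

noncomputable section

namespace EnrichedModels

/-! ### Limits along equivalences -/

section Equivalence

variable {V : Type u} [Category.{v} V] [MonoidalCategory V] [MonoidalClosed V]
variable {C : Type w} [EnrichedCategory V C] {M : Type u₁} [EnrichedCategory V M]
  {D : Type u₂} [EnrichedCategory V D]

/-- The right Kan extension property is invariant under isomorphism of objects. -/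
lemma IsRightKanAt.of_isIsoArrow {J : EnrichedFunctor V C M} {E : EnrichedFunctor V M D} {X Y : M}
    (h : IsRightKanAt J E X) {e : 𝟙_ V ⟶ eHom V Y X} (he : IsIsoArrow e) :
    IsRightKanAt J E Y := by
  obtain ⟨e', he', h1, -⟩ := he.exists_inv
  have hi : ∀ t, IsIso (precomp e' (J.obj t)) := fun t => he'.isIso_precomp _
  have h2 := h.of_weight_iso (W' := J.comp V (homFunctor Y)) (fun t => precomp e' (J.obj t)) hi
    fun a b => by
      rw [act_comp_homFunctor, act_comp_homFunctor]
      have h3 : (𝟙 (eHom V Y (J.obj a)) ⊙ J.map a b) ≫ precomp e' (J.obj b) =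
          precomp e' (J.obj a) ▷ _ ≫ (𝟙 (eHom V X (J.obj a)) ⊙ J.map a b) := by
        rw [← comp_precomp_elemComp, ← comp_elemComp, Category.id_comp, Category.comp_id]
      exact h3
  refine h2.of_isIsoArrow' (he.map E) fun t => ?_
  have h4 : (precomp e' (J.obj t) ≫ E.map X (J.obj t)) ≫ precomp (e ≫ E.map Y X) (E.obj (J.obj t)) =
      E.map Y (J.obj t) := by
    rw [Category.assoc, ← precomp_map, ← Category.assoc, precomp_comp_precomp,
      comp_precomp_eq_comp_postcomp, h1, precomp_eId, Category.id_comp]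
  exact h4

/-- An indexed cone over the unit object is a cone. -/
lemma IsIndexedCone.isWeightedCone {W : EnrichedFunctor V C V} {S : EnrichedFunctor V C D} {X : D}
    {d : ∀ b, 𝟙_ V ⊗ W.obj b ⟶ eHom V X (S.obj b)} (h : IsIndexedCone W S X (𝟙_ V) d) :
    IsWeightedCone W S X (fun b => (λ_ _).inv ≫ d b) := by
  intro a b
  change act W a b ≫ (λ_ _).inv ≫ d b = ((λ_ _).inv ≫ d a) ⊙ S.map a b
  rw [leftUnitor_inv_naturality_assoc, h.eq, comp_elemComp]
  simp

lemma IsIndexedCone.whiskerLeft {W : EnrichedFunctor V M V} {S : EnrichedFunctor V M D} {X : D}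
    {Z : V} {d : ∀ b, Z ⊗ W.obj b ⟶ eHom V X (S.obj b)} (h : IsIndexedCone W S X Z d)
    (I : EnrichedFunctor V C M) :
    IsIndexedCone (I.comp V W) (I.comp V S) X Z (fun a => d (I.obj a)) := by
  intro a b
  have e : act (I.comp V W) a b = _ ◁ I.map a b ≫ act W (I.obj a) (I.obj b) :=
    uncurry_comp_left (I.map a b) (W.map (I.obj a) (I.obj b))
  change Z ◁ act (I.comp V W) a b ≫ d (I.obj b) =
    (α_ _ _ _).inv ≫ (d (I.obj a) ⊙ (I.map a b ≫ S.map (I.obj a) (I.obj b)))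
  refine (congrArg (fun z => Z ◁ z ≫ d (I.obj b)) e).trans ?_
  refine (congrArg (· ≫ d (I.obj b)) (MonoidalCategory.whiskerLeft_comp _ _ _)).trans ?_
  rw [Category.assoc, h.eq, elemComp_comp]
  exact associator_inv_naturality_right_assoc Z (W.obj (I.obj a)) (I.map a b) _

end Equivalence

section Extension

variable {V : Type u} [Category.{v} V] [MonoidalCategory V] [SymmetricCategory V]
  [MonoidalClosed V]
variable {A : Type w} [EnrichedCategory V A] {K : Type u₁} [EnrichedCategory V K]
  {M : Type u₂} [EnrichedCategory V M]

lemma isNatFamily_comp_homFunctor_iff {W : EnrichedFunctor V K V} {S : EnrichedFunctor V K M}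
    {X : M} {Z : V} (g : ∀ b, Z ⟶ eHom V (W.obj b) (eHom V X (S.obj b))) :
    IsNatFamily W (S.comp V (homFunctor X)) Z g ↔
      IsIndexedCone W S X Z (fun b => (β_ _ _).hom ≫ uncurry (g b)) :=
  (isNatFamily_base_iff W (S.comp V (homFunctor X)) g).trans (isBaseCone_homFunctor_iff X _)

lemma braiding_uncurry_curry {P Q Z : V} (x : Z ⊗ P ⟶ Q) :
    (β_ Z P).hom ≫ uncurry (curry ((β_ P Z).hom ≫ x)) = x := by
  rw [uncurry_curry, SymmetricCategory.symmetry_assoc]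

/-- Cones with vertex `X` are natural families of transformations from the weight to `K(X, S -)`. -/
lemma isNatFamily_curry_iff {W : EnrichedFunctor V K V} {S : EnrichedFunctor V K M}
    {X : M} {Z : V} (d : ∀ b, Z ⊗ W.obj b ⟶ eHom V X (S.obj b)) :
    IsNatFamily W (S.comp V (homFunctor X)) Z (fun b => curry ((β_ _ _).hom ≫ d b)) ↔
      IsIndexedCone W S X Z d := by
  refine (isNatFamily_comp_homFunctor_iff (S := S) (X := X) _).trans
    (iff_of_eq (congrArg (IsIndexedCone W S X Z) (funext fun b =>
      braiding_uncurry_curry (d b))))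

/-- Cones extend uniquely along an equivalence. -/
lemma IsIndexedCone.existsUnique_extension (I : EnrichedFunctor V A K) [∀ a b, IsIso (I.map a b)]
    (hI : ∀ Y, ∃ (a : A) (e : 𝟙_ V ⟶ eHom V Y (I.obj a)), IsIsoArrow e)
    {W : EnrichedFunctor V K V} {S : EnrichedFunctor V K M}
    {X : M} {Z : V} {d : ∀ a, Z ⊗ W.obj (I.obj a) ⟶ eHom V X (S.obj (I.obj a))}
    (hd : IsIndexedCone (I.comp V W) (I.comp V S) X Z d) :
    ∃! d' : ∀ b, Z ⊗ W.obj b ⟶ eHom V X (S.obj b), IsIndexedCone W S X Z d' ∧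
      ∀ a, d' (I.obj a) = d a := by
  have hK : ∀ Y, IsRightKanAt I (S.comp V (homFunctor X)) Y := fun Y => by
    obtain ⟨a, e, he⟩ := hI Y
    exact (isRightKanAt_obj I (S.comp V (homFunctor X)) a).of_isIsoArrow he
  have hg : IsNatFamily (I.comp V W) (I.comp V (S.comp V (homFunctor X))) Z
      (fun a => curry ((β_ _ _).hom ≫ d a)) := by
    intro a b
    refine ((isNatFamily_curry_iff (W := I.comp V W) (S := I.comp V S) d).2 hd a b).trans ?_
    exact congrArg (elemComp (X := W.obj (I.obj a)) (Y := eHom V X (S.obj (I.obj a)))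
      (Z := eHom V X (S.obj (I.obj b))) (curry ((β_ _ _).hom ≫ d a))) (Category.assoc _ _ _)
  obtain ⟨f, hf, hfu⟩ := hg.existsUnique_extension hK
  have h1 : ∀ a, f (I.obj a) = curry ((β_ _ _).hom ≫ d a) := hf.2
  refine ⟨fun b => (β_ _ _).hom ≫ uncurry (f b),
    ⟨(isNatFamily_comp_homFunctor_iff f).1 hf.1, fun a => ?_⟩, fun d' hd' => funext fun b => ?_⟩
  · change (β_ _ _).hom ≫ uncurry (f (I.obj a)) = d a
    rw [h1]
    exact braiding_uncurry_curry (d a)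
  · have h := hfu (fun b => curry ((β_ _ _).hom ≫ d' b))
      ⟨(isNatFamily_curry_iff d').2 hd'.1, fun a =>
        congrArg (fun z => curry ((β_ _ _).hom ≫ z)) (hd'.2 a)⟩
    have h2 : f b = curry ((β_ _ _).hom ≫ d' b) := (congrFun h b).symm
    rw [h2]
    exact (braiding_uncurry_curry (d' b)).symm

/-- Limits extend along an equivalence. -/
lemma IsWeightedLimit.exists_extension (I : EnrichedFunctor V A K) [∀ a b, IsIso (I.map a b)]
    (hI : ∀ Y, ∃ (a : A) (e : 𝟙_ V ⟶ eHom V Y (I.obj a)), IsIsoArrow e)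
    {W : EnrichedFunctor V K V} {S : EnrichedFunctor V K M}
    {L : M} {c : ∀ a, W.obj (I.obj a) ⟶ eHom V L (S.obj (I.obj a))}
    (h : IsWeightedLimit (I.comp V W) (I.comp V S) L c) :
    ∃ c' : ∀ b, W.obj b ⟶ eHom V L (S.obj b), IsWeightedLimit W S L c' ∧
      ∀ a, c' (I.obj a) = c a := by
  obtain ⟨d, ⟨hd, hdI⟩, -⟩ := h.1.isIndexedCone_unit.existsUnique_extension I hI
  have hI' : ∀ a, (λ_ _).inv ≫ d (I.obj a) = c a := fun a => by
    rw [hdI]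
    exact Iso.inv_hom_id_assoc _ _
  refine ⟨_, ⟨hd.isWeightedCone, fun X Z x hx => ?_⟩, hI'⟩
  obtain ⟨f, hf, hfu⟩ := h.2 X Z _ (hx.whiskerLeft I)
  refine ⟨f, fun b => ?_, fun f' hf' => hfu f' fun a => ?_⟩
  · have h1 := (hx.whiskerLeft I).existsUnique_extension I hI
    refine congrFun (h1.unique ⟨hd.isWeightedCone.isIndexedCone f, fun a => ?_⟩
      ⟨hx, fun a => rfl⟩) b
    rw [hI']
    exact hf a
  · have h2 := hf' (I.obj a)
    rw [hI'] at h2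
    exact h2

end Extension

end EnrichedModels

end

noncomputable section

namespace EnrichedModels

/-! ### The left Kan extension along the right adjoint -/

section Nerve

variable {V : Type u} [Category.{v} V] [MonoidalCategory V] [SymmetricCategory V]

/-- The two ways of reversing the order of three tensor factors agree. -/
lemma yang_baxter (Z X A : V) :
    Z ◁ (β_ X A).hom ≫ (β_ Z (A ⊗ X)).hom ≫ (α_ A X Z).hom =
      (α_ Z X A).inv ≫ (β_ Z X).hom ▷ A ≫ (β_ (X ⊗ Z) A).hom := by
  rw [braiding_naturality_left, braiding_tensor_left_hom, braiding_tensor_right_hom]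
  simp

variable [MonoidalClosed V]
variable {K : Type u₁} [EnrichedCategory V K] {T : Type u₂} [EnrichedCategory V T]

/-- The weight `X ↦ T(P X, t)` on the opposite of the domain of `P`. -/
def coWeight (P : EnrichedFunctor V K T) (t : T) : EnrichedFunctor V Kᵒᵖ V :=
  (opFunctor P).comp V (homFunctor (op t))

lemma act_coWeight (P : EnrichedFunctor V K T) (t : T) (X Y : Kᵒᵖ) :
    act (coWeight P t) X Y = (β_ _ _).hom ≫
      (P.map Y.unop X.unop ⊙ 𝟙 (eHom V (P.obj X.unop) t)) :=
  act_comp_homFunctor_op (opFunctor P) t X Y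

/-- The weights `T(P -, t)` depend `V`-functorially on `t`. -/
lemma isNatFamily_coWeight (P : EnrichedFunctor V K T) (s t : T) :
    IsNatFamily (coWeight P s) (coWeight P t) (eHom V s t)
      (fun X => (homFunctor (P.obj X.unop)).map s t) := by
  refine (isNatFamily_base_iff _ _ _).2 fun X Y => ?_
  have e : ∀ X : Kᵒᵖ, (β_ (eHom V s t) (eHom V (P.obj X.unop) s)).hom ≫
      uncurry ((homFunctor (P.obj X.unop)).map s t) =
      (β_ _ _).hom ≫ (𝟙 (eHom V (P.obj X.unop) s) ⊙ 𝟙 (eHom V s t)) := fun X => by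
    rw [← eComp_eq_elemComp]
    exact congrArg (_ ≫ ·) (uncurry_curry _)
  have e1 : eHom V s t ◁ ((β_ _ _).hom ≫ (P.map Y.unop X.unop ⊙ 𝟙 (eHom V (P.obj X.unop) s))) ≫
      (β_ (eHom V s t) (eHom V (P.obj Y.unop) s)).hom ≫
        (𝟙 (eHom V (P.obj Y.unop) s) ⊙ 𝟙 (eHom V s t)) =
      (α_ _ _ _).inv ≫ ((β_ (eHom V s t) (eHom V (P.obj X.unop) s)).hom ≫
        (𝟙 (eHom V (P.obj X.unop) s) ⊙ 𝟙 (eHom V s t))) ▷ (eHom V Y.unop X.unop) ≫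
      (β_ (eHom V (P.obj X.unop) t) (eHom V Y.unop X.unop)).hom ≫
        (P.map Y.unop X.unop ⊙ 𝟙 (eHom V (P.obj X.unop) t)) := by
    have e2 : ((β_ (eHom V s t) (eHom V (P.obj X.unop) s)).hom ≫
        (𝟙 (eHom V (P.obj X.unop) s) ⊙ 𝟙 (eHom V s t))) ▷ (eHom V Y.unop X.unop) ≫
      (β_ (eHom V (P.obj X.unop) t) (eHom V Y.unop X.unop)).hom ≫
        (P.map Y.unop X.unop ⊙ 𝟙 (eHom V (P.obj X.unop) t)) =
      (β_ _ _).hom ▷ _ ≫ (β_ _ _).hom ≫ (P.map Y.unop X.unop ⊙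
        (𝟙 (eHom V (P.obj X.unop) s) ⊙ 𝟙 (eHom V s t))) := by
      rw [comp_whiskerRight, Category.assoc, braiding_naturality_left_assoc, ← elemComp_comp,
        Category.comp_id]
    rw [e2, MonoidalCategory.whiskerLeft_comp, Category.assoc, braiding_naturality_right_assoc,
      ← comp_elemComp, Category.comp_id, elemComp_assoc,
      reassoc_of% (yang_baxter (eHom V s t) (eHom V (P.obj X.unop) s) (eHom V Y.unop X.unop))]
  have h1 := act_coWeight P s X Y
  have h2 := act_coWeight P t X Y
  refine (congrArg₂ (fun z z' => eHom V s t ◁ z ≫ z') h1 (e Y)).trans (e1.trans ?_)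
  exact (congrArg₂ (fun z z' => (α_ _ _ _).inv ≫ z ▷ _ ≫ z') (e X) h2).symm

end Nerve

section Kan

variable {V : Type u} [Category.{v} V] [MonoidalCategory V] [SymmetricCategory V]
  [MonoidalClosed V] [HasLimits V]
variable {K : Type u₁} [EnrichedCategory V K] {T : Type u₂} [EnrichedCategory V T]
  {A : Type v} [EnrichedCategory V A]

/-- The `V`-functor `T → [Aᵒᵖ, V]` sending `t` to `T(P I -, t)`. -/
def nerve (I : EnrichedFunctor V A K) (P : EnrichedFunctor V K T) :
    EnrichedFunctor V T (EnrichedFunctor V Aᵒᵖ V) where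
  obj t := (opFunctor I).comp V (coWeight P t)
  map s t := homLift _ ((isNatFamily_coWeight P s t).whiskerLeft (opFunctor I))
  map_id t := homObj_ext fun a => by
    refine (Category.assoc _ _ _).trans ((congrArg (_ ≫ ·) (homLift_π _
      ((isNatFamily_coWeight P t t).whiskerLeft (opFunctor I)) a)).trans ?_)
    exact ((homFunctor (P.obj (I.obj a.unop))).map_id t).trans
      ((evalAt a).map_id ((opFunctor I).comp V (coWeight P t))).symm
  map_comp r s t := homObj_ext fun a => by
    have h := fun s t => homLift_π _
      ((isNatFamily_coWeight P s t).whiskerLeft (opFunctor I)) a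
    refine (Category.assoc _ _ _).trans ((congrArg (_ ≫ ·) (h r t)).trans ?_)
    refine ((homFunctor (P.obj (I.obj a.unop))).map_comp r s t).trans ?_
    refine Eq.trans ?_ (elemComp_homπ (homLift _
      ((isNatFamily_coWeight P r s).whiskerLeft (opFunctor I))) (homLift _
      ((isNatFamily_coWeight P s t).whiskerLeft (opFunctor I))) a).symm
    exact (congrArg₂ elemComp (h r s) (h s t)).symm

lemma nerve_map_homπ (I : EnrichedFunctor V A K) (P : EnrichedFunctor V K T) (s t : T) (a : Aᵒᵖ) :
    (nerve I P).map s t ≫ homπ ((opFunctor I).comp V (coWeight P s))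
      ((opFunctor I).comp V (coWeight P t)) a =
        (homFunctor (P.obj (I.obj a.unop))).map s t :=
  homLift_π _ ((isNatFamily_coWeight P s t).whiskerLeft (opFunctor I)) a

/-- Limits in `[Aᵒᵖ, V]` are computed pointwise, and each `T(P I a, -)` preserves limits. -/
lemma phiContinuous_nerve (Φ : WeightClass.{w} V) (I : EnrichedFunctor V A K)
    (P : EnrichedFunctor V K T) : PhiContinuous Φ (nerve I P) := by
  intro B _ W _ S L c hc
  refine isWeightedLimit_of_evalAt fun a => ?_
  refine (hc.map_homFunctor (P.obj (I.obj a.unop))).of_map_eq (fun b b' => ?_) fun b => ?_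
  · exact ((Category.assoc _ _ _).trans (congrArg (_ ≫ ·) (nerve_map_homπ I P _ _ a))).symm
  · exact ((Category.assoc _ _ _).trans (congrArg (_ ≫ ·) (nerve_map_homπ I P _ _ a))).symm

end Kan

end EnrichedModels

end

noncomputable section

namespace EnrichedModels

section Assemble

variable {V : Type u} [Category.{v} V] [MonoidalCategory V] [SymmetricCategory V]
  [MonoidalClosed V]
variable {K : Type u₁} [EnrichedCategory V K] {T : Type u₂} [EnrichedCategory V T]
  {D : Type u₃} [EnrichedCategory V D]

/-- A `V`-functor whose values are colimits of `E` weighted by `T(P -, t)`, compatibly with `t`, is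
a left Kan extension. -/
lemma exists_isLeftKan_of_pointwise {P : EnrichedFunctor V K T} {E : EnrichedFunctor V K D}
    {L : EnrichedFunctor V T D}
    {c : ∀ (t : T) (X : K), eHom V (P.obj X) t ⟶ eHom V (E.obj X) (L.obj t)}
    (h : ∀ t, IsWeightedColimit (coWeight P t) E (L.obj t) (fun X => c t X.unop))
    (hc : ∀ s t X, c s X ⊙ L.map s t = (𝟙 (eHom V (P.obj X) s) ⊙ 𝟙 (eHom V s t)) ≫ c t X) :
    ∃ η : VNat E (P.comp V L), IsLeftKan P E L η := by
  -- the unit is the cocone at the identity, and recovers the cocone by naturality in `t`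
  have h1 : ∀ t X, L.map (P.obj X) t ≫
      precomp (eId V (P.obj X) ≫ c (P.obj X) X) (L.obj t) = c t X := fun t X => by
    rw [comp_precomp, comp_elemComp, hc, ← reassoc_of% comp_elemComp, Category.comp_id,
      eId_elemComp, Category.comp_id, Iso.inv_hom_id_assoc]
  have h2 : ∀ X Y, (P.map X Y ⊙ 𝟙 (eHom V (P.obj Y) (P.obj Y))) ≫ c (P.obj Y) X =
      E.map X Y ⊙ c (P.obj Y) Y := fun X Y => by
    have e1 := (isWeightedCone_op_iff _).1 (h (P.obj Y)).1 (op Y) (op X)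
    have e2 := act_coWeight P (P.obj Y) (op Y) (op X)
    exact (cancel_epi (β_ _ _).hom).1 ((Category.assoc _ _ _).symm.trans
      ((congrArg (· ≫ c (P.obj Y) X) e2).symm.trans e1))
  refine ⟨⟨fun X => eId V (P.obj X) ≫ c (P.obj X) X, (isNatFamily_unit_iff _).2 fun X Y => ?_⟩,
    fun t => (h t).of_eq fun X => (h1 t X.unop).symm⟩
  refine Eq.trans ?_ ((Category.assoc _ _ _).trans (congrArg (P.map X Y ≫ ·) (h1 _ X))).symm
  have h3 := congrArg (_ ◁ eId V (P.obj Y) ≫ ·) (h2 X Y)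
  beta_reduce at h3
  rw [← elemComp_comp, ← reassoc_of% elemComp_comp, Category.comp_id, elemComp_eId] at h3
  rw [comp_postcomp]
  refine (congrArg (_ ≫ ·) h3).symm.trans ?_
  rw [Category.assoc, Iso.inv_hom_id_assoc]

end Assemble

section KanExistence

variable {V : Type u} [Category.{v} V] [MonoidalCategory V] [SymmetricCategory V]
  [MonoidalClosed V] [HasLimits V]
variable {K : Type u₁} [EnrichedCategory V K] {T : Type u₂} [EnrichedCategory V T]
  {A : Type v} [EnrichedCategory V A]

/-- The colimit cocones `T(P I a, t) ⟶ [F a, H (nerve t)]` are natural in `t`. -/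
lemma ColimitFunctor.cocone_natural_nerve {I : EnrichedFunctor V A K} {P : EnrichedFunctor V K T}
    {F : EnrichedFunctor V A V} (H : ColimitFunctor F) (s t : T) (a : A) :
    elemComp (H.cocone ((nerve I P).obj s) (op a)) (((nerve I P).comp V H.functor).map s t) =
      (𝟙 (eHom V (P.obj (I.obj a)) s) ⊙ 𝟙 (eHom V s t)) ≫
        H.cocone ((nerve I P).obj t) (op a) := by
  refine (elemComp_comp ((nerve I P).map s t) _ _).trans ?_
  refine (congrArg (_ ≫ ·) (H.natural _ _ (op a))).symm.trans ?_
  refine (Category.assoc _ _ _).symm.trans (congrArg (· ≫ _) ?_)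
  refine (uncurry_comp_left _ _).symm.trans ((congrArg uncurry
    (nerve_map_homπ I P s t (op a))).trans ?_)
  exact (uncurry_curry _).trans (eComp_eq_elemComp _ _ _)

/-- If `K` is equivalent to the small `V`-category `A`, the left Kan extension of `E` along
`P : K → T` is the composite of `nerve I P` with the left Kan extension of `E I` along the Yoneda
embedding of `A`. -/
lemma exists_isLeftKan_nerve (I : EnrichedFunctor V A K) [hI : ∀ a b, IsIso (I.map a b)]
    (hI' : ∀ Y, ∃ (a : A) (e : 𝟙_ V ⟶ eHom V Y (I.obj a)), IsIsoArrow e)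
    (P : EnrichedFunctor V K T) (E : EnrichedFunctor V K V) (H : ColimitFunctor (I.comp V E)) :
    ∃ η : VNat E (P.comp V ((nerve I P).comp V H.functor)),
      IsLeftKan P E ((nerve I P).comp V H.functor) η := by
  have iI : ∀ a b, IsIso ((opFunctor I).map a b) := fun a b => hI b.unop a.unop
  have iI' : ∀ Y : Kᵒᵖ, ∃ (a : Aᵒᵖ) (e : 𝟙_ V ⟶ eHom V Y ((opFunctor I).obj a)), IsIsoArrow e := by
    intro Y
    obtain ⟨a, e, he⟩ := hI' Y.unop
    obtain ⟨g, hg, -⟩ := he.exists_inv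
    exact ⟨op a, g, (isIsoArrow_op_iff g).2 hg⟩
  choose c hc hca using fun t => IsWeightedLimit.exists_extension (opFunctor I) iI'
    (W := coWeight P t) (S := opFunctor E) (H.isColimit ((nerve I P).obj t))
  refine exists_isLeftKan_of_pointwise (c := fun t X => c t (op X)) hc fun s t X => ?_
  -- naturality in `t` is an equality of two indexed cones on `K`; as they agree on `A`, they agree
  have n1 := (hc s).1.isIndexedCone (X := op (H.functor.obj ((nerve I P).obj t)))
    (((nerve I P).comp V H.functor).map s t)
  have n2 := IsBaseCone.comp_isWeightedCone
    ((isNatFamily_base_iff _ _ _).1 (isNatFamily_coWeight P s t)) (hc t).1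
  have e1 : ∀ X : Kᵒᵖ, (β_ (eHom V s t) (eHom V (P.obj X.unop) s)).hom ≫
      uncurry ((homFunctor (P.obj X.unop)).map s t) =
      (β_ _ _).hom ≫ (𝟙 (eHom V (P.obj X.unop) s) ⊙ 𝟙 (eHom V s t)) := fun X => by
    rw [← eComp_eq_elemComp]
    exact congrArg (_ ≫ ·) (uncurry_curry _)
  have e2 : ∀ a : Aᵒᵖ, elemComp (K := V) (X := E.obj (I.obj a.unop))
      (Y := ((nerve I P).comp V H.functor).obj s) (c s ((opFunctor I).obj a))
      (((nerve I P).comp V H.functor).map s t) =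
      (𝟙 (eHom V (P.obj (I.obj a.unop)) s) ⊙ 𝟙 (eHom V s t)) ≫ c t ((opFunctor I).obj a) :=
    fun a => (congrArg (elemComp (K := V) · (((nerve I P).comp V H.functor).map s t))
      (hca s a)).trans ((H.cocone_natural_nerve s t a.unop).trans
      (congrArg (_ ≫ ·) (hca t a)).symm)
  have key := (IsIndexedCone.existsUnique_extension (opFunctor I) iI'
    (n1.whiskerLeft (opFunctor I))).unique ⟨n1, fun _ => rfl⟩ ⟨n2, fun a => ?_⟩
  · have h1 := congrFun key (op X)
    have h2 := (elemComp_op (((nerve I P).comp V H.functor).map s t) (c s (op X))).symm.trans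
      (h1.trans ((congrArg (· ≫ c t (op X)) (e1 (op X))).trans (Category.assoc _ _ _)))
    exact (cancel_epi (β_ _ _).hom).1 h2
  · refine (congrArg (· ≫ c t ((opFunctor I).obj a)) (e1 ((opFunctor I).obj a))).trans ?_
    refine (Category.assoc _ _ _).trans ((congrArg (_ ≫ ·) (e2 a)).symm.trans ?_)
    exact (elemComp_op (((nerve I P).comp V H.functor).map s t) (c s ((opFunctor I).obj a))).symm

end KanExistence

section

variable {V : Type u} [Category.{v} V] [MonoidalCategory V] [SymmetricCategory V]
  [MonoidalClosed V] [HasLimits V] [HasColimits V] {Φ : WeightClass.{w} V}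
  {T : Type v} [EnrichedCategory V T]

/-- The left Kan extension exists because the free completion is essentially small, and it is a
model by Axiom A. -/
lemma exists_isLeftKan_isModel (hΦ : IsLocallySmallClass Φ) (hA : AxiomA Φ)
    (R : EnrichedFunctor V (FreeCompletion Φ T) T) {E : EnrichedFunctor V (FreeCompletion Φ T) V}
    (hE : PhiContinuous Φ E) :
    ∃ (L : EnrichedFunctor V T V) (η : VNat E (R.comp V L)), IsLeftKan R E L η ∧ IsModel Φ L := by
  obtain ⟨A, _, I, hI, hI'⟩ := exists_small_freeCompletion hΦ T
  obtain ⟨H⟩ := nonempty_colimitFunctor (I.comp V E)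
  have hIc : PhiContinuous Φ I := fun _ _ _ _ _ _ _ h => h.map_of_essSurj I hI'
  obtain ⟨η, hη⟩ := exists_isLeftKan_nerve I hI' R E H
  exact ⟨_, η, hη, (phiContinuous_nerve Φ I R).comp
    (hA A (HasPhiLimits.of_essSurj I hI' hasPhiLimits_freeCompletion) _ (hIc.comp hE) H)⟩

end

end EnrichedModels

end

noncomputable section

namespace EnrichedModels

/-! ### The universal property of the left Kan extension -/

section

variable {V : Type u} [Category.{v} V] [MonoidalCategory V]

lemma isIsoArrow_of_isIso_postcomp {K : Type u₁} [EnrichedCategory V K] {X Y : K}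
    (f : 𝟙_ V ⟶ eHom V X Y) (h : ∀ Z, IsIso (postcomp f Z)) : IsIsoArrow f := by
  refine (isIsoArrow_iff f).2 ⟨eId V Y ≫ inv (postcomp f Y), ?_, by simp⟩
  have := h X
  rw [← cancel_mono (postcomp f X), Category.assoc, postcomp_comp_postcomp, Category.assoc,
    IsIso.inv_hom_id, Category.comp_id, postcomp_eId, Category.comp_id, eId_postcomp]

end

section

variable {V : Type u} [Category.{v} V] [MonoidalCategory V] [BraidedCategory V]
variable {C : Type u₁} [EnrichedCategory V C] {D : Type u₂} [EnrichedCategory V D]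

/-- The naturality square of a family of transformations at an arrow of the underlying category. -/
lemma IsNatFamily.postcomp_arrow {F G : EnrichedFunctor V C D} {Z : V}
    {s : ∀ a, Z ⟶ eHom V (F.obj a) (G.obj a)} (h : IsNatFamily F G Z s) {a b : C}
    (r : 𝟙_ V ⟶ eHom V a b) :
    s a ≫ EnrichedModels.postcomp (r ≫ G.map a b) (F.obj a) =
      s b ≫ EnrichedModels.precomp (r ≫ F.map a b) (G.obj b) := by
  rw [comp_postcomp, comp_precomp, elemComp_comp, ← h.eq, braiding_naturality_right_assoc,
    braiding_tensorUnit_right, comp_elemComp]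
  simp

variable {L : EnrichedFunctor V C D} {R : EnrichedFunctor V D C}

/-- The natural isomorphism `D(L X, Y) ≅ C(X, R Y)` of an adjunction. -/
def VAdjunction.homMap (adj : VAdjunction L R) (X : C) (Y : D) :
    eHom V (L.obj X) Y ⟶ eHom V X (R.obj Y) :=
  R.map (L.obj X) Y ≫ precomp (X := X) (Y := R.obj (L.obj X)) (adj.unit.app X) (R.obj Y)

instance (adj : VAdjunction L R) (X : C) (Y : D) : IsIso (adj.homMap X Y) := adj.isIso X Y

lemma VAdjunction.elemComp_homMap (adj : VAdjunction L R) {X : C} {Y Y' : D} {P Q : V}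
    (f : P ⟶ eHom V (L.obj X) Y) (g : Q ⟶ eHom V Y Y') :
    (f ⊙ g) ≫ adj.homMap X Y' = (f ≫ adj.homMap X Y) ⊙ (g ≫ R.map Y Y') := by
  rw [homMap, homMap, ← Category.assoc, elemComp_map, ← Category.assoc f]
  exact (comp_precomp_elemComp _ _ _).symm

/-- A right adjoint preserves weighted limits. -/
lemma VAdjunction.map_isWeightedLimit [MonoidalClosed V] (adj : VAdjunction L R) {B : Type w}
    [EnrichedCategory V B] {W : EnrichedFunctor V B V} {S : EnrichedFunctor V B D} {Y : D}
    {c : ∀ b, W.obj b ⟶ eHom V Y (S.obj b)} (h : IsWeightedLimit W S Y c) :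
    IsWeightedLimit W (S.comp V R) (R.obj Y) (fun b => c b ≫ R.map Y (S.obj b)) := by
  refine ⟨h.1.map R, fun X Z (d : ∀ b, Z ⊗ W.obj b ⟶ eHom V X (R.obj (S.obj b))) hd => ?_⟩
  have hd' : IsIndexedCone W S (L.obj X) Z (fun b => d b ≫ inv (adj.homMap X (S.obj b))) := by
    intro a b
    rw [← cancel_mono (adj.homMap X (S.obj b)), Category.assoc, Category.assoc, IsIso.inv_hom_id]
    refine (congrArg (_ ≫ ·) (Category.comp_id _)).trans ((hd a b).trans ?_)
    refine Eq.trans ?_ ((Category.assoc _ _ _).trans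
      (congrArg ((α_ _ _ _).inv ≫ ·) (adj.elemComp_homMap _ (S.map a b)))).symm
    rw [Category.assoc, IsIso.inv_hom_id]
    exact congrArg (fun z => (α_ _ _ _).inv ≫ elemComp z (S.map a b ≫ R.map _ _))
      (Category.comp_id _).symm
  obtain ⟨f, hf, hf'⟩ := h.2 (L.obj X) Z _ hd'
  have key : ∀ (f : Z ⟶ eHom V (L.obj X) Y) b,
      (f ≫ adj.homMap X Y) ⊙ (c b ≫ R.map Y (S.obj b)) = d b ↔
        f ⊙ c b = d b ≫ inv (adj.homMap X (S.obj b)) := by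
    intro f b
    rw [← adj.elemComp_homMap, IsIso.eq_comp_inv]
  refine ⟨f ≫ adj.homMap X Y, fun b => (key f b).2 (hf b), fun g hg => ?_⟩
  have e : g = (g ≫ inv (adj.homMap X Y)) ≫ adj.homMap X Y := by simp
  rw [e, hf' (g ≫ inv (adj.homMap X Y)) fun b => (key _ b).1 (by rw [← e]; exact hg b)]

lemma VAdjunction.phiContinuous [MonoidalClosed V] (adj : VAdjunction L R)
    (Φ : WeightClass.{w} V) : PhiContinuous Φ R :=
  fun _ _ _ _ _ _ _ h => adj.map_isWeightedLimit h

/-- The unit of an adjunction, whiskered with a `V`-functor on the domain of the left adjoint. -/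
def VAdjunction.unitComp (adj : VAdjunction L R) {E : Type u₃} [EnrichedCategory V E]
    (M : EnrichedFunctor V C E) : VNat M (L.comp V (R.comp V M)) where
  app X := adj.unit.app X ≫ M.map X (R.obj (L.obj X))
  natural := (isNatFamily_unit_iff _).2 fun X Y =>
    (congrArg (· ≫ _) (Category.id_comp (M.map X Y))).symm.trans
      (((adj.unit.whiskerRight M).naturality X Y).trans
        (congrArg (· ≫ _) (Category.assoc _ _ _)))

/-- The unit of an adjunction with fully faithful left adjoint is invertible. -/
lemma VAdjunction.unit_isIso (adj : VAdjunction L R) [∀ X Y, IsIso (L.map X Y)] :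
    adj.unit.IsIso := by
  intro Y
  refine isIsoArrow_of_isIso_postcomp _ fun X => ?_
  have h := adj.unit.naturality X Y
  have h2 : L.map X Y ≫ adj.homMap X (L.obj Y) = postcomp (adj.unit.app Y) X :=
    (Category.assoc _ _ _).symm.trans (h.symm.trans (Category.id_comp _))
  exact h2 ▸ inferInstanceAs (IsIso (L.map X Y ≫ adj.homMap X (L.obj Y)))

end

section

variable {V : Type u} [Category.{v} V] [MonoidalCategory V] [SymmetricCategory V]
  [MonoidalClosed V] [HasLimits V]
variable {T : Type v} [EnrichedCategory V T] {D : Type u₂} [EnrichedCategory V D]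

/-- Unique extension of families of transformations along `ρ` means that
`[T, D](ρ, M) : [T, D](L, M) ⟶ [T, D](F, M)` is invertible. -/
lemma isIso_precomp_homLift {F L M : EnrichedFunctor V T D} (ρ : VNat F L)
    (h : ∀ (Z : V) (g : ∀ t, Z ⟶ eHom V (F.obj t) (M.obj t)), IsNatFamily F M Z g →
      ∃! f : ∀ t, Z ⟶ eHom V (L.obj t) (M.obj t), IsNatFamily L M Z f ∧
        ∀ t, f t ≫ precomp (ρ.app t) (M.obj t) = g t) :
    IsIso (precomp (X := F) (Y := L) (homLift ρ.app ρ.natural) M) := by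
  have key : ∀ {Z : V} (f : Z ⟶ homObj L M) t,
      (f ≫ precomp (X := F) (Y := L) (homLift ρ.app ρ.natural) M) ≫ homπ F M t =
        (f ≫ homπ L M t) ≫ precomp (ρ.app t) (M.obj t) := by
    intro Z f t
    have h1 := precomp_map (evalAt t) (X := F) (Y := L) (homLift ρ.app ρ.natural) M
    refine (Category.assoc _ _ _).trans ((congrArg (f ≫ ·) h1).trans ?_)
    refine (Category.assoc _ _ _).symm.trans (congrArg (fun r => (f ≫ homπ L M t) ≫
      precomp r (M.obj t)) ?_)
    exact homLift_π _ _ t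
  refine isIso_of_bijective _ fun Z g => ?_
  obtain ⟨f, ⟨hf, hfg⟩, hu⟩ := h Z _ (isNatFamily_comp_homπ g)
  refine ⟨homLift f hf, homObj_ext fun t => ?_, fun f' hf' => homObj_ext fun t => ?_⟩
  · exact (key _ t).trans ((congrArg (· ≫ _) (homLift_π f hf t)).trans (hfg t))
  · refine Eq.trans ?_ (homLift_π f hf t).symm
    exact congrFun (hu (fun t => f' ≫ homπ L M t) ⟨isNatFamily_comp_homπ f', fun t =>
      (key f' t).symm.trans (congrArg (· ≫ homπ F M t) hf')⟩) t

end

section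

variable {V : Type u} [Category.{v} V] [MonoidalCategory V] [SymmetricCategory V]
  [MonoidalClosed V] [HasLimits V] {Φ : WeightClass.{w} V}
  {T : Type v} [EnrichedCategory V T] {R : EnrichedFunctor V (FreeCompletion Φ T) T}

/-- The prescribed equation determines the unit `F ⟶ L`: since the unit of `J ⊣ R` is invertible, so
is `L ⟶ L R J`, and its inverse is composed with `F ⟶ E J ⟶ L R J`. -/
lemma exists_unit_eq (adj : VAdjunction (toFreeCompletion Φ T) R)
    {F L : EnrichedFunctor V T V} {E : EnrichedFunctor V (FreeCompletion Φ T) V}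
    (e : VNat F ((toFreeCompletion Φ T).comp V E)) (η : VNat E (R.comp V L)) :
    ∃ ρ : VNat F L, ∀ t, arrowComp (e.app t) (η.app ((toFreeCompletion Φ T).obj t)) =
      arrowComp (ρ.app t) (adj.unit.app t ≫ L.map _ _) := by
  have hu : (adj.unitComp L).IsIso := fun t => IsIsoArrow.map (adj.unit_isIso t) L
  obtain ⟨γ, -, hγ⟩ := hu.exists_inv
  refine ⟨(e.vcomp (η.whiskerLeft (toFreeCompletion Φ T))).vcomp γ, fun t => ?_⟩
  refine Eq.trans ?_ (arrowComp_eq_postcomp _ _).symm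
  refine (arrowComp_eq_postcomp _ _).trans (Eq.symm ((Category.assoc _ _ _).trans ?_))
  refine (congrArg (_ ≫ ·) (postcomp_comp_postcomp _ _ _)).trans ?_
  refine (congrArg (fun r => _ ≫ postcomp r _) (hγ t)).trans ?_
  exact (congrArg (_ ≫ ·) (postcomp_eId _ _)).trans (Category.comp_id _)

variable [HasColimits V]

/-- The left Kan extension along `R` of a `Φ`-continuous extension of `F` is the reflection of `F`.
For a model `M`, families `L ⟶ M` correspond to families `E ⟶ M R` since `L` is a left Kan
extension, these to families `E J ⟶ M R J` since `M R` is `Φ`-continuous and hence a right Kan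
extension, and these to families `F ⟶ M` by the isomorphisms `F ≅ E J` and `M ≅ M R J`. -/
lemma isReflection_of_isLeftKan (adj : VAdjunction (toFreeCompletion Φ T) R)
    {F L : EnrichedFunctor V T V} {E : EnrichedFunctor V (FreeCompletion Φ T) V}
    {e : VNat F ((toFreeCompletion Φ T).comp V E)} (he : e.IsIso)
    {η : VNat E (R.comp V L)} (hη : IsLeftKan R E L η) (hL : IsModel Φ L) {ρ : VNat F L}
    (hρ : ∀ t, arrowComp (e.app t) (η.app ((toFreeCompletion Φ T).obj t)) =
      arrowComp (ρ.app t) (adj.unit.app t ≫ L.map _ _)) :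
    IsReflectionIntoModels Φ ρ := by
  refine ⟨hL, fun M hM => isIso_precomp_homLift ρ fun Z g hg => ?_⟩
  let J := toFreeCompletion Φ T
  let u : ∀ t, 𝟙_ V ⟶ eHom V t (R.obj (J.obj t)) := fun t => adj.unit.app t
  have hRM : PhiContinuous Φ (R.comp V M) := (adj.phiContinuous Φ).comp hM
  have hu : ∀ t, IsIso (postcomp (u t ≫ M.map t (R.obj (J.obj t))) (F.obj t)) := fun t =>
    (IsIsoArrow.map (f := u t) (adj.unit_isIso t) M).isIso_postcomp _
  -- restriction along `ρ` and transport along `u` agree with restriction along `η` and `e`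
  have key : ∀ {f : ∀ t, Z ⟶ eHom V (L.obj t) (M.obj t)}, IsNatFamily L M Z f → ∀ t,
      (f t ≫ precomp (ρ.app t) (M.obj t)) ≫ postcomp (u t ≫ M.map t (R.obj (J.obj t))) (F.obj t) =
      (f (R.obj (J.obj t)) ≫ precomp (X := E.obj (J.obj t)) (η.app (J.obj t))
        (M.obj (R.obj (J.obj t)))) ≫ precomp (X := F.obj t) (Y := E.obj (J.obj t)) (e.app t)
          (M.obj (R.obj (J.obj t))) := by
    intro f hf t
    have h1 := (arrowComp_eq_precomp (X := F.obj t) (Y := E.obj (J.obj t))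
      (Z := L.obj (R.obj (J.obj t))) (e.app t) (η.app (J.obj t))).symm.trans
        ((hρ t).trans (arrowComp_eq_precomp (ρ.app t) (u t ≫ L.map t (R.obj (J.obj t)))))
    rw [Category.assoc, precomp_postcomp, ← Category.assoc, hf.postcomp_arrow, Category.assoc]
    refine (congrArg (f _ ≫ ·) (precomp_comp_precomp _ _ _)).trans ?_
    refine (congrArg (fun r => f _ ≫ precomp r _) h1.symm).trans ?_
    refine (congrArg (f _ ≫ ·) (precomp_comp_precomp _ _ _)).symm.trans ?_
    exact (Category.assoc _ _ _).symm
  -- `g` transported along `u` and the inverse of `e` is a family `E J ⟶ M R J`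
  obtain ⟨γ, hγ, -⟩ := he.exists_inv
  have hg' := (hg.postcomp (adj.unitComp M)).precomp γ
  have hgγ : ∀ t, ((g t ≫ postcomp (u t ≫ M.map t (R.obj (J.obj t))) (F.obj t)) ≫
      precomp (X := E.obj (J.obj t)) (γ.app t) (M.obj (R.obj (J.obj t)))) ≫
        precomp (X := F.obj t) (Y := E.obj (J.obj t)) (e.app t) (M.obj (R.obj (J.obj t))) =
      g t ≫ postcomp (u t ≫ M.map t (R.obj (J.obj t))) (F.obj t) := by
    intro t
    refine (Category.assoc _ _ _).trans ((congrArg (_ ≫ ·) ((precomp_comp_precomp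
      (X := E.obj (J.obj t)) _ _ _).trans (congrArg (precomp · _)
        ((comp_precomp_eq_comp_postcomp _ _).trans (hγ t))))).trans ?_)
    rw [precomp_eId, Category.comp_id]
  obtain ⟨h, ⟨hh, hhg⟩, hhu⟩ := hg'.existsUnique_extension
    (fun X => isRightKanAt_of_phiContinuous hRM X)
  obtain ⟨f, ⟨hf, hfh⟩, hfu⟩ := hη.existsUnique_family hh
  refine ⟨f, ⟨hf, fun t => ?_⟩, fun f' hf' => hfu f' ⟨hf'.1, ?_⟩⟩
  · rw [← cancel_mono (postcomp (u t ≫ M.map t (R.obj (J.obj t))) (F.obj t)), key hf, ← hgγ]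
    exact congrArg (· ≫ _) ((hfh _).trans (hhg t))
  · refine congrFun (hhu (fun X => f' (R.obj X) ≫ precomp (η.app X) (M.obj (R.obj X)))
      ⟨(hf'.1.whiskerLeft R).precomp η, fun t => ?_⟩)
    have : IsIso (precomp (X := F.obj t) (Y := E.obj (J.obj t)) (e.app t)
      (M.obj (R.obj (J.obj t)))) := (he t).isIso_precomp _
    refine (cancel_mono (precomp (X := F.obj t) (Y := E.obj (J.obj t)) (e.app t)
      (M.obj (R.obj (J.obj t))))).1 ?_
    refine (key hf'.1 t).symm.trans (Eq.trans ?_ (hgγ t).symm)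
    exact congrArg (· ≫ _) (hf'.2 t)

/-- Every `F` has a reflection, obtained from the extension `X ↦ [T, V](X, F)`. -/
lemma exists_reflection_isModel (hΦ : IsLocallySmallClass Φ) (hA : AxiomA Φ)
    (hT : HasPhiLimits Φ T) (F : EnrichedFunctor V T V) :
    ∃ (L : EnrichedFunctor V T V) (r : 𝟙_ V ⟶ eHom V F L), IsModel Φ L ∧
      ∀ M, IsModel Φ M → IsIso (precomp r M) := by
  obtain ⟨R, ⟨adj⟩⟩ := exists_rightAdjoint_toFreeCompletion hT
  obtain ⟨L, η, hη, hL⟩ := exists_isLeftKan_isModel hΦ hA R (phiContinuous_freeExtension (Φ := Φ) F)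
  obtain ⟨ρ, hρ⟩ := exists_unit_eq adj (freeExtensionNat Φ F) η
  exact ⟨L, homLift ρ.app ρ.natural,
    isReflection_of_isLeftKan adj (freeExtensionNat_isIso F) hη hL hρ⟩

end

end EnrichedModels

end

noncomputable section

namespace EnrichedModels

/-! ### Colimits of models -/

section

variable {V : Type u} [Category.{v} V] [MonoidalCategory V] [BraidedCategory V]
  [MonoidalClosed V]

/-- A colimit in a reflective subcategory is the reflection of the colimit in the ambient
category. -/
lemma exists_isWeightedColimit_of_reflection {K : Type u₁} [EnrichedCategory V K] {P : K → Prop}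
    (hP : ∀ X : K, ∃ (L : K) (r : 𝟙_ V ⟶ eHom V X L), P L ∧ ∀ Y, P Y → IsIso (precomp r Y))
    {A : Type w} [EnrichedCategory V A] {W : EnrichedFunctor V Aᵒᵖ V}
    (hW : ∀ S : EnrichedFunctor V A K, ∃ C c, IsWeightedColimit W S C c)
    (S : EnrichedFunctor V A (FullSub P)) : ∃ C c, IsWeightedColimit W S C c := by
  -- `S` composed with the inclusion; unlike `S.comp V (FullSub.ι P)`, it has the same `map` as `S`
  let S₀ : EnrichedFunctor V A K :=
    { obj a := (S.obj a).obj
      map a b := S.map a b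
      map_id := S.map_id
      map_comp := S.map_comp }
  obtain ⟨C, c, hc⟩ := hW S₀
  obtain ⟨L, r, hL, hr⟩ := hP C
  have hc := (isWeightedLimit_op_iff (S := opFunctor S₀) c).1 hc
  let c' : ∀ a : Aᵒᵖ, W.obj a ⟶ eHom V (S.obj a.unop).obj L := fun a =>
    c a ≫ postcomp r (S.obj a.unop).obj
  have hc' : IsWeightedCone W (opFunctor S₀) (op L) c' := by
    refine (isWeightedCone_op_iff (S := opFunctor S₀) c').2 fun a b => ?_
    refine ((Category.assoc _ _ _).symm.trans (congrArg (· ≫ postcomp r _)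
      ((isWeightedCone_op_iff (S := opFunctor S₀) c).1 hc.1 a b))).trans ?_
    refine (Category.assoc _ _ _).trans (congrArg (_ ≫ ·) ?_)
    exact (elemComp_comp_postcomp (S.map b.unop a.unop) (c a) r).symm
  refine ⟨⟨L, hL⟩, c', (isWeightedLimit_op_iff (S := opFunctor S)
    (C := (⟨L, hL⟩ : FullSub P)) c').2 ⟨hc', fun Y Z d hd => ?_⟩⟩
  have := hr Y.obj Y.property
  obtain ⟨f, hf, hu⟩ := hc.2 Y.obj Z d hd
  have key : ∀ (g : Z ⟶ eHom V L Y.obj) a, (β_ _ _).hom ≫ (c' a ⊙ g) =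
      (β_ _ _).hom ≫ (c a ⊙ (g ≫ precomp r Y.obj)) := fun g a =>
    congrArg (_ ≫ ·) (comp_postcomp_elemComp _ _ _)
  obtain ⟨g, hg, hgu⟩ := existsUnique_comp_eq (precomp r Y.obj) f
  refine ⟨g, fun a => (key g a).trans (by rw [hg]; exact hf a), fun g' hg' =>
    hgu g' (hu _ fun a => (key g' a).symm.trans (hg' a))⟩

end

section

variable {V : Type u} [Category.{v} V] [MonoidalCategory V] [SymmetricCategory V]
variable {C : Type u₁} [EnrichedCategory V C] {D : Type u₂} [EnrichedCategory V D]

/-- The naturality square of a family of transformations at a generalized element. -/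
lemma IsNatFamily.elemComp_eq {F G : EnrichedFunctor V C D} {Z Q : V}
    {s : ∀ a, Z ⟶ eHom V (F.obj a) (G.obj a)} (h : IsNatFamily F G Z s) {a b : C}
    (q : Q ⟶ eHom V a b) :
    (q ≫ F.map a b) ⊙ s b = (β_ _ _).hom ≫ (s a ⊙ (q ≫ G.map a b)) := by
  rw [elemComp_comp, ← h.eq, braiding_naturality_right_assoc, SymmetricCategory.symmetry_assoc,
    comp_elemComp]

end

section

variable {V : Type u} [Category.{v} V] [MonoidalCategory V] [SymmetricCategory V]
  [MonoidalClosed V] [HasLimits V] {T : Type v} [EnrichedCategory V T]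

/-- The `V`-functor `A ⊗ B → V` sending `(a, b)` to `D b (S a)`. -/
def evalBifunctor {A : Type u₁} [EnrichedCategory V A] {B : Type u₂} [EnrichedCategory V B]
    (S : EnrichedFunctor V A T) (D : EnrichedFunctor V B (EnrichedFunctor V T V)) :
    Bifunctor V A B V where
  obj a b := (D.obj b).obj (S.obj a)
  mapL a a' b := (S.comp V (D.obj b)).map a a'
  mapR a b b' := (D.comp V (evalAt (S.obj a))).map b b'
  mapL_id a b := (S.comp V (D.obj b)).map_id a
  mapR_id a b := (D.comp V (evalAt (S.obj a))).map_id b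
  mapL_comp a a' a'' b := (S.comp V (D.obj b)).map_comp a a' a''
  mapR_comp a b b' b'' := (D.comp V (evalAt (S.obj a))).map_comp b b' b''
  interchange a a' b b' := (isNatFamily_comp_homπ (D.map b b')).elemComp_eq (S.map a a')

variable [HasColimits V]

/-- Let `C` be the colimit of models `D` weighted by a flat weight `G`, and `d` a limit `{F, S}`
in `T`. Since colimits in `[T, V]` are pointwise, `C d` is the `G`-weighted colimit of the limits
`D b d = {F, D b S}`, and by flatness this is the limit of the colimits `C (S a)`. -/
lemma closedUnderColimits_isModel (Φ : WeightClass.{w} V) :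
    ClosedUnderColimits.{w₃} V (IsModel Φ (T := T)) (fun W => IsFlat Φ W) := by
  intro B _ G hG hflat D hD C c hc A _ F hF S d l hl
  -- `Y` is the limit `{F, C S}`, and flatness makes the comparison map `k : C d ⟶ Y` invertible
  obtain ⟨Y, y, hy⟩ := exists_isWeightedLimit_of_isWeight
    (fun B _ W S => exists_isWeightedLimit_base W S) F (Φ.isWeight _ hF) (S.comp V C)
  obtain ⟨k, hk⟩ := hy.exists_lift (hl.1.map C)
  refine hy.of_isIsoArrow' (hflat A F hF (evalBifunctor S D)
    (D.comp V (evalAt d)) (fun b a => l a ≫ (D.obj b).map d (S.obj a))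
    (fun b => hD b A F hF S d l hl)
    (fun a b b' => (isNatFamily_comp_homπ (D.map b b')).elemComp_eq (l a))
    (S.comp V C) (fun a b => c b ≫ homπ (D.obj b.unop) C (S.obj a))
    (fun a => hG.map_evalAt_op hc (S.obj a))
    (fun a a' b => ?_)
    (C.obj d) (fun b => c b ≫ homπ (D.obj b.unop) C d) (hG.map_evalAt_op hc d)
    Y y hy k fun a b => ?_) hk
  · have h := (isNatFamily_comp_homπ (F := D.obj b.unop) (G := C) (c b)).elemComp_eq (S.map a a')
    refine Eq.trans ?_ (congrArg ((β_ _ _).hom ≫ ·) h).symm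
    exact (SymmetricCategory.symmetry_assoc _ _ _).symm
  · refine ((isNatFamily_comp_homπ (F := D.obj b.unop) (G := C) (c b)).elemComp_eq (l a)).trans ?_
    exact congrArg (fun z => (β_ _ _).hom ≫ elemComp (c b ≫ homπ (D.obj b.unop) C d) z)
      (hk a).symm

/-- Colimits of models are reflections of the pointwise colimits. -/
lemma isVCocomplete_phiMod {Φ : WeightClass.{w} V} (hΦ : IsLocallySmallClass Φ) (hA : AxiomA Φ)
    (hT : HasPhiLimits Φ T) : IsVCocomplete.{w₁} V (PhiMod Φ T) := by
  intro A _ W hW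
  refine exists_isWeightedColimit_of_reflection (exists_reflection_isModel hΦ hA hT) fun S => ?_
  obtain ⟨L, c, hc, -⟩ := hW.exists_colimit (opFunctor S)
  exact ⟨L.unop, c, hc⟩

end

end EnrichedModels

end

theorem mainTheorem7 {V : Type u} [Category.{v} V] [MonoidalCategory V] [SymmetricCategory V]
    [MonoidalClosed V] [HasLimits V] [HasColimits V]
    (Φ : WeightClass.{w} V) (hΦ : IsLocallySmallClass Φ) (hA : AxiomA Φ)
    (T : Type v) [EnrichedCategory V T] (hT : HasPhiLimits Φ T) :
    -- the models form a full reflective subcategory of `[T, V]`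
    IsReflective V (IsModel Φ (T := T)) ∧
    -- the inclusion `T → FT` has a right adjoint
    (∃ R : EnrichedFunctor V (FreeCompletion Φ T) T,
      Nonempty (VAdjunction (toFreeCompletion Φ T) R)) ∧
    -- every `F : T → V` extends to a `Φ`-continuous `V`-functor on `FT`
    (∀ F : EnrichedFunctor V T V, ∃ E : EnrichedFunctor V (FreeCompletion Φ T) V,
      PhiContinuous Φ E ∧ ∃ e : VNat F ((toFreeCompletion Φ T).comp V E), e.IsIso) ∧
    -- the left Kan extension of this extension along the right adjoint is the reflection of `F`
    (∀ (R : EnrichedFunctor V (FreeCompletion Φ T) T) (adj : VAdjunction (toFreeCompletion Φ T) R)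
      (F : EnrichedFunctor V T V) (E : EnrichedFunctor V (FreeCompletion Φ T) V)
      (e : VNat F ((toFreeCompletion Φ T).comp V E)), PhiContinuous Φ E → e.IsIso →
      ∃ (L : EnrichedFunctor V T V) (η : VNat E (R.comp V L)), IsLeftKan R E L η ∧
        ∃ ρ : VNat F L,
          (∀ t, arrowComp (e.app t) (η.app ((toFreeCompletion Φ T).obj t)) =
            arrowComp (ρ.app t) (adj.unit.app t ≫ L.map _ _)) ∧
          IsReflectionIntoModels Φ ρ) ∧
    -- the models are complete and cocomplete
    IsVComplete.{w₁} V (PhiMod Φ T) ∧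
    IsVCocomplete.{w₁} V (PhiMod Φ T) ∧
    -- the models are closed in `[T, V]` under limits and under `Φ`-flat colimits
    ClosedUnderLimits.{w₂} V (IsModel Φ (T := T)) ∧
    ClosedUnderColimits.{w₃} V (IsModel Φ (T := T)) (fun W => IsFlat Φ W) := by
  refine ⟨isReflective_of_pointwise (exists_reflection_isModel hΦ hA hT),
    exists_rightAdjoint_toFreeCompletion hT,
    fun F => ⟨freeExtension Φ F, phiContinuous_freeExtension F, freeExtensionNat Φ F,
      freeExtensionNat_isIso F⟩,
    fun R adj F E e hE he => ?_, isVComplete_phiMod Φ, isVCocomplete_phiMod hΦ hA hT,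
    closedUnderLimits_isModel Φ, closedUnderColimits_isModel Φ⟩
  obtain ⟨L, η, hη, hL⟩ := exists_isLeftKan_isModel hΦ hA R hE
  obtain ⟨ρ, hρ⟩ := exists_unit_eq adj e η
  exact ⟨L, η, hη, ρ, hρ, isReflection_of_isLeftKan adj he hη hL hρ⟩
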